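/- Model. Let $\lambda_b,\lambda_m,\lambda_r,R,A,T,P_m,P_b>0$, $\alpha>2$, $\sigma^2\ge 0$, $\tau_m\in\mathbb N$, and let $\ell(r)=Ar^{\alpha}$ be the path loss, $\mathrm{SNR}^{-1}=\sigma^2/P_m$, $\mathrm{SNR}_c^{-1}=\sigma^2/P_b$. In $\mathbb R^2$, the base stations form a homogeneous Poisson point process $\Phi_b$ of intensity $\lambda_b$ and the multicast transmitters a homogeneous Poisson point process $\Phi_m$ of intensity $\lambda_m$. Each transmitter $x\in\Phi_m$ has a point process $\Phi_{m,x}$ of intended receivers which, conditionally on $\Phi_m$, has intensity measure $\lambda_r$ times Lebesgue measure on the ball $B(x,R)$; nothing else is assumed about its law. The fading variables $F$ of all links (from each transmitter to each receiver at each time, and from each base station to each receiver) are i.i.d. exponential with mean $1$. The pair ($\Phi_m$, all receiver processes), the process $\Phi_b$, the transmitter–receiver fading and the base-station–receiver fading are mutually independent. For a receiver $y$ of the transmitter $x_0$ put $$\mathrm{SINR}_{y,x_0}(n)=\frac{F_{y,x_0}(n)/\ell(\|y-x_0\|)}{\mathrm{SNR}^{-1}+\sum_{x\in\Phi_m\setminus\{x_0\}}F_{y,x}(n)/\ell(\|x-y\|)},\qquad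 n=1,\dots,\tau_m .$$ Let $z_0$ be the base station nearest to $x_0$. Under the approximation that the distance from each base station to $y$ is replaced by its distance to $x_0$, put $$\mathrm{SINR}^{(c)}_{y,z_0}=\frac{F_{y,z_0}/\ell(\|z_0-x_0\|)}{\mathrm{SNR}_c^{-1}+\sum_{z\in\Phi_b\setminus\{z_0\}}F_{y,z}/\ell(\|z-x_0\|)} .$$ The receiver is covered without network assistance if $\mathrm{SINR}_{y,x_0}(n)\ge T$ for some $n\in\{1,\dots,\tau_m\}$; it is covered by the base station if $\mathrm{SINR}^{(c)}_{y,z_0}\ge T$; it is covered with network assistance if at least one of the two happens. Let $\mathbb P^o,\mathbb E^o$ be the Palm probability and expectation with respect to $\Phi_m$, i.e. averages over the transmitters in a window: for every Borel set $W$ with $0<|W|<\infty$, $\mathbb E^o[f]=\frac1{\lambda_m|W|}\mathbb E\sum_{x\in\Phi_m\cap W}f_x$, where $f_x$ is the quantity $f$ seen from the transmitter $x$. Let $p(y)$ and $\tilde p(y)$ be the $\mathbb P^o$-probabilities that a receiver displaced by $y\in\mathbb R^2$ from the typical transmitter is covered without and with network assistance, let $p_c$ be the $\mathbb P^o$-probability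 that a receiver of the typical transmitter is covered by the base station, and let $\mathbb E^o[N]$, $\mathbb E^o[\tilde N]$ be the mean numbers of covered receivers of the typical transmitter without and with network assistance. Proposition. For every $y\in\mathbb R^2$, $$\tilde p(y)=p(y)+p_c\,(1-p(y)),$$ where $$p(y)=\sum_{n=1}^{\tau_m}(-1)^{n+1}\binom{\tau_m}{n}\,e^{-n\ell(\|y\|)T\,\mathrm{SNR}^{-1}}\,\exp\Big(-2\pi\lambda_m\int_0^\infty\big(1-(1+T\ell(\|y\|)/\ell(r))^{-n}\big)\,r\,dr\Big),$$ $$p_c=2\pi\lambda_b\int_0^\infty e^{-T\,\mathrm{SNR}_c^{-1}Ar^\alpha}\,e^{-2\pi\lambda_bH(T,\alpha)r^2}\,e^{-\lambda_b\pi r^2}\,r\,dr,\qquad H(T,\alpha)=\int_1^\infty\frac{x}{1+x^\alpha/T}\,dx ;$$ these numbers lie in $[0,1]$. Moreover $\mathbb E^o[N]=\lambda_r\int_{B(0,R)}p(y)\,dy$ and $\mathbb E^o[\tilde N]$ are finite, and $$\mathbb E^o[\tilde N]=\mathbb E^o[N]+p_c\,\big(\lambda_r\pi R^2-\mathbb E^o[N]\big).$$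 In particular none of these quantities depends on the window $W$. -/

import Mathlib

open MeasureTheory ProbabilityTheory
open scoped ENNReal

namespace MulticastD2D

/-- The Euclidean plane. -/
abbrev Plane : Type := EuclideanSpace ℝ (Fin 2)

/-- The numerical parameters of the network. -/
structure Params where
  /-- intensity of the base stations -/
  lamB : ℝ
  /-- intensity of the multicast transmitters -/
  lamM : ℝ
  /-- intensity of the receivers inside a cluster -/
  lamR : ℝ
  /-- cluster radius -/
  R : ℝ
  /-- path-loss constant -/
  A : ℝ
  /-- path-loss exponent -/
  α : ℝ
  /-- detection threshold -/
  T : ℝ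
  /-- transmit power of a multicast transmitter -/
  Pm : ℝ
  /-- transmit power of a base station -/
  Pb : ℝ
  /-- noise power (zero is allowed: the noise-free network) -/
  noise : ℝ
  /-- number of multicast transmissions of each message -/
  τ : ℕ
  lamB_pos : 0 < lamB
  lamM_pos : 0 < lamM
  lamR_pos : 0 < lamR
  R_pos : 0 < R
  A_pos : 0 < A
  two_lt_α : 2 < α
  T_pos : 0 < T
  Pm_pos : 0 < Pm
  Pb_pos : 0 < Pb
  noise_nonneg : 0 ≤ noise

namespace Params

/-- The path loss `ℓ(r) = A r ^ α` at distance `r`. -/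
noncomputable def loss (c : Params) (r : ℝ) : ℝ := c.A * r ^ c.α

/-- `SNR⁻¹ = σ² / P_m`. -/
noncomputable def invSNR (c : Params) : ℝ := c.noise / c.Pm

/-- `SNR_c⁻¹ = σ² / P_b`. -/
noncomputable def invSNRc (c : Params) : ℝ := c.noise / c.Pb

/-- The closed form `p(y)` of the coverage probability without network assistance of a receiver
displaced by `y` from its transmitter. -/
noncomputable def p (c : Params) (y : Plane) : ℝ :=
  ∑ n ∈ Finset.Icc 1 c.τ,
    (-1 : ℝ) ^ (n + 1) * (c.τ.choose n : ℝ) *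
      Real.exp (-((n : ℝ) * c.loss ‖y‖ * c.T * c.invSNR)) *
      Real.exp (-(2 * Real.pi * c.lamM *
        ∫ r in Set.Ioi (0 : ℝ), (1 - ((1 + c.T * c.loss ‖y‖ / c.loss r) ^ n)⁻¹) * r))

/-- `H(T, α) = ∫₁^∞ x / (1 + x ^ α / T) dx`. -/
noncomputable def H (c : Params) : ℝ :=
  ∫ x in Set.Ioi (1 : ℝ), x / (1 + x ^ c.α / c.T)

/-- The closed form `p_c` of the probability of being covered by the serving base station. -/
noncomputable def pc (c : Params) : ℝ :=
  2 * Real.pi * c.lamB *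
    ∫ r in Set.Ioi (0 : ℝ),
      Real.exp (-(c.T * c.invSNRc * c.A * r ^ c.α)) *
      Real.exp (-(2 * Real.pi * c.lamB * c.H * r ^ 2)) *
      Real.exp (-(c.lamB * Real.pi * r ^ 2)) * r

end Params

variable {Ω : Type*} [MeasurableSpace Ω]

/-- The number of indices `i` with `X i ω ∈ S`, that is, the mass that the random counting measure
`∑ i, δ_{X i}` gives to `S`. -/
noncomputable def count (X : ℕ → Ω → Plane) (S : Set Plane) (ω : Ω) : ℕ∞ :=
  {i | X i ω ∈ S}.encard

/-- The random counting measure `∑ i, δ_{X i}` is a homogeneous Poisson point process of intensity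
`lam > 0` on the plane: the number of points in a measurable set of finite area is Poisson with
mean `lam` times the area, and the numbers of points in finitely many disjoint sets are
independent. (Such a process almost surely has infinitely many points, so that its points can be
listed as a sequence.) -/
structure IsPoissonProcess (P : Measure Ω) (X : ℕ → Ω → Plane) (lam : ℝ) : Prop where
  measurable : ∀ i, Measurable (X i)
  count_law : ∀ S : Set Plane, MeasurableSet S → volume S ≠ ∞ → ∀ n : ℕ,
    P {ω | count X S ω = n} =
      ENNReal.ofReal (Real.exp (-(lam * volume.real S)) * (lam * volume.real S) ^ n /
        (n.factorial : ℝ))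
  count_indep : ∀ (m : ℕ) (S : Fin m → Set Plane), (∀ l, MeasurableSet (S l)) →
    (∀ l, volume (S l) ≠ ∞) → Pairwise (fun l l' => Disjoint (S l) (S l')) →
    iIndepFun (fun l => count X (S l)) P

/-- The random elements of the hybrid network. -/
structure Network (Ω : Type*) where
  /-- position of the `i`-th multicast transmitter -/
  X : ℕ → Ω → Plane
  /-- position of the `j`-th base station -/
  Z : ℕ → Ω → Plane
  /-- number of intended receivers of transmitter `i` -/
  K : ℕ → Ω → ℕ
  /-- position of receiver `k` of transmitter `i`; it exists if `k < K i` -/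
  Y : ℕ → ℕ → Ω → Plane
  /-- `F i k j n`: fading from transmitter `j` to receiver `k` of transmitter `i` at time `n` -/
  F : ℕ → ℕ → ℕ → ℕ → Ω → ℝ
  /-- `G i k j`: fading from base station `j` to receiver `k` of transmitter `i` -/
  G : ℕ → ℕ → ℕ → Ω → ℝ

namespace Network

/-- All the transmitter positions. -/
def transmitters (N : Network Ω) (ω : Ω) : ℕ → Plane := fun i => N.X i ω

/-- The number of receivers in cluster `i` that lie in `S`. -/
noncomputable def receiverCount (N : Network Ω) (i : ℕ) (S : Set Plane) (ω : Ω) : ℝ≥0∞ :=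
  ∑ k ∈ Finset.range (N.K i ω), S.indicator 1 (N.Y i k ω)

/-- Transmitters together with their receiver clusters. -/
def clusters (N : Network Ω) (ω : Ω) : (ℕ → Plane) × (ℕ → ℕ) × (ℕ → ℕ → Plane) :=
  (fun i => N.X i ω, fun i => N.K i ω, fun i k => N.Y i k ω)

/-- All the base station positions. -/
def stations (N : Network Ω) (ω : Ω) : ℕ → Plane := fun j => N.Z j ω

/-- All the fading variables of the links from transmitters to receivers. -/
def fading (N : Network Ω) (ω : Ω) : ℕ → ℕ → ℕ → ℕ → ℝ := fun i k j n => N.F i k j n ω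

/-- All the fading variables of the links from base stations to receivers. -/
def fadingDown (N : Network Ω) (ω : Ω) : ℕ → ℕ → ℕ → ℝ := fun i k j => N.G i k j ω

/-- The probabilistic assumptions of the model. -/
structure IsModel (N : Network Ω) (c : Params) (P : Measure Ω) : Prop where
  poisson_X : IsPoissonProcess P N.X c.lamM
  poisson_Z : IsPoissonProcess P N.Z c.lamB
  measurable_K : ∀ i, Measurable (N.K i)
  measurable_Y : ∀ i k, Measurable (N.Y i k)
  /-- Conditionally on the transmitters, the point process of receivers of transmitter `i` has
  intensity measure `lamR` times Lebesgue measure on the ball of radius `R` around it. Nothing else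
  is required of its law. -/
  intensity : ∀ (i : ℕ) (S : Set Plane) (C : Set (ℕ → Plane)), MeasurableSet S → MeasurableSet C →
    ∫⁻ ω in N.transmitters ⁻¹' C, N.receiverCount i S ω ∂P =
      ∫⁻ ω in N.transmitters ⁻¹' C,
        ENNReal.ofReal c.lamR * volume (S ∩ Metric.closedBall (N.X i ω) c.R) ∂P
  /-- All fading variables have the exponential law with mean one and are independent. -/
  measurable_F : ∀ i k j n, Measurable (N.F i k j n)
  measurable_G : ∀ i k j, Measurable (N.G i k j)
  law_F : ∀ i k j n, P.map (N.F i k j n) = expMeasure 1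
  law_G : ∀ i k j, P.map (N.G i k j) = expMeasure 1
  indep_F : iIndepFun (fun l : ℕ × ℕ × ℕ × ℕ => N.F l.1 l.2.1 l.2.2.1 l.2.2.2) P
  indep_G : iIndepFun (fun l : ℕ × ℕ × ℕ => N.G l.1 l.2.1 l.2.2) P
  /-- Clusters, base stations, and the two families of fading variables are (mutually)
  independent. -/
  indep_clusters : IndepFun N.clusters (fun ω => (N.stations ω, N.fading ω, N.fadingDown ω)) P
  indep_stations : IndepFun N.stations (fun ω => (N.fading ω, N.fadingDown ω)) P
  indep_fading : IndepFun N.fading N.fadingDown P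

/-- Expectation under the Palm probability of the transmitter process. Here `f i` is the quantity
of interest, as seen from the `i`-th transmitter, and `B` is the averaging window:
`E[∑_{i : X i ∈ B} f i] / (lamM * |B|)`. -/
noncomputable def palm (N : Network Ω) (c : Params) (P : Measure Ω) (B : Set Plane)
    (f : ℕ → Ω → ℝ≥0∞) : ℝ≥0∞ :=
  (∫⁻ ω, ∑' i, B.indicator 1 (N.X i ω) * f i ω ∂P) / (ENNReal.ofReal c.lamM * volume B)

/-- The Palm probability of an event `S i` seen from the typical transmitter. -/
noncomputable def palmProb (N : Network Ω) (c : Params) (P : Measure Ω) (B : Set Plane)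
    (S : ℕ → Set Ω) : ℝ≥0∞ :=
  N.palm c P B fun i ω => (S i).indicator 1 ω

/-- SINR at time `n` of the link from transmitter `i` to its receiver with label `k`, when this
receiver is located at `w`. It takes values in `[0, ∞]`. -/
noncomputable def sinr (N : Network Ω) (c : Params) (i k n : ℕ) (w : Plane) (ω : Ω) : ℝ≥0∞ :=
  (ENNReal.ofReal (N.F i k i n ω) / ENNReal.ofReal (c.loss (dist w (N.X i ω)))) /
    (ENNReal.ofReal c.invSNR +
      ∑' j, if j = i then 0 else
        ENNReal.ofReal (N.F i k j n ω) / ENNReal.ofReal (c.loss (dist w (N.X j ω))))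

/-- SINR of the link from base station `s` to the receiver with label `k` of transmitter `i`, when
the distances to the base stations are measured from `w`; all the other base stations interfere. -/
noncomputable def sinrDown (N : Network Ω) (c : Params) (i k s : ℕ) (w : Plane) (ω : Ω) : ℝ≥0∞ :=
  (ENNReal.ofReal (N.G i k s ω) / ENNReal.ofReal (c.loss (dist w (N.Z s ω)))) /
    (ENNReal.ofReal c.invSNRc +
      ∑' j, if j = s then 0 else
        ENNReal.ofReal (N.G i k j ω) / ENNReal.ofReal (c.loss (dist w (N.Z j ω))))

/-- Base station `s` is the serving, that is, the nearest base station of transmitter `i`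
(almost surely there is exactly one). -/
def IsServing (N : Network Ω) (i s : ℕ) (ω : Ω) : Prop :=
  ∀ j, dist (N.X i ω) (N.Z s ω) ≤ dist (N.X i ω) (N.Z j ω)

/-- In one of the `τ` transmissions, transmitter `i` covers its receiver with label `k`, located
at `w`. -/
def CoveredD2D (N : Network Ω) (c : Params) (i k : ℕ) (w : Plane) (ω : Ω) : Prop :=
  ∃ n ∈ Finset.Icc 1 c.τ, ENNReal.ofReal c.T ≤ N.sinr c i k n w ω

/-- The serving base station of transmitter `i` covers the receiver with label `k` of this
transmitter, under the approximation that the distances from the base stations to the receiver are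
those to the transmitter; they are therefore measured from `X i`. -/
def CoveredBS (N : Network Ω) (c : Params) (i k : ℕ) (ω : Ω) : Prop :=
  ∃ s, N.IsServing i s ω ∧ ENNReal.ofReal c.T ≤ N.sinrDown c i k s (N.X i ω) ω

/-- Coverage with network assistance. -/
def CoveredAssisted (N : Network Ω) (c : Params) (i k : ℕ) (w : Plane) (ω : Ω) : Prop :=
  N.CoveredD2D c i k w ω ∨ N.CoveredBS c i k ω

/-- Coverage probability without network assistance of a receiver (with label `k`) displaced by `y`
from the typical transmitter. -/
noncomputable def coverageProb (N : Network Ω) (c : Params) (P : Measure Ω) (B : Set Plane)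
    (k : ℕ) (y : Plane) : ℝ≥0∞ :=
  N.palmProb c P B fun i => {ω | N.CoveredD2D c i k (N.X i ω + y) ω}

/-- Probability that a receiver (with label `k`) of the typical transmitter is covered by the
serving base station. -/
noncomputable def coverageProbBS (N : Network Ω) (c : Params) (P : Measure Ω) (B : Set Plane)
    (k : ℕ) : ℝ≥0∞ :=
  N.palmProb c P B fun i => {ω | N.CoveredBS c i k ω}

/-- Coverage probability with network assistance of a receiver (with label `k`) displaced by `y`
from the typical transmitter. -/
noncomputable def coverageProbAssisted (N : Network Ω) (c : Params) (P : Measure Ω)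
    (B : Set Plane) (k : ℕ) (y : Plane) : ℝ≥0∞ :=
  N.palmProb c P B fun i => {ω | N.CoveredAssisted c i k (N.X i ω + y) ω}

/-- Mean number of covered receivers of the typical transmitter, without network assistance. -/
noncomputable def meanCovered (N : Network Ω) (c : Params) (P : Measure Ω) (B : Set Plane) :
    ℝ≥0∞ :=
  N.palm c P B fun i ω => ∑ k ∈ Finset.range (N.K i ω),
    {ω' | N.CoveredD2D c i k (N.Y i k ω') ω'}.indicator 1 ω

/-- Mean number of covered receivers of the typical transmitter, with network assistance. -/
noncomputable def meanCoveredAssisted (N : Network Ω) (c : Params) (P : Measure Ω)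
    (B : Set Plane) : ℝ≥0∞ :=
  N.palm c P B fun i ω => ∑ k ∈ Finset.range (N.K i ω),
    {ω' | N.CoveredAssisted c i k (N.Y i k ω') ω'}.indicator 1 ω

end Network

end MulticastD2D

namespace MulticastD2D

open Filter Topology

/-! Everything rests on three facts about Poisson processes and exponential variables, all stated in
`[0, ∞]` so that no convergence has to be known in advance. Fading: an exponential variable exceeds
an independent quantity `S` with probability `E[e^{-S}]`, and `E[e^{-sF}] = 1 / (1 + s)`. For fixed
positions the success probability of a link is therefore the exponential of minus a sum over the
interferers (`measure_interference_le`, `measure_le_sinrOf`), and the transmissions at different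
times are conditionally independent. Laplace functional: `E[exp(-∑ g(X_j))] = exp(-λ ∫ (1 -
e^{-g}))` (`lintegral_expNeg_tsum`), proved for simple functions from the independent counts and
extended by monotone approximation. Mecke formula: summing over the points a function of the point
and of an additive statistic of the other points amounts to integrating over the position with the
whole process as the other points (`mecke`). It comes from the identity `n p_n = a p_{n-1}` for
Poisson weights, first for counts in disjoint sets, then for the law of the random counting measure
in a window, then in the limit of large windows.

Given the positions, direct coverage has probability `1 - (1 - q)^τ`, where `q` is the success
probability of one transmission. The Mecke formula for the transmitters and the moments of `q`,
which are Laplace functionals, give `p` (`lintegral_condCoverage`). A displacement of zero is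
treated by a limit, because the path loss vanishes there. For the base stations, the Mecke formula
sums over the candidates for the nearest station; an interferer nearer than the candidate gets
infinite exponent, so one Laplace functional accounts both for the empty disc and for the
interference outside it (`lintegral_measure_coveredDown`). The result is `pc` whatever the position
of the transmitter, so coverage by the station is independent of clusters and direct fading
(`lintegral_mul_coveredBS`). This yields the decomposition behind both assisted formulas
(`lintegral_mul_coveredAssisted`). For the mean numbers, conditional coverage depends on a cluster
only through the transmitters and the position of the one receiver considered, so the conditional
intensity is all that is needed (`lintegral_tsum_receivers`). -/

/-! ### Exponential and logarithm on `[0, ∞]` -/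

/-- The function `a ↦ e^{-a}` on `[0, ∞]`. -/
noncomputable def expNeg (a : ℝ≥0∞) : ℝ≥0∞ := EReal.exp (-(a : EReal))

@[simp] lemma expNeg_zero : expNeg 0 = 1 := by simp [expNeg]

@[simp] lemma expNeg_top : expNeg ∞ = 0 := by simp [expNeg]

lemma expNeg_add (a b : ℝ≥0∞) : expNeg (a + b) = expNeg a * expNeg b := by
  unfold expNeg
  rw [EReal.coe_ennreal_add, EReal.neg_add (by simp) (by simp), sub_eq_add_neg, EReal.exp_add]

lemma expNeg_ofReal {a : ℝ} (ha : 0 ≤ a) :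
    expNeg (ENNReal.ofReal a) = ENNReal.ofReal (Real.exp (-a)) := by
  unfold expNeg
  rw [EReal.coe_ennreal_ofReal, max_eq_left ha, ← EReal.coe_neg, EReal.exp_coe]

lemma expNeg_anti : Antitone expNeg := fun a b h => by
  unfold expNeg
  rw [EReal.exp_le_exp_iff, EReal.neg_le_neg_iff]
  exact_mod_cast h

lemma expNeg_le_one (a : ℝ≥0∞) : expNeg a ≤ 1 := by
  simpa using expNeg_anti (zero_le (a := a))

lemma expNeg_ne_top (a : ℝ≥0∞) : expNeg a ≠ ∞ := ((expNeg_le_one a).trans_lt (by simp)).ne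

lemma continuous_expNeg : Continuous expNeg :=
  ENNReal.continuous_exp.comp (continuous_neg.comp continuous_coe_ennreal_ereal)

@[fun_prop] lemma measurable_expNeg : Measurable expNeg := continuous_expNeg.measurable

lemma expNeg_sum {ι : Type*} (s : Finset ι) (a : ι → ℝ≥0∞) :
    expNeg (∑ i ∈ s, a i) = ∏ i ∈ s, expNeg (a i) := by
  classical
  induction s using Finset.induction_on with
  | empty => simp
  | insert i s hi ih => rw [Finset.sum_insert hi, Finset.prod_insert hi, expNeg_add, ih]

lemma expNeg_natCast_mul (n : ℕ) (a : ℝ≥0∞) : expNeg (n * a) = expNeg a ^ n := by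
  induction n with
  | zero => simp
  | succ n ih => rw [pow_succ, ← ih, ← expNeg_add]; push_cast; ring_nf

/-- The function `b ↦ log (1 + b)` on `[0, ∞]`. -/
noncomputable def logOneAdd (b : ℝ≥0∞) : ℝ≥0∞ := (ENNReal.log (1 + b)).toENNReal

lemma expNeg_logOneAdd (b : ℝ≥0∞) : expNeg (logOneAdd b) = (1 + b)⁻¹ := by
  unfold expNeg logOneAdd
  have h : 0 ≤ ENNReal.log (1 + b) := by
    rw [← ENNReal.log_one]; exact ENNReal.log_monotone (by simp)
  rw [EReal.coe_toENNReal h, EReal.exp_neg, ENNReal.exp_log]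

@[fun_prop] lemma measurable_logOneAdd : Measurable logOneAdd := by
  unfold logOneAdd
  exact (ENNReal.measurable_log.comp (measurable_const.add measurable_id)).ereal_toENNReal

/-! ### Exponential variables and Rayleigh fading -/

instance : IsProbabilityMeasure (expMeasure 1) := isProbabilityMeasure_expMeasure one_pos

lemma expMeasure_le_ofReal (a : ℝ≥0∞) :
    expMeasure 1 {x | a ≤ ENNReal.ofReal x} = expNeg a := by
  rcases eq_or_ne a ∞ with rfl | ha
  · simp
  rcases eq_or_ne a 0 with rfl | ha0
  · simp
  obtain ⟨r, hr, rfl⟩ : ∃ r : ℝ, 0 < r ∧ a = ENNReal.ofReal r :=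
    ⟨a.toReal, ENNReal.toReal_pos ha0 ha, (ENNReal.ofReal_toReal ha).symm⟩
  have h1 : {x | ENNReal.ofReal r ≤ ENNReal.ofReal x} = Set.Ici r := by
    ext x
    simp only [Set.mem_ofPred_eq, Set.mem_Ici]
    refine ⟨fun h => ?_, fun h => ENNReal.ofReal_le_ofReal h⟩
    by_contra! hx
    exact absurd h (not_le.2 ((ENNReal.ofReal_lt_ofReal_iff hr).2 hx))
  have : NullSingletonClass (expMeasure 1) :=
    inferInstanceAs (NullSingletonClass (volume.withDensity (exponentialPDF 1)))
  rw [h1, ← measure_congr (Ioi_ae_eq_Ici (a := r)), ← Set.compl_Iic,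
    prob_compl_eq_one_sub measurableSet_Iic, ← ofReal_cdf, cdf_expMeasure_eq one_pos,
    if_pos hr.le, expNeg_ofReal hr.le, ← ENNReal.ofReal_one,
    ← ENNReal.ofReal_sub _ (by simp [hr.le])]
  simp

lemma ae_expMeasure_pos : ∀ᵐ x ∂(expMeasure 1), 0 < x := by
  have h : expMeasure 1 (Set.Iic 0) = 0 := by
    rw [← ofReal_cdf, cdf_expMeasure_eq one_pos]; simp
  rw [ae_iff]
  simpa [Set.Iic] using h

/-- Tilting the unit exponential density by `e^{-sx}` gives `(1 + s)⁻¹` times the exponential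
density of rate `1 + s`. For `s = ∞` the integrand is zero only where `x > 0`, since `∞ * 0 = 0`;
hence the almost sure positivity. -/
lemma lintegral_expNeg_expMeasure (s : ℝ≥0∞) :
    ∫⁻ x, expNeg (s * ENNReal.ofReal x) ∂(expMeasure 1) = (1 + s)⁻¹ := by
  rcases eq_or_ne s ∞ with rfl | hs
  · rw [lintegral_congr_ae (g := fun _ => 0)]
    · simp
    · filter_upwards [ae_expMeasure_pos] with x hx
      rw [ENNReal.top_mul (by simpa using hx), expNeg_top]
  lift s to NNReal using hs
  have h1 : (0 : ℝ) < 1 + s := by positivity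
  have hpdf : Measurable (exponentialPDF 1) := (measurable_exponentialPDFReal 1).ennreal_ofReal
  have key : ∀ x, exponentialPDF 1 x * expNeg (s * ENNReal.ofReal x) =
      (1 + (s : ℝ≥0∞))⁻¹ * exponentialPDF (1 + s) x := by
    intro x
    rcases lt_or_ge x 0 with hx | hx
    · simp [exponentialPDF_of_neg hx]
    · rw [exponentialPDF_of_nonneg hx, exponentialPDF_of_nonneg hx,
        ← ENNReal.ofReal_coe_nnreal, ← ENNReal.ofReal_mul s.coe_nonneg, expNeg_ofReal (by positivity),
        ENNReal.ofReal_mul h1.le, ← mul_assoc, ← ENNReal.ofReal_one,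
        ← ENNReal.ofReal_add zero_le_one s.coe_nonneg, ENNReal.inv_mul_cancel (by simpa using h1) (by simp),
        one_mul, ← ENNReal.ofReal_mul (by positivity), one_mul, one_mul, ← Real.exp_add]
      congr 2
      ring
  have hm : expMeasure 1 = volume.withDensity (exponentialPDF 1) := rfl
  rw [hm, lintegral_withDensity_eq_lintegral_mul _ hpdf (by fun_prop)]
  simp only [Pi.mul_apply, key]
  rw [lintegral_const_mul' _ _ (by simp), lintegral_exponentialPDF_eq_one h1, mul_one]

section Fading

variable {Ω : Type*} [MeasurableSpace Ω] {P : Measure Ω} [IsProbabilityMeasure P]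

/-- By independence the joint law is a product; integrating out `E` first leaves the exponential
tail evaluated at `S`. -/
lemma measure_le_exp_of_indepFun {E : Ω → ℝ} {S : Ω → ℝ≥0∞} (hE : Measurable E)
    (hS : Measurable S) (hlaw : P.map E = expMeasure 1) (hind : IndepFun S E P) :
    P {ω | S ω ≤ ENNReal.ofReal (E ω)} = ∫⁻ ω, expNeg (S ω) ∂P := by
  have hset : MeasurableSet {q : ℝ≥0∞ × ℝ | q.1 ≤ ENNReal.ofReal q.2} :=
    measurableSet_le measurable_fst (by fun_prop)
  have h := (indepFun_iff_map_prod_eq_prod_map_map hS.aemeasurable hE.aemeasurable).1 hind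
  calc P {ω | S ω ≤ ENNReal.ofReal (E ω)}
      = P.map (fun ω => (S ω, E ω)) {q : ℝ≥0∞ × ℝ | q.1 ≤ ENNReal.ofReal q.2} := by
        rw [Measure.map_apply (hS.prodMk hE) hset]; rfl
    _ = ∫⁻ a, expMeasure 1 {x | a ≤ ENNReal.ofReal x} ∂(P.map S) := by
        rw [h, hlaw, Measure.prod_apply hset]; rfl
    _ = _ := by
        simp only [expMeasure_le_ofReal]
        rw [lintegral_map measurable_expNeg hS]

/-- With finitely many interferers the Laplace transform factorizes, and each factor is `(1 + b
j)⁻¹`, the value of `expNeg` at `logOneAdd (b j)`. Writing it this way keeps the result a single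
exponential of a sum. -/
lemma measure_finset_interference_le {E : ℕ → Ω → ℝ} (hE : ∀ j, Measurable (E j))
    (hlaw : ∀ j, P.map (E j) = expMeasure 1) (hind : iIndepFun E P) (i : ℕ) (a : ℝ≥0∞)
    (b : ℕ → ℝ≥0∞) (s : Finset ℕ) (hi : i ∉ s) :
    P {ω | a + ∑ j ∈ s, b j * ENNReal.ofReal (E j ω) ≤ ENNReal.ofReal (E i ω)} =
      expNeg (a + ∑ j ∈ s, logOneAdd (b j)) := by
  have hI : IndepFun (fun ω => a + ∑ j ∈ s, b j * ENNReal.ofReal (E j ω)) (E i) P := by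
    have h := hind.indepFun_finset s {i} (by simpa using hi) hE
    have hm : Measurable fun x : ({i} : Finset ℕ) → ℝ => x ⟨i, by simp⟩ := measurable_pi_apply _
    have h2 := h.comp (φ := fun x : s → ℝ => a + ∑ j : s, b j * ENNReal.ofReal (x j))
      (ψ := fun x : ({i} : Finset ℕ) → ℝ => x ⟨i, by simp⟩) (by fun_prop) hm
    convert h2 using 1
    · ext ω
      simp only [Function.comp]
      congr 1
      exact (Finset.sum_coe_sort s fun j => b j * ENNReal.ofReal (E j ω)).symm
    · rfl
  rw [measure_le_exp_of_indepFun (hE i) (by fun_prop) (hlaw i) hI]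
  simp only [expNeg_add, expNeg_sum]
  rw [lintegral_const_mul' _ _ (expNeg_ne_top a)]
  congr 1
  rw [lintegral_prod_eq_prod_lintegral_of_indepFun s
    (fun j ω => expNeg (b j * ENNReal.ofReal (E j ω)))
    (hind.comp (fun j x => expNeg (b j * ENNReal.ofReal x)) (fun j => by fun_prop))
    (fun j => by have := hE j; fun_prop)]
  refine Finset.prod_congr rfl fun j _ => ?_
  rw [expNeg_logOneAdd, ← lintegral_expNeg_expMeasure, ← hlaw j, lintegral_map (by fun_prop) (hE j)]

/-- Rayleigh fading: the success probability of a link is the Laplace transform of its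
interference. -/
lemma measure_interference_le {E : ℕ → Ω → ℝ} (hE : ∀ j, Measurable (E j))
    (hlaw : ∀ j, P.map (E j) = expMeasure 1) (hind : iIndepFun E P) (i : ℕ) (a : ℝ≥0∞)
    (b : ℕ → ℝ≥0∞) :
    P {ω | a + ∑' j, (if j = i then 0 else b j * ENNReal.ofReal (E j ω)) ≤
        ENNReal.ofReal (E i ω)} =
      expNeg (a + ∑' j, if j = i then 0 else logOneAdd (b j)) := by
  have hsum : ∀ (n : ℕ) (f : ℕ → ℝ≥0∞),
      ∑ j ∈ Finset.range n, (if j = i then 0 else f j) = ∑ j ∈ (Finset.range n).erase i, f j := by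
    intro n f
    rw [← Finset.filter_ne' (Finset.range n) i, Finset.sum_filter]
    exact Finset.sum_congr rfl fun j _ => by by_cases h : j = i <;> simp [h]
  -- A threshold is above an infinite sum of nonnegative terms iff it is above all partial sums, so
  -- the event is a decreasing intersection; continuity of `expNeg`, also at `∞`, gives the limit of
  -- the probabilities.
  let A : ℕ → Set Ω := fun n =>
    {ω | a + ∑ j ∈ (Finset.range n).erase i, b j * ENNReal.ofReal (E j ω) ≤ ENNReal.ofReal (E i ω)}
  have hA : ∀ n, P (A n) = expNeg (a + ∑ j ∈ (Finset.range n).erase i, logOneAdd (b j)) :=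
    fun n => measure_finset_interference_le hE hlaw hind i a b _ (by simp)
  have hAmeas : ∀ n, MeasurableSet (A n) := fun n =>
    measurableSet_le (by fun_prop) (by have := hE i; fun_prop)
  have hanti : Antitone A := by
    intro m n hmn ω hω
    simp only [A, Set.mem_ofPred_eq] at hω ⊢
    refine le_trans ?_ hω
    gcongr
  have hInter : {ω | a + ∑' j, (if j = i then 0 else b j * ENNReal.ofReal (E j ω)) ≤
        ENNReal.ofReal (E i ω)} = ⋂ n, A n := by
    ext ω
    simp only [Set.mem_ofPred_eq, Set.mem_iInter, A, ← hsum]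
    rw [ENNReal.tsum_eq_iSup_nat, ENNReal.add_iSup, iSup_le_iff]
  rw [hInter]
  refine tendsto_nhds_unique
    (tendsto_measure_iInter_atTop (fun n => (hAmeas n).nullMeasurableSet) hanti
      ⟨0, measure_ne_top _ _⟩) ?_
  simp only [Function.comp_def, hA, ← hsum]
  exact (continuous_expNeg.tendsto _).comp
    (tendsto_const_nhds.add (ENNReal.tendsto_nat_tsum _))

end Fading

/-! ### Poisson weights and the Mecke formula for counts -/

/-- The weight that the Poisson law of mean `a` gives to `n`. -/
noncomputable def poissonWeight (a : ℝ) (n : ℕ) : ℝ≥0∞ :=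
  ENNReal.ofReal (Real.exp (-a) * a ^ n / (n.factorial : ℝ))

lemma tsum_poissonWeight {a : ℝ} (ha : 0 ≤ a) : ∑' n, poissonWeight a n = 1 := by
  have h := hasSum_one_poissonMeasure ⟨a, ha⟩
  change HasSum (fun n : ℕ => Real.exp (-a) * a ^ n / (n.factorial : ℝ)) 1 at h
  unfold poissonWeight
  rw [← ENNReal.ofReal_tsum_of_nonneg (fun n => by positivity) h.summable, h.tsum_eq,
    ENNReal.ofReal_one]

lemma succ_mul_poissonWeight {a : ℝ} (ha : 0 ≤ a) (n : ℕ) :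
    ((n + 1 : ℕ) : ℝ≥0∞) * poissonWeight a (n + 1) = ENNReal.ofReal a * poissonWeight a n := by
  unfold poissonWeight
  rw [← ENNReal.ofReal_natCast, ← ENNReal.ofReal_mul (by positivity), ← ENNReal.ofReal_mul ha]
  congr 1
  rw [Nat.factorial_succ, pow_succ]
  push_cast
  field_simp

/-- The Mecke formula in its discrete form: `n p_n = a p_{n-1}` in coordinate `t₀`, the other
coordinates being spectators. -/
lemma tsum_poissonWeight_shift {T : Type*} [Fintype T] [DecidableEq T] (a : T → ℝ)
    (ha : ∀ t, 0 ≤ a t) (t₀ : T) (f : (T → ℕ) → ℝ≥0∞) :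
    ∑' m : T → ℕ, (∏ t, poissonWeight (a t) (m t)) * (m t₀ * f (m - Pi.single t₀ 1)) =
      ENNReal.ofReal (a t₀) * ∑' m : T → ℕ, (∏ t, poissonWeight (a t) (m t)) * f m := by
  have hinj : Function.Injective fun m : T → ℕ => m + Pi.single t₀ 1 := add_left_injective _
  rw [← hinj.tsum_eq, ← ENNReal.tsum_mul_left]
  · refine tsum_congr fun m => ?_
    have h1 : ∏ t, poissonWeight (a t) ((m + Pi.single t₀ 1 : T → ℕ) t) =
        poissonWeight (a t₀) (m t₀ + 1) * ∏ t ∈ Finset.univ.erase t₀, poissonWeight (a t) (m t) := by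
      rw [← Finset.mul_prod_erase _ _ (Finset.mem_univ t₀)]
      congr 1
      · simp
      · refine Finset.prod_congr rfl fun t ht => ?_
        simp [Pi.single_eq_of_ne (Finset.ne_of_mem_erase ht)]
    have h2 := succ_mul_poissonWeight (ha t₀) (m t₀)
    rw [h1, ← Finset.mul_prod_erase _ _ (Finset.mem_univ t₀), add_tsub_cancel_right]
    simp only [Pi.add_apply, Pi.single_eq_same]
    calc _ = (((m t₀ + 1 : ℕ) : ℝ≥0∞) * poissonWeight (a t₀) (m t₀ + 1)) *
          (∏ t ∈ Finset.univ.erase t₀, poissonWeight (a t) (m t)) * f m := by ring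
      _ = _ := by rw [h2]; ring
  -- The reindexing `m ↦ m + Pi.single t₀ 1` misses only the `m` with `m t₀ = 0`, whose terms vanish
  -- because of the factor `m t₀`.
  · intro m hm
    have hm0 : m t₀ ≠ 0 := by
      rintro h
      simp [h] at hm
    refine ⟨m - Pi.single t₀ 1, ?_⟩
    ext t
    by_cases h : t = t₀
    · subst h; simp; omega
    · simp [h]

lemma tsum_eq_add_tsum_ite (f : ℕ → ℝ≥0∞) (i : ℕ) :
    ∑' j, f j = f i + ∑' j, if j = i then 0 else f j := by
  convert ENNReal.tsum_eq_add_tsum_ite (f := f) i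

section Counts

variable {Ω : Type*} [MeasurableSpace Ω] {P : Measure Ω}

lemma tsum_indicator_eq_count {Ω : Type*} (X : ℕ → Ω → Plane) (S : Set Plane) (ω : Ω) :
    ∑' j, S.indicator (1 : Plane → ℝ≥0∞) (X j ω) = (count X S ω : ℝ≥0∞) := by
  have h := ENNReal.tsum_set_one {i | X i ω ∈ S}
  rw [tsum_subtype {i | X i ω ∈ S} (fun _ => (1 : ℝ≥0∞))] at h
  rw [count, ← h]
  rfl

lemma measurable_count {X : ℕ → Ω → Plane} (hX : ∀ i, Measurable (X i)) {S : Set Plane}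
    (hS : MeasurableSet S) : Measurable (count X S) := by
  have h : Measurable fun ω => ∑' j, S.indicator (1 : Plane → ℝ≥0∞) (X j ω) :=
    Measurable.tsum fun j => (measurable_one.indicator hS).comp (hX j)
  refine measurable_to_countable' fun n => ?_
  have : count X S ⁻¹' {n} =
      (fun ω => ∑' j, S.indicator (1 : Plane → ℝ≥0∞) (X j ω)) ⁻¹' {(n : ℝ≥0∞)} := by
    ext ω
    simp [tsum_indicator_eq_count]
  rw [this]
  exact h (measurableSet_singleton _)

namespace IsPoissonProcess

variable {X : ℕ → Ω → Plane} {lam : ℝ}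

lemma measure_count_eq (hX : IsPoissonProcess P X lam) {T : Type*} [Fintype T]
    (S : T → Set Plane) (hS : ∀ t, MeasurableSet (S t)) (hfin : ∀ t, volume (S t) ≠ ∞)
    (hdisj : Pairwise fun t t' => Disjoint (S t) (S t')) (m : T → ℕ) :
    P {ω | ∀ t, count X (S t) ω = m t} = ∏ t, poissonWeight (lam * volume.real (S t)) (m t) := by
  let e := Fintype.equivFin T
  have h := hX.count_indep _ (fun l => S (e.symm l)) (fun l => hS _) (fun l => hfin _)
    (fun l l' hl => hdisj (e.symm.injective.ne hl))
  have h2 := h.measure_inter_preimage_eq_mul Finset.univ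
    (sets := fun l => {((m (e.symm l) : ℕ) : ℕ∞)}) (fun l _ => measurableSet_singleton _)
  have hset : {ω | ∀ t, count X (S t) ω = m t} =
      ⋂ l ∈ (Finset.univ : Finset (Fin (Fintype.card T))),
        count X (S (e.symm l)) ⁻¹' {((m (e.symm l) : ℕ) : ℕ∞)} := by
    ext ω
    simp only [Set.mem_ofPred_eq, Finset.mem_univ, Set.iInter_true, Set.mem_iInter,
      Set.mem_preimage, Set.mem_singleton_iff]
    exact (e.symm.forall_congr_right (q := fun t => count X (S t) ω = m t)).symm
  rw [hset, h2, ← e.symm.prod_comp]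
  exact Finset.prod_congr rfl fun l _ => hX.count_law _ (hS _) (hfin _) _

/-- The prescribed probabilities of the finite values already sum to one, so nothing is left for the
value `⊤`. -/
lemma ae_count_ne_top [IsProbabilityMeasure P] (hX : IsPoissonProcess P X lam) (hlam : 0 < lam)
    {S : Set Plane} (hS : MeasurableSet S) (hfin : volume S ≠ ∞) :
    ∀ᵐ ω ∂P, count X S ω ≠ ⊤ := by
  have hm := measurable_count hX.measurable hS
  have hset : {ω | count X S ω ≠ ⊤} = ⋃ n : ℕ, {ω | count X S ω = n} := by
    ext ω
    simp only [Set.mem_ofPred_eq, Set.mem_iUnion]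
    exact ⟨fun h => ⟨_, (ENat.natCast_toNat h).symm⟩, fun ⟨n, hn⟩ => hn ▸ ENat.natCast_ne_top n⟩
  have hone : P {ω | count X S ω ≠ ⊤} = 1 := by
    rw [hset, measure_iUnion]
    · rw [← tsum_poissonWeight (a := lam * volume.real S) (by positivity)]
      exact tsum_congr fun n => hX.count_law S hS hfin n
    · intro n n' hn
      refine Set.disjoint_left.2 fun ω h h' => hn ?_
      simp only [Set.mem_ofPred_eq] at h h'
      exact_mod_cast h.symm.trans h'
    · exact fun n => hm (measurableSet_singleton _)
  have hms : MeasurableSet {ω | count X S ω ≠ ⊤} := hm (measurableSet_singleton _).compl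
  exact (prob_compl_eq_zero_iff hms).2 hone

lemma lintegral_count [IsProbabilityMeasure P] (hX : IsPoissonProcess P X lam) (hlam : 0 < lam)
    {T : Type*} [Fintype T]
    (S : T → Set Plane) (hS : ∀ t, MeasurableSet (S t)) (hfin : ∀ t, volume (S t) ≠ ∞)
    (hdisj : Pairwise fun t t' => Disjoint (S t) (S t')) (f : (T → ℕ) → ℝ≥0∞) :
    ∫⁻ ω, f (fun t => (count X (S t) ω).toNat) ∂P =
      ∑' m : T → ℕ, (∏ t, poissonWeight (lam * volume.real (S t)) (m t)) * f m := by
  have hmeas : Measurable fun ω t => (count X (S t) ω).toNat :=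
    measurable_pi_lambda _ fun t => (measurable_of_countable ENat.toNat).comp
      (measurable_count hX.measurable (hS t))
  rw [← lintegral_map (f := f) (g := fun ω t => (count X (S t) ω).toNat)
    (measurable_of_countable f) hmeas, lintegral_countable']
  refine tsum_congr fun m => ?_
  rw [mul_comm, ← hX.measure_count_eq S hS hfin hdisj m,
    Measure.map_apply hmeas (measurableSet_singleton _)]
  congr 1
  refine measure_congr ?_
  have hae : ∀ᵐ ω ∂P, ∀ t, count X (S t) ω ≠ ⊤ :=
    ae_all_iff.2 fun t => hX.ae_count_ne_top hlam (hS t) (hfin t)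
  filter_upwards [hae] with ω hω
  refine propext ?_
  change (fun t => (count X (S t) ω).toNat) = m ↔ ∀ t, count X (S t) ω = m t
  rw [funext_iff]
  refine forall_congr' fun t => ?_
  rw [← ENat.natCast_inj, ENat.natCast_toNat (hω t)]

/-- For disjoint sets, removing a point of `S t₀` lowers the count of `S t₀` by one and leaves the
other counts alone. The sum over points thus becomes the count of `S t₀` times a function of the
shifted counts, to which the discrete formula applies. -/
lemma lintegral_tsum_counts [IsProbabilityMeasure P] (hX : IsPoissonProcess P X lam)
    (hlam : 0 < lam) {T : Type*} [Fintype T] [DecidableEq T]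
    (S : T → Set Plane) (hS : ∀ t, MeasurableSet (S t)) (hfin : ∀ t, volume (S t) ≠ ∞)
    (hdisj : Pairwise fun t t' => Disjoint (S t) (S t')) (t₀ : T) (f : (T → ℝ≥0∞) → ℝ≥0∞) :
    ∫⁻ ω, ∑' i, (S t₀).indicator 1 (X i ω) *
        f (fun t => ∑' j, if j = i then 0 else (S t).indicator 1 (X j ω)) ∂P =
      ENNReal.ofReal lam * volume (S t₀) *
        ∫⁻ ω, f (fun t => ∑' j, (S t).indicator 1 (X j ω)) ∂P := by
  have hae : ∀ᵐ ω ∂P, ∀ t, count X (S t) ω ≠ ⊤ :=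
    ae_all_iff.2 fun t => hX.ae_count_ne_top hlam (hS t) (hfin t)
  have hR : ∫⁻ ω, f (fun t => ∑' j, (S t).indicator 1 (X j ω)) ∂P =
      ∫⁻ ω, (fun m : T → ℕ => f fun t => (m t : ℝ≥0∞)) (fun t => (count X (S t) ω).toNat) ∂P := by
    refine lintegral_congr_ae ?_
    filter_upwards [hae] with ω hω
    congr 1
    ext t
    rw [tsum_indicator_eq_count]
    conv_lhs => rw [← ENat.natCast_toNat (hω t)]
    simp
  have hL : ∫⁻ ω, ∑' i, (S t₀).indicator 1 (X i ω) *
        f (fun t => ∑' j, if j = i then 0 else (S t).indicator 1 (X j ω)) ∂P =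
      ∫⁻ ω, (fun m : T → ℕ => (m t₀ : ℝ≥0∞) *
        (fun m' : T → ℕ => f fun t => (m' t : ℝ≥0∞)) (m - Pi.single t₀ 1))
          (fun t => (count X (S t) ω).toNat) ∂P := by
    refine lintegral_congr_ae ?_
    filter_upwards [hae] with ω hω
    have hcount : ∀ t, ∑' j, (S t).indicator (1 : Plane → ℝ≥0∞) (X j ω) =
        ((count X (S t) ω).toNat : ℝ≥0∞) := fun t => by
      rw [tsum_indicator_eq_count]
      conv_lhs => rw [← ENat.natCast_toNat (hω t)]
      simp
    have hterm : ∀ i, (S t₀).indicator 1 (X i ω) *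
        f (fun t => ∑' j, if j = i then 0 else (S t).indicator 1 (X j ω)) =
        (S t₀).indicator 1 (X i ω) * f (fun t =>
          (((fun t => (count X (S t) ω).toNat) - Pi.single t₀ 1 : T → ℕ) t : ℝ≥0∞)) := by
      intro i
      -- Only here is the truncated subtraction meaningful: the point `X i ω` itself makes the count
      -- of `S t₀` at least one. Otherwise the indicator in front is zero.
      by_cases hi : X i ω ∈ S t₀
      · congr 2
        ext t
        have h1 := tsum_eq_add_tsum_ite
          (fun j => (S t).indicator (1 : Plane → ℝ≥0∞) (X j ω)) i
        rw [hcount] at h1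
        by_cases ht : t = t₀
        · subst ht
          rw [Set.indicator_of_mem hi] at h1
          simp only [Pi.sub_apply, Pi.single_eq_same, ENNReal.natCast_sub, h1]
          simp
        · rw [Set.indicator_of_notMem (Set.disjoint_right.1 (hdisj ht) hi), zero_add] at h1
          simp [ht, h1]
      · simp [hi]
    simp only [hterm]
    rw [ENNReal.tsum_mul_right, hcount]
  have eL := hX.lintegral_count hlam S hS hfin hdisj fun m => (m t₀ : ℝ≥0∞) *
    (fun m' : T → ℕ => f fun t => (m' t : ℝ≥0∞)) (m - Pi.single t₀ 1)
  have eR := hX.lintegral_count hlam S hS hfin hdisj fun m => f fun t => (m t : ℝ≥0∞)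
  have eS := tsum_poissonWeight_shift (fun t => lam * volume.real (S t)) (fun t => by positivity)
    t₀ fun m => f fun t => (m t : ℝ≥0∞)
  have eV : ENNReal.ofReal (lam * volume.real (S t₀)) = ENNReal.ofReal lam * volume (S t₀) := by
    rw [ENNReal.ofReal_mul hlam.le, Measure.real, ENNReal.ofReal_toReal (hfin t₀)]
  rw [hR.trans eR, ← eV]
  exact hL.trans (eL.trans eS)

end IsPoissonProcess

end Counts

/-! ### Random measures: laws and integrals -/

section Evaluations

variable {α : Type*} [MeasurableSpace α]

/-- A finite measure on a space of measures is determined by the joint laws of finitely many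
evaluations. -/
lemma Measure.ext_of_map_evaluations {ν₁ ν₂ : Measure (Measure α)} [IsFiniteMeasure ν₂]
    (h : ∀ J : Finset {S : Set α // MeasurableSet S},
      ν₁.map (fun μ (S : J) => μ S.1.1) = ν₂.map (fun μ (S : J) => μ S.1.1)) : ν₁ = ν₂ := by
  let e : Measure α → {S : Set α // MeasurableSet S} → ℝ≥0∞ := fun μ S => μ S.1
  have he : Measurable e := measurable_pi_lambda _ fun S => Measure.measurable_coe S.2
  have hcomap : (Measure.instMeasurableSpace : MeasurableSpace (Measure α)) =
      MeasurableSpace.comap e MeasurableSpace.pi := by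
    simp only [MeasurableSpace.pi, MeasurableSpace.comap_iSup, MeasurableSpace.comap_comp]
    rw [iSup_subtype]
    rfl
  -- The σ-algebra on measures is pulled back from the evaluations, so it suffices to compare the
  -- laws of the whole family of evaluations. These are projective limits of the same
  -- finite-dimensional laws, hence equal.
  have hmap : ν₁.map e = ν₂.map e := by
    have hlim : ∀ ν : Measure (Measure α), IsProjectiveLimit (ν.map e)
        fun J => ν.map (fun μ (S : J) => μ S.1.1) := fun ν J => by
      rw [Measure.map_map (by fun_prop) he]
      rfl
    refine IsProjectiveLimit.unique (P := fun J => ν₂.map (fun μ (S : J) => μ S.1.1)) ?_ (hlim ν₂)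
    intro J
    exact (hlim ν₁ J).trans (h J)
  ext s hs
  have hs' : MeasurableSet[MeasurableSpace.comap e MeasurableSpace.pi] s := by
    rw [← hcomap]; exact hs
  obtain ⟨t, ht, rfl⟩ := hs'
  rw [← Measure.map_apply he ht, hmap, Measure.map_apply he ht]

open Classical in
/-- A measure of finite mass divided by its mass; zero if the mass is infinite. -/
noncomputable def normalizedKernel : Kernel (Measure α) α where
  toFun μ := if μ Set.univ < ∞ then (μ Set.univ)⁻¹ • μ else 0
  measurable' := by
    have hu : Measurable fun μ : Measure α => μ Set.univ := Measure.measurable_coe MeasurableSet.univ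
    refine Measure.measurable_of_measurable_coe _ fun s hs => ?_
    have : (fun μ : Measure α => (if μ Set.univ < ∞ then (μ Set.univ)⁻¹ • μ else 0 : Measure α) s) =
        fun μ => if μ Set.univ < ∞ then (μ Set.univ)⁻¹ * μ s else 0 := by
      ext μ
      split_ifs <;> simp
    rw [this]
    exact Measurable.ite (measurableSet_lt hu measurable_const)
      (hu.inv.mul (Measure.measurable_coe hs)) measurable_const

instance : IsFiniteKernel (normalizedKernel (α := α)) := by
  refine ⟨1, by simp, fun μ => ?_⟩
  change (if μ Set.univ < ∞ then (μ Set.univ)⁻¹ • μ else 0 : Measure α) Set.univ ≤ 1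
  split_ifs
  · simp [ENNReal.inv_mul_le_one]
  · simp

/-- The integral against a measure of finite mass, as a measurable function of the measure. -/
noncomputable def finiteIntegral {β : Type*} (g : β → α → ℝ≥0∞) (q : β × Measure α) : ℝ≥0∞ :=
  q.2 Set.univ * ∫⁻ z, g q.1 z ∂(normalizedKernel q.2)

lemma finiteIntegral_eq {β : Type*} (g : β → α → ℝ≥0∞) (b : β) {μ : Measure α}
    (hμ : μ Set.univ < ∞) : finiteIntegral g (b, μ) = ∫⁻ z, g b z ∂μ := by
  have : normalizedKernel μ = (μ Set.univ)⁻¹ • μ := if_pos hμ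
  rw [finiteIntegral, this, lintegral_smul_measure, smul_eq_mul, ← mul_assoc]
  rcases eq_or_ne (μ Set.univ) 0 with h | h
  · rw [Measure.measure_univ_eq_zero.1 h]
    simp
  · rw [ENNReal.mul_inv_cancel h hμ.ne, one_mul]

/-- Normalizing makes the measure a finite kernel in its own argument, so parameter-dependent
integrals against it are jointly measurable; the total mass is then put back as a factor. -/
lemma measurable_finiteIntegral {β : Type*} [MeasurableSpace β] {g : β → α → ℝ≥0∞}
    (hg : Measurable (Function.uncurry g)) : Measurable (finiteIntegral g) := by
  have hu : Measurable fun q : β × Measure α => q.2 Set.univ :=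
    (Measure.measurable_coe MeasurableSet.univ).comp measurable_snd
  refine hu.mul ?_
  have := Measurable.lintegral_kernel_prod_right
    (κ := (normalizedKernel (α := α)).comap (Prod.snd : β × Measure α → Measure α) measurable_snd)
    (f := fun q z => g q.1 z)
    (hg.comp ((measurable_fst.comp measurable_fst).prodMk measurable_snd))
  simpa using this

end Evaluations

/-! ### Counting measures in a window -/

/-- The counting measure of the points `x j` in the window `W`. -/
noncomputable def windowMeasure (W : Set Plane) (x : ℕ → Plane) : Measure Plane :=
  Measure.sum fun j => (Measure.dirac (x j)).restrict W

/-- The counting measure of the points `x j`, `j ≠ i`, in the window `W`. -/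
noncomputable def otherMeasure (W : Set Plane) (i : ℕ) (x : ℕ → Plane) : Measure Plane :=
  Measure.sum fun j => if j = i then 0 else (Measure.dirac (x j)).restrict W

section Window

variable {W : Set Plane}

lemma lintegral_dirac_restrict (hW : MeasurableSet W) {g : Plane → ℝ≥0∞} (hg : Measurable g)
    (z : Plane) : ∫⁻ w, g w ∂((Measure.dirac z).restrict W) = W.indicator g z := by
  rw [← lintegral_indicator hW, lintegral_dirac' _ (hg.indicator hW)]

lemma lintegral_windowMeasure (hW : MeasurableSet W) {g : Plane → ℝ≥0∞} (hg : Measurable g)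
    (x : ℕ → Plane) : ∫⁻ z, g z ∂(windowMeasure W x) = ∑' j, W.indicator g (x j) := by
  rw [windowMeasure, lintegral_sum_measure]
  exact tsum_congr fun j => lintegral_dirac_restrict hW hg _

lemma lintegral_otherMeasure (hW : MeasurableSet W) {g : Plane → ℝ≥0∞} (hg : Measurable g)
    (i : ℕ) (x : ℕ → Plane) :
    ∫⁻ z, g z ∂(otherMeasure W i x) = ∑' j, if j = i then 0 else W.indicator g (x j) := by
  rw [otherMeasure, lintegral_sum_measure]
  refine tsum_congr fun j => ?_
  split_ifs
  · simp
  · exact lintegral_dirac_restrict hW hg _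

lemma windowMeasure_apply (hW : MeasurableSet W) {S : Set Plane} (hS : MeasurableSet S)
    (x : ℕ → Plane) : windowMeasure W x S = ∑' j, (W ∩ S).indicator 1 (x j) := by
  rw [← lintegral_indicator_one hS, lintegral_windowMeasure hW (measurable_one.indicator hS)]
  simp only [Set.indicator_indicator]

lemma otherMeasure_apply (hW : MeasurableSet W) {S : Set Plane} (hS : MeasurableSet S)
    (i : ℕ) (x : ℕ → Plane) :
    otherMeasure W i x S = ∑' j, if j = i then 0 else (W ∩ S).indicator 1 (x j) := by
  rw [← lintegral_indicator_one hS, lintegral_otherMeasure hW (measurable_one.indicator hS)]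
  simp only [Set.indicator_indicator]

lemma measurable_indicator_tsum {S : Set Plane} (hS : MeasurableSet S) :
    Measurable fun x : ℕ → Plane => ∑' j, S.indicator (1 : Plane → ℝ≥0∞) (x j) :=
  Measurable.tsum fun j => (measurable_one.indicator hS).comp (measurable_pi_apply j)

lemma measurable_indicator_tsum_ne {S : Set Plane} (hS : MeasurableSet S) (i : ℕ) :
    Measurable fun x : ℕ → Plane =>
      ∑' j, if j = i then 0 else S.indicator (1 : Plane → ℝ≥0∞) (x j) :=
  Measurable.tsum fun j => by
    split_ifs
    · exact measurable_const
    · exact (measurable_one.indicator hS).comp (measurable_pi_apply j)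

lemma measurable_windowMeasure (hW : MeasurableSet W) : Measurable (windowMeasure W) :=
  Measure.measurable_of_measurable_coe _ fun S hS => by
    simp only [windowMeasure_apply hW hS]
    exact measurable_indicator_tsum (hW.inter hS)

lemma measurable_otherMeasure (hW : MeasurableSet W) (i : ℕ) : Measurable (otherMeasure W i) :=
  Measure.measurable_of_measurable_coe _ fun S hS => by
    simp only [otherMeasure_apply hW hS]
    exact measurable_indicator_tsum_ne (hW.inter hS) i

lemma otherMeasure_le_windowMeasure (hW : MeasurableSet W) (i : ℕ) (x : ℕ → Plane) :
    otherMeasure W i x Set.univ ≤ windowMeasure W x Set.univ := by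
  rw [windowMeasure_apply hW .univ, otherMeasure_apply hW .univ]
  refine ENNReal.tsum_le_tsum fun j => ?_
  split_ifs <;> simp

end Window

/-! ### The Mecke formula in a window -/

namespace IsPoissonProcess

variable {Ω : Type*} [MeasurableSpace Ω] {P : Measure Ω} [IsProbabilityMeasure P]
  {X : ℕ → Ω → Plane} {lam : ℝ}

/-- Overlapping sets reduce to disjoint ones: the plane is cut into the atoms on which membership in
all the `U k` is constant, and every count is a sum of counts of atoms. -/
lemma lintegral_tsum_family (hX : IsPoissonProcess P X lam)
    (hlam : 0 < lam) {K : Type*} [Fintype K] (U : K → Set Plane) (hU : ∀ k, MeasurableSet (U k))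
    (hfin : ∀ k, volume (U k) ≠ ∞) (k₀ : K) {f : (K → ℝ≥0∞) → ℝ≥0∞} (hf : Measurable f) :
    ∫⁻ ω, ∑' i, (U k₀).indicator 1 (X i ω) *
        f (fun k => ∑' j, if j = i then 0 else (U k).indicator 1 (X j ω)) ∂P =
      ENNReal.ofReal lam * volume (U k₀) *
        ∫⁻ ω, f (fun k => ∑' j, (U k).indicator 1 (X j ω)) ∂P := by
  classical
  let κ : Plane → K → Prop := fun x k => x ∈ U k
  have hκ : Measurable κ := measurable_pi_lambda _ fun k => (hU k).mem
  -- Cutting with the union is needed for finite area: the pattern of belonging to no `U k` would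
  -- otherwise be an atom of infinite area.
  let W : Set Plane := ⋃ k, U k
  have hW : MeasurableSet W := MeasurableSet.iUnion hU
  have hWfin : volume W ≠ ∞ :=
    ((measure_iUnion_le _).trans_lt (by
      rw [tsum_fintype]; exact ENNReal.sum_lt_top.2 fun k _ => (hfin k).lt_top)).ne
  let S : (K → Prop) → Set Plane := fun t => W ∩ κ ⁻¹' {t}
  have hS : ∀ t, MeasurableSet (S t) := fun t => hW.inter (hκ (measurableSet_singleton t))
  have hSfin : ∀ t, volume (S t) ≠ ∞ := fun t => measure_ne_top_of_subset Set.inter_subset_left hWfin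
  have hdisj : Pairwise fun t t' => Disjoint (S t) (S t') := fun t t' h =>
    Set.disjoint_left.2 fun x hx hx' => h (hx.2.symm.trans hx'.2)
  have hind : ∀ k x, (U k).indicator (1 : Plane → ℝ≥0∞) x =
      ∑ t, if t k then (S t).indicator 1 x else 0 := by
    intro k x
    rw [Finset.sum_eq_single (κ x)]
    · by_cases hx : x ∈ U k
      · have : x ∈ S (κ x) := ⟨Set.mem_iUnion.2 ⟨k, hx⟩, rfl⟩
        rw [if_pos (show κ x k from hx), Set.indicator_of_mem hx, Set.indicator_of_mem this]
      · rw [if_neg (show ¬ κ x k from hx), Set.indicator_of_notMem hx]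
    · intro t _ ht
      have : x ∉ S t := fun h => ht h.2.symm
      simp [this]
    · simp
  have hvol : ∀ k, volume (U k) = ∑ t, if t k then volume (S t) else 0 := by
    intro k
    rw [← lintegral_indicator_one (hU k)]
    simp only [hind]
    rw [lintegral_finsetSum _ fun t _ => by
      split_ifs
      · exact measurable_one.indicator (hS t)
      · exact measurable_const]
    refine Finset.sum_congr rfl fun t _ => ?_
    split_ifs
    · exact lintegral_indicator_one (hS t)
    · simp
  let f' : ((K → Prop) → ℝ≥0∞) → ℝ≥0∞ := fun m => f fun k => ∑ t, if t k then m t else 0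
  have hall : ∀ ω, f (fun k => ∑' j, (U k).indicator 1 (X j ω)) =
      f' fun t => ∑' j, (S t).indicator 1 (X j ω) := by
    intro ω
    simp only [f', hind]
    congr 1
    ext k
    rw [Summable.tsum_finsetSum fun _ _ => ENNReal.summable]
    exact Finset.sum_congr rfl fun t _ => by split_ifs <;> simp
  have hother : ∀ ω i, f (fun k => ∑' j, if j = i then 0 else (U k).indicator 1 (X j ω)) =
      f' fun t => ∑' j, if j = i then 0 else (S t).indicator 1 (X j ω) := by
    intro ω i
    simp only [f', hind]
    congr 1
    ext k
    have : ∀ j, (if j = i then 0 else ∑ t, if t k then (S t).indicator 1 (X j ω) else 0) =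
        ∑ t, if t k then (if j = i then 0 else (S t).indicator (1 : Plane → ℝ≥0∞) (X j ω))
          else 0 := by
      intro j
      by_cases hj : j = i <;> simp [hj]
    simp only [this]
    rw [Summable.tsum_finsetSum fun _ _ => ENNReal.summable]
    exact Finset.sum_congr rfl fun t _ => by split_ifs <;> simp
  have hmeas : ∀ t, Measurable fun ω => ∑' i, (S t).indicator 1 (X i ω) *
      f' (fun t => ∑' j, if j = i then 0 else (S t).indicator 1 (X j ω)) := by
    intro t
    have hXm : Measurable fun ω i => X i ω := measurable_pi_lambda _ hX.measurable
    have hf' : Measurable f' := hf.comp <| measurable_pi_lambda _ fun k =>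
      Finset.measurable_sum _ fun t _ => by split_ifs <;> fun_prop
    refine Measurable.tsum fun i => ?_
    refine ((measurable_one.indicator (hS t)).comp (hX.measurable i)).mul (hf'.comp ?_)
    exact measurable_pi_lambda _ fun t => (measurable_indicator_tsum_ne (hS t) i).comp hXm
  have hkey := fun t => hX.lintegral_tsum_counts hlam S hS hSfin hdisj t f'
  simp only [hall, hother]
  calc _ = ∫⁻ ω, ∑ t, (if t k₀ then ∑' i, (S t).indicator 1 (X i ω) *
        f' (fun t => ∑' j, if j = i then 0 else (S t).indicator 1 (X j ω)) else 0) ∂P := by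
        refine lintegral_congr fun ω => ?_
        simp only [hind k₀, Finset.sum_mul]
        rw [Summable.tsum_finsetSum fun _ _ => ENNReal.summable]
        exact Finset.sum_congr rfl fun t _ => by split_ifs <;> simp
    _ = ∑ t, (if t k₀ then ENNReal.ofReal lam * volume (S t) *
        ∫⁻ ω, f' (fun t => ∑' j, (S t).indicator 1 (X j ω)) ∂P else 0) := by
        rw [lintegral_finsetSum _ fun t _ => by
          split_ifs
          · exact hmeas t
          · exact measurable_const]
        refine Finset.sum_congr rfl fun t _ => ?_
        split_ifs
        · exact hkey t
        · simp
    _ = _ := by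
        rw [hvol, Finset.mul_sum, Finset.sum_mul]
        exact Finset.sum_congr rfl fun t _ => by split_ifs <;> simp

/-- Both sides are compared through finitely many evaluations, which turns the claim into the
formula for a finite family of sets. -/
lemma sum_map_otherMeasure (hX : IsPoissonProcess P X lam) (hlam : 0 < lam) {A W : Set Plane}
    (hA : MeasurableSet A) (hAfin : volume A ≠ ∞) (hW : MeasurableSet W) (hWfin : volume W ≠ ∞) :
    Measure.sum (fun i => (P.restrict (X i ⁻¹' A)).map fun ω => otherMeasure W i fun j => X j ω) =
      (ENNReal.ofReal lam * volume A) • P.map fun ω => windowMeasure W fun j => X j ω := by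
  have hXm : Measurable fun ω i => X i ω := measurable_pi_lambda _ hX.measurable
  have hwm : Measurable fun ω => windowMeasure W fun j => X j ω :=
    (measurable_windowMeasure hW).comp hXm
  have hom : ∀ i, Measurable fun ω => otherMeasure W i fun j => X j ω :=
    fun i => (measurable_otherMeasure hW i).comp hXm
  have hfin : IsFiniteMeasure ((ENNReal.ofReal lam * volume A) •
      P.map fun ω => windowMeasure W fun j => X j ω) := by
    have := Measure.isProbabilityMeasure_map (μ := P) hwm.aemeasurable
    exact Measure.smul_finite _ (ENNReal.mul_ne_top (by simp) hAfin)
  refine Measure.ext_of_map_evaluations fun J => ?_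
  have hev : Measurable fun (μ : Measure Plane) (S : J) => μ S.1.1 :=
    measurable_pi_lambda _ fun S => Measure.measurable_coe S.1.2
  ext t ht
  rw [Measure.map_apply hev ht, Measure.map_apply hev ht, Measure.sum_apply _ (hev ht)]
  -- The index `none` carries the set `A` of the distinguished point and `some S` the evaluations;
  -- the function `f` ignores the coordinate `none`.
  have hkey := hX.lintegral_tsum_family hlam (K := Option J)
    (fun k => k.elim A fun S => W ∩ S.1.1)
    (fun k => by cases k with
      | none => exact hA
      | some S => exact hW.inter S.1.2)
    (fun k => by cases k with
      | none => exact hAfin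
      | some S => exact measure_ne_top_of_subset Set.inter_subset_left hWfin)
    none (f := fun m => t.indicator 1 fun S => m (some S))
    ((measurable_one.indicator ht).comp (by fun_prop))
  simp only [Option.elim] at hkey
  have h1 : ∀ i, (P.restrict (X i ⁻¹' A)).map (fun ω => otherMeasure W i fun j => X j ω)
      ((fun (μ : Measure Plane) (S : J) => μ S.1.1) ⁻¹' t) =
      ∫⁻ ω, A.indicator 1 (X i ω) * t.indicator 1 (fun S : J =>
        ∑' j, if j = i then 0 else (W ∩ S.1.1).indicator 1 (X j ω)) ∂P := by
    intro i
    rw [Measure.map_apply (hom i) (hev ht), Measure.restrict_apply (hom i (hev ht)),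
      ← lintegral_indicator_one ((hom i (hev ht)).inter (hX.measurable i hA))]
    refine lintegral_congr fun ω => ?_
    have h : (fun S : J => ∑' j, if j = i then 0 else (W ∩ S.1.1).indicator 1 (X j ω)) =
        fun S : J => otherMeasure W i (fun j => X j ω) S.1.1 :=
      funext fun S => (otherMeasure_apply hW S.1.2 i _).symm
    rw [h, Set.inter_comm, Set.inter_indicator_one]
    rfl
  simp only [h1]
  rw [← lintegral_tsum, hkey]
  · rw [Measure.smul_apply, smul_eq_mul, Measure.map_apply hwm (hev ht),
      ← lintegral_indicator_one (hwm (hev ht))]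
    congr 1
    refine lintegral_congr fun ω => ?_
    have h : (fun S : J => ∑' j, (W ∩ S.1.1).indicator 1 (X j ω)) =
        fun S : J => windowMeasure W (fun j => X j ω) S.1.1 :=
      funext fun S => (windowMeasure_apply hW S.1.2 _).symm
    rw [h]
    rfl
  · intro i
    refine Measurable.aemeasurable ?_
    refine ((measurable_one.indicator hA).comp (hX.measurable i)).mul
      ((measurable_one.indicator ht).comp ?_)
    exact measurable_pi_lambda _ fun S =>
      (measurable_indicator_tsum_ne (hW.inter S.1.2) i).comp hXm

/-- The Mecke formula in a window, as an identity of measures. -/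
lemma sum_map_prodMk_otherMeasure (hX : IsPoissonProcess P X lam) (hlam : 0 < lam)
    {A W : Set Plane}
    (hA : MeasurableSet A) (hAfin : volume A ≠ ∞) (hW : MeasurableSet W) (hWfin : volume W ≠ ∞) :
    ENNReal.ofReal lam • (volume.restrict A).prod (P.map fun ω => windowMeasure W fun j => X j ω) =
    Measure.sum fun i => (P.restrict (X i ⁻¹' A)).map
      fun ω => (X i ω, otherMeasure W i fun j => X j ω) := by
  have hXm : Measurable fun ω i => X i ω := measurable_pi_lambda _ hX.measurable
  have hwm : Measurable fun ω => windowMeasure W fun j => X j ω :=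
    (measurable_windowMeasure hW).comp hXm
  have hom : ∀ i, Measurable fun ω => otherMeasure W i fun j => X j ω :=
    fun i => (measurable_otherMeasure hW i).comp hXm
  have : IsFiniteMeasure (volume.restrict A) := isFiniteMeasure_restrict.2 hAfin
  have := Measure.isProbabilityMeasure_map (μ := P) hwm.aemeasurable
  have : IsFiniteMeasure (ENNReal.ofReal lam •
      (volume.restrict A).prod (P.map fun ω => windowMeasure W fun j => X j ω)) :=
    Measure.smul_finite _ (by simp)
  refine Measure.ext_prod fun {s t} hs ht => ?_
  -- On a rectangle `s ×ˢ t` the condition `X i ∈ s` can be absorbed into the averaging set, which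
  -- becomes `A ∩ s`.
  have h := congrArg (fun ν => ν t)
    (hX.sum_map_otherMeasure hlam (hA.inter hs)
      (measure_ne_top_of_subset Set.inter_subset_left hAfin) hW hWfin)
  rw [Measure.smul_apply, Measure.prod_prod, smul_eq_mul, Measure.restrict_apply hs, ← mul_assoc,
    Set.inter_comm s A, Measure.sum_apply _ (hs.prod ht)]
  simp only [Measure.smul_apply, smul_eq_mul, Measure.sum_apply _ ht] at h
  rw [← h]
  refine tsum_congr fun i => ?_
  rw [Measure.map_apply (hom i) ht, Measure.map_apply ((hX.measurable i).prodMk (hom i))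
    (hs.prod ht), Measure.restrict_apply (hom i ht),
    Measure.restrict_apply (((hX.measurable i).prodMk (hom i)) (hs.prod ht))]
  congr 1
  ext ω
  simp only [Set.mem_inter_iff, Set.mem_preimage, Set.mem_prod]
  tauto

end IsPoissonProcess

/-! ### Limits of sums and exhaustion of the plane -/

lemma tendsto_tsum_of_monotone {f : ℕ → ℕ → ℝ≥0∞} {F : ℕ → ℝ≥0∞} (hmono : ∀ j, Monotone fun n => f n j)
    (h : ∀ j, Tendsto (fun n => f n j) atTop (𝓝 (F j))) :
    Tendsto (fun n => ∑' j, f n j) atTop (𝓝 (∑' j, F j)) := by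
  simp only [← lintegral_count]
  exact lintegral_tendsto_of_tendsto_of_monotone
    (fun n => (measurable_of_countable _).aemeasurable) (ae_of_all _ hmono) (ae_of_all _ h)

lemma tendsto_tsum_of_dominated {f : ℕ → ℕ → ℝ≥0∞} {F b : ℕ → ℝ≥0∞} (hb : ∑' j, b j ≠ ∞)
    (hle : ∀ n j, f n j ≤ b j) (h : ∀ j, Tendsto (fun n => f n j) atTop (𝓝 (F j))) :
    Tendsto (fun n => ∑' j, f n j) atTop (𝓝 (∑' j, F j)) := by
  simp only [← lintegral_count] at hb ⊢
  exact tendsto_lintegral_of_dominated_convergence b (fun n => measurable_of_countable _)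
    (fun n => ae_of_all _ (hle n)) hb (ae_of_all _ h)

/-- An exhaustion of the plane by bounded sets. -/
def exhaustion (n : ℕ) : Set Plane := Metric.closedBall 0 n

lemma measurableSet_exhaustion (n : ℕ) : MeasurableSet (exhaustion n) :=
  Metric.isClosed_closedBall.measurableSet

lemma volume_exhaustion_ne_top (n : ℕ) : volume (exhaustion n) ≠ ∞ :=
  measure_closedBall_lt_top.ne

lemma monotone_exhaustion : Monotone exhaustion := fun m n h =>
  Metric.closedBall_subset_closedBall (by exact_mod_cast h)

lemma iUnion_exhaustion : ⋃ n, exhaustion n = Set.univ := Metric.iUnion_closedBall_nat 0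

lemma tendsto_indicator_exhaustion (f : Plane → ℝ≥0∞) (z : Plane) :
    Tendsto (fun n => (exhaustion n).indicator f z) atTop (𝓝 (f z)) := by
  have h := Monotone.tendsto_indicator exhaustion monotone_exhaustion f z
  rw [iUnion_exhaustion, Set.indicator_univ] at h
  exact h.mono_right (pure_le_nhds _)

lemma monotone_indicator_exhaustion (f : Plane → ℝ≥0∞) (z : Plane) :
    Monotone fun n => (exhaustion n).indicator f z := fun _ _ h =>
  Set.indicator_le_indicator_of_subset (monotone_exhaustion h) (fun _ => bot_le) z

/-! ### The Laplace functional of a Poisson process -/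

/-- With `q = e^{-c}`, the weights of mean `a` times `q ^ n` are `e^{-a(1-q)}` times the weights of
mean `a q`, whose sum is one. -/
lemma tsum_poissonWeight_mul_expNeg {a : ℝ} (ha : 0 ≤ a) (c : ℝ≥0∞) :
    ∑' n : ℕ, poissonWeight a n * expNeg (c * n) = expNeg (ENNReal.ofReal a * (1 - expNeg c)) := by
  have hq : expNeg c = ENNReal.ofReal (expNeg c).toReal :=
    (ENNReal.ofReal_toReal (expNeg_ne_top c)).symm
  set q := (expNeg c).toReal with hqdef
  have hq0 : 0 ≤ q := ENNReal.toReal_nonneg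
  have hq1 : q ≤ 1 := by
    have := ENNReal.toReal_mono ENNReal.one_ne_top (expNeg_le_one c)
    simpa using this
  have h : ∀ n : ℕ, poissonWeight a n * expNeg (c * n) =
      ENNReal.ofReal (Real.exp (-(a * (1 - q)))) * poissonWeight (a * q) n := by
    intro n
    rw [mul_comm c, expNeg_natCast_mul, hq, ← ENNReal.ofReal_pow hq0, poissonWeight, poissonWeight,
      ← ENNReal.ofReal_mul (by positivity), ← ENNReal.ofReal_mul (by positivity)]
    congr 1
    have : Real.exp (-a) = Real.exp (-(a * (1 - q))) * Real.exp (-(a * q)) := by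
      rw [← Real.exp_add]; ring_nf
    rw [this, mul_pow]
    ring
  simp only [h]
  rw [ENNReal.tsum_mul_left, tsum_poissonWeight (by positivity), mul_one, hq,
    ← ENNReal.ofReal_one, ← ENNReal.ofReal_sub _ hq0, ← ENNReal.ofReal_mul ha,
    expNeg_ofReal (mul_nonneg ha (by linarith))]

namespace IsPoissonProcess

variable {Ω : Type*} [MeasurableSpace Ω] {P : Measure Ω} [IsProbabilityMeasure P]
  {X : ℕ → Ω → Plane} {lam : ℝ}

lemma lintegral_expNeg_count (hX : IsPoissonProcess P X lam) (hlam : 0 < lam) {S : Set Plane}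
    (hS : MeasurableSet S) (hfin : volume S ≠ ∞) (c : ℝ≥0∞) :
    ∫⁻ ω, expNeg (c * (count X S ω : ℝ≥0∞)) ∂P =
      expNeg (ENNReal.ofReal lam * ((1 - expNeg c) * volume S)) := by
  have h := hX.lintegral_count hlam (T := Unit) (fun _ => S) (fun _ => hS) (fun _ => hfin)
    (fun t t' h => absurd rfl h) fun m => expNeg (c * m ())
  rw [lintegral_congr_ae (g := fun ω => expNeg (c * ((count X S ω).toNat : ℝ≥0∞)))]
  · rw [h, ← (Equiv.funUnique Unit ℕ).symm.tsum_eq]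
    simp only [Finset.univ_unique, Finset.prod_singleton]
    have e := tsum_poissonWeight_mul_expNeg (a := lam * volume.real S) (by positivity) c
    rw [ENNReal.ofReal_mul hlam.le, Measure.real, ENNReal.ofReal_toReal hfin] at e
    rw [mul_comm (1 - expNeg c), ← mul_assoc, ← e]
    rfl
  · filter_upwards [hX.ae_count_ne_top hlam hS hfin] with ω hω
    conv_lhs => rw [← ENat.natCast_toNat hω]
    simp

/-- The sum is a finite combination of the counts of the level sets in `W`, which are independent,
so the expectation is a product of Poisson generating functions. -/
lemma lintegral_expNeg_simpleFunc (hX : IsPoissonProcess P X lam) (hlam : 0 < lam) {W : Set Plane}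
    (hW : MeasurableSet W) (hWfin : volume W ≠ ∞) (g : SimpleFunc Plane ℝ≥0∞) :
    ∫⁻ ω, expNeg (∑' j, W.indicator g (X j ω)) ∂P =
      expNeg (ENNReal.ofReal lam * ∫⁻ z, 1 - expNeg (W.indicator g z)) := by
  let S : g.range → Set Plane := fun y => W ∩ g ⁻¹' {y.1}
  have hS : ∀ y, MeasurableSet (S y) := fun y => hW.inter (g.measurableSet_fiber _)
  have hfin : ∀ y, volume (S y) ≠ ∞ := fun y => measure_ne_top_of_subset Set.inter_subset_left hWfin
  have hdisj : Pairwise fun t t' => Disjoint (S t) (S t') := fun t t' h =>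
    Set.disjoint_left.2 fun x hx hx' => h (Subtype.ext (hx.2.symm.trans hx'.2))
  -- Used with the identity for the sum over the points and with `a ↦ 1 - e^{-a}` for the integral.
  -- The condition `φ 0 = 0` takes care of the points outside `W`.
  have hdec : ∀ (φ : ℝ≥0∞ → ℝ≥0∞), φ 0 = 0 → ∀ z,
      φ (W.indicator g z) = ∑ y : g.range, φ y.1 * (S y).indicator 1 z := by
    intro φ hφ z
    by_cases hz : z ∈ W
    · rw [Finset.sum_eq_single ⟨g z, g.mem_range_self z⟩]
      · have : z ∈ S ⟨g z, g.mem_range_self z⟩ := ⟨hz, rfl⟩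
        simp [hz, this]
      · intro y _ hy
        have : z ∉ S y := fun h => hy (Subtype.ext h.2.symm)
        simp [this]
      · simp
    · rw [Set.indicator_of_notMem hz, hφ]
      refine (Finset.sum_eq_zero fun y _ => ?_).symm
      have : z ∉ S y := fun h => hz h.1
      simp [this]
  have h1 : ∀ ω, expNeg (∑' j, W.indicator g (X j ω)) =
      ∏ y : g.range, expNeg (y.1 * (count X (S y) ω : ℝ≥0∞)) := by
    intro ω
    rw [← expNeg_sum]
    congr 1
    have hid := hdec id rfl
    simp only [id] at hid
    simp only [hid]
    rw [Summable.tsum_finsetSum fun _ _ => ENNReal.summable]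
    refine Finset.sum_congr rfl fun y _ => ?_
    rw [ENNReal.tsum_mul_left, tsum_indicator_eq_count]
  have hindep : iIndepFun (fun y : g.range => count X (S y)) P := by
    let e := Fintype.equivFin g.range
    have h := hX.count_indep _ (fun l => S (e.symm l)) (fun l => hS _) (fun l => hfin _)
      (fun l l' hl => hdisj (e.symm.injective.ne hl))
    have h' := h.precomp e.injective
    simpa using h'
  simp only [h1]
  rw [lintegral_prod_eq_prod_lintegral_of_indepFun Finset.univ
    (fun (y : g.range) ω => expNeg (y.1 * (count X (S y) ω : ℝ≥0∞)))
    (hindep.comp (fun y (n : ℕ∞) => expNeg (y.1 * (n : ℝ≥0∞)))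
      fun y => measurable_of_countable _)
    (fun y => (measurable_of_countable fun n : ℕ∞ => expNeg (y.1 * (n : ℝ≥0∞))).comp
      (measurable_count hX.measurable (hS y)))]
  simp only [hX.lintegral_expNeg_count hlam (hS _) (hfin _)]
  rw [← expNeg_sum, ← Finset.mul_sum]
  congr 2
  simp only [hdec (fun a => 1 - expNeg a) (by simp)]
  rw [lintegral_finsetSum _ fun y _ => (measurable_one.indicator (hS y)).const_mul _]
  refine Finset.sum_congr rfl fun y _ => ?_
  rw [lintegral_const_mul _ (measurable_one.indicator (hS y)), lintegral_indicator_one (hS y)]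

/-- The Laplace functional of a Poisson process. -/
theorem lintegral_expNeg_tsum (hX : IsPoissonProcess P X lam) (hlam : 0 < lam)
    {g : Plane → ℝ≥0∞} (hg : Measurable g) :
    ∫⁻ ω, expNeg (∑' j, g (X j ω)) ∂P =
      expNeg (ENNReal.ofReal lam * ∫⁻ z, 1 - expNeg (g z)) := by
  -- Simple functions cut off to balls, increasing to `g`. On the left `e^{-∑}` is dominated by one;
  -- on the right the integrands `1 - e^{-G n}` increase.
  let G : ℕ → Plane → ℝ≥0∞ := fun n => (exhaustion n).indicator (SimpleFunc.eapprox g n)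
  have hGm : ∀ n, Measurable (G n) := fun n =>
    (SimpleFunc.measurable _).indicator (measurableSet_exhaustion n)
  have hGmono : ∀ z, Monotone fun n => G n z := fun z m n h =>
    (monotone_indicator_exhaustion _ z h).trans
      (Set.indicator_le_indicator (SimpleFunc.monotone_eapprox g h z))
  have hGlim : ∀ z, Tendsto (fun n => G n z) atTop (𝓝 (g z)) := by
    intro z
    have h := SimpleFunc.iSup_eapprox_apply hg z
    have h2 : Tendsto (fun n => SimpleFunc.eapprox g n z) atTop (𝓝 (g z)) := by
      rw [← h]
      exact tendsto_atTop_iSup fun m n hmn => SimpleFunc.monotone_eapprox g hmn z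
    refine h2.congr' ?_
    obtain ⟨n₀, hn₀⟩ := Set.mem_iUnion.1 (iUnion_exhaustion ▸ Set.mem_univ z)
    filter_upwards [eventually_ge_atTop n₀] with n hn
    exact (Set.indicator_of_mem (monotone_exhaustion hn hn₀) _).symm
  have hkey : ∀ n, ∫⁻ ω, expNeg (∑' j, G n (X j ω)) ∂P =
      expNeg (ENNReal.ofReal lam * ∫⁻ z, 1 - expNeg (G n z)) := fun n =>
    hX.lintegral_expNeg_simpleFunc hlam (measurableSet_exhaustion n) (volume_exhaustion_ne_top n) _
  refine tendsto_nhds_unique (f := fun n => ∫⁻ ω, expNeg (∑' j, G n (X j ω)) ∂P) (l := atTop) ?_ ?_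
  · refine tendsto_lintegral_of_dominated_convergence (fun _ => 1)
      (fun n => measurable_expNeg.comp
        (Measurable.tsum fun j => (hGm n).comp (hX.measurable j)))
      (fun n => ae_of_all _ fun ω => expNeg_le_one _) (by simp) (ae_of_all _ fun ω => ?_)
    exact (continuous_expNeg.tendsto _).comp
      (tendsto_tsum_of_monotone (fun j => hGmono _) fun j => hGlim _)
  · simp only [hkey]
    refine (continuous_expNeg.tendsto _).comp ?_
    refine ENNReal.Tendsto.const_mul ?_ (Or.inr (by simp))
    refine lintegral_tendsto_of_tendsto_of_monotone
      (fun n => (measurable_const.sub (measurable_expNeg.comp (hGm n))).aemeasurable)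
      (ae_of_all _ fun z m n h => tsub_le_tsub_left (expNeg_anti (hGmono z h)) 1)
      (ae_of_all _ fun z => ?_)
    exact ENNReal.Tendsto.sub tendsto_const_nhds ((continuous_expNeg.tendsto _).comp (hGlim z))
      (Or.inl (by simp))

/-! ### The Mecke formula for additive statistics -/

lemma lintegral_tsum_otherMeasure (hX : IsPoissonProcess P X lam) (hlam : 0 < lam)
    {A W : Set Plane} (hA : MeasurableSet A) (hAfin : volume A ≠ ∞) (hW : MeasurableSet W)
    (hWfin : volume W ≠ ∞) {F : Plane × Measure Plane → ℝ≥0∞} (hF : Measurable F) :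
    ∫⁻ ω, ∑' i, A.indicator 1 (X i ω) * F (X i ω, otherMeasure W i fun j => X j ω) ∂P =
      ENNReal.ofReal lam * ∫⁻ x in A, ∫⁻ ω, F (x, windowMeasure W fun j => X j ω) ∂P := by
  have hXm : Measurable fun ω i => X i ω := measurable_pi_lambda _ hX.measurable
  have hwm : Measurable fun ω => windowMeasure W fun j => X j ω :=
    (measurable_windowMeasure hW).comp hXm
  have hpm : ∀ i, Measurable fun ω => (X i ω, otherMeasure W i fun j => X j ω) :=
    fun i => (hX.measurable i).prodMk ((measurable_otherMeasure hW i).comp hXm)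
  have := Measure.isProbabilityMeasure_map (μ := P) hwm.aemeasurable
  have h := congrArg (fun ν => ∫⁻ q, F q ∂ν)
    (hX.sum_map_prodMk_otherMeasure hlam hA hAfin hW hWfin)
  simp only [lintegral_smul_measure, lintegral_sum_measure] at h
  rw [lintegral_prod _ hF.aemeasurable, smul_eq_mul] at h
  have hm : ∀ i, Measurable fun ω => A.indicator 1 (X i ω) *
      F (X i ω, otherMeasure W i fun j => X j ω) := fun i =>
    ((measurable_one.indicator hA).comp (hX.measurable i)).mul (hF.comp (hpm i))
  rw [lintegral_tsum fun i => (hm i).aemeasurable]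
  refine Eq.trans (tsum_congr fun i => ?_) (h.symm.trans ?_)
  · rw [lintegral_map hF (hpm i), ← lintegral_indicator (hX.measurable i hA)]
    refine lintegral_congr fun ω => ?_
    by_cases hω : X i ω ∈ A <;> simp [Set.indicator, hω]
  · congr 1
    refine lintegral_congr fun x => ?_
    exact lintegral_map (hF.comp measurable_prodMk_left) hwm

lemma lintegral_tsum_indicator (hX : IsPoissonProcess P X lam) (hlam : 0 < lam)
    {A : Set Plane} (hA : MeasurableSet A) (hAfin : volume A ≠ ∞) :
    ∫⁻ ω, ∑' i, A.indicator 1 (X i ω) ∂P = ENNReal.ofReal lam * volume A := by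
  simpa using hX.lintegral_tsum_otherMeasure hlam hA hAfin hA hAfin (F := fun _ => 1)
    measurable_const

/-- The window formula is applied to `g` cut off to a ball, whose statistic is an integral against
the window measure. As the balls grow the statistics increase, so continuity of `v x` gives
convergence, and `v ≤ 1` with finite area of `A` gives domination by the number of points in `A`. -/
lemma mecke_of_volume_ne_top (hX : IsPoissonProcess P X lam) (hlam : 0 < lam)
    {A : Set Plane} (hA : MeasurableSet A) (hAfin : volume A ≠ ∞) {g : Plane → Plane → ℝ≥0∞}
    (hg : Measurable (Function.uncurry g)) {v : Plane → ℝ≥0∞ → ℝ≥0∞}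
    (hv : Measurable (Function.uncurry v)) (hvc : ∀ x, Continuous (v x)) (hv1 : ∀ x a, v x a ≤ 1) :
    ∫⁻ ω, ∑' i, A.indicator 1 (X i ω) *
        v (X i ω) (∑' j, if j = i then 0 else g (X i ω) (X j ω)) ∂P =
      ENNReal.ofReal lam * ∫⁻ x in A, ∫⁻ ω, v x (∑' j, g x (X j ω)) ∂P := by
  have hXm := hX.measurable
  have hgx : ∀ x, Measurable (g x) := fun x => hg.comp measurable_prodMk_left
  let G : ℕ → Plane → Plane → ℝ≥0∞ := fun n x => (exhaustion n).indicator (g x)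
  have hGm : ∀ n, Measurable (Function.uncurry (G n)) := fun n => by
    have : Function.uncurry (G n) =
        (Prod.snd ⁻¹' (exhaustion n)).indicator (Function.uncurry g) := by
      ext ⟨x, z⟩
      by_cases h : z ∈ exhaustion n <;> simp [G, h, Set.indicator]
    rw [this]
    exact hg.indicator (measurable_snd (measurableSet_exhaustion n))
  have hwin : ∀ n, ∫⁻ ω, ∑' i, A.indicator 1 (X i ω) *
        v (X i ω) (∑' j, if j = i then 0 else G n (X i ω) (X j ω)) ∂P =
      ENNReal.ofReal lam * ∫⁻ x in A, ∫⁻ ω, v x (∑' j, G n x (X j ω)) ∂P := by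
    intro n
    have hF : Measurable fun q : Plane × Measure Plane => v q.1 (finiteIntegral g q) :=
      hv.comp (measurable_fst.prodMk (measurable_finiteIntegral hg))
    have h := hX.lintegral_tsum_otherMeasure hlam hA hAfin (measurableSet_exhaustion n)
      (volume_exhaustion_ne_top n) hF
    have hae : ∀ᵐ ω ∂P, windowMeasure (exhaustion n) (fun j => X j ω) Set.univ < ∞ := by
      filter_upwards [hX.ae_count_ne_top hlam (measurableSet_exhaustion n)
        (volume_exhaustion_ne_top n)] with ω hω
      rw [windowMeasure_apply (measurableSet_exhaustion n) .univ, Set.inter_univ,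
        tsum_indicator_eq_count]
      exact (by simpa using hω : (count X (exhaustion n) ω : ℝ≥0∞) ≠ ∞).lt_top
    refine Eq.trans (lintegral_congr_ae ?_) (h.trans ?_)
    · filter_upwards [hae] with ω hω
      refine tsum_congr fun i => ?_
      rw [finiteIntegral_eq _ _ ((otherMeasure_le_windowMeasure (measurableSet_exhaustion n)
        i _).trans_lt hω), lintegral_otherMeasure (measurableSet_exhaustion n) (hgx _)]
    · congr 1
      refine lintegral_congr fun x => lintegral_congr_ae ?_
      filter_upwards [hae] with ω hω
      rw [finiteIntegral_eq _ _ hω, lintegral_windowMeasure (measurableSet_exhaustion n) (hgx _)]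
  have hGmono : ∀ x z, Monotone fun n => G n x z := fun x => monotone_indicator_exhaustion _
  have hGlim : ∀ x z, Tendsto (fun n => G n x z) atTop (𝓝 (g x z)) :=
    fun x => tendsto_indicator_exhaustion _
  clear_value G
  have hfinE := hX.lintegral_tsum_indicator hlam hA hAfin
  have hfin : ENNReal.ofReal lam * volume A ≠ ∞ := ENNReal.mul_ne_top (by simp) hAfin
  have hindm : ∀ i, Measurable fun ω => A.indicator (1 : Plane → ℝ≥0∞) (X i ω) := fun i =>
    (measurable_one.indicator hA).comp (hXm i)
  have hle : ∀ (ω : Ω) (i : ℕ) (a : ℝ≥0∞), A.indicator 1 (X i ω) * v (X i ω) a ≤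
      A.indicator (1 : Plane → ℝ≥0∞) (X i ω) := fun ω i a => mul_le_of_le_one_right' (hv1 _ _)
  refine tendsto_nhds_unique (f := fun n => ∫⁻ ω, ∑' i, A.indicator 1 (X i ω) *
        v (X i ω) (∑' j, if j = i then 0 else G n (X i ω) (X j ω)) ∂P) (l := atTop) ?_ ?_
  · refine tendsto_lintegral_of_dominated_convergence
      (fun ω => ∑' i, A.indicator 1 (X i ω)) (fun n => ?_)
      (fun n => ae_of_all _ fun ω => ENNReal.tsum_le_tsum fun i => hle _ _ _)
      (by rw [hfinE]; exact hfin) ?_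
    · refine Measurable.tsum fun i => (hindm i).mul (hv.comp ((hXm i).prodMk ?_))
      refine Measurable.tsum fun j => ?_
      split_ifs
      · exact measurable_const
      · exact (hGm n).comp ((hXm i).prodMk (hXm j))
    · filter_upwards [ae_lt_top (Measurable.tsum hindm) (by rw [hfinE]; exact hfin)] with ω hω
      have hb : ∑' i, A.indicator (1 : Plane → ℝ≥0∞) (X i ω) ≠ ∞ := hω.ne
      have hlim : ∀ i, Tendsto (fun n => ∑' j, if j = i then 0 else G n (X i ω) (X j ω)) atTop
          (𝓝 (∑' j, if j = i then 0 else g (X i ω) (X j ω))) := by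
        intro i
        refine tendsto_tsum_of_monotone (fun j => ?_) fun j => ?_
        · split_ifs
          · exact monotone_const
          · exact hGmono _ _
        · split_ifs
          · exact tendsto_const_nhds
          · exact hGlim _ _
      have hterm : ∀ i, Tendsto (fun n => A.indicator 1 (X i ω) *
          v (X i ω) (∑' j, if j = i then 0 else G n (X i ω) (X j ω))) atTop
          (𝓝 (A.indicator 1 (X i ω) *
            v (X i ω) (∑' j, if j = i then 0 else g (X i ω) (X j ω)))) := by
        intro i
        refine ENNReal.Tendsto.const_mul (((hvc (X i ω)).tendsto _).comp (hlim i)) (Or.inr ?_)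
        by_cases h : X i ω ∈ A <;> simp [h]
      exact tendsto_tsum_of_dominated hb (fun n i => hle ω i _) hterm
  · simp only [hwin]
    refine ENNReal.Tendsto.const_mul ?_ (Or.inr (by simp))
    have hmeas : ∀ n, Measurable fun q : Plane × Ω => v q.1 (∑' j, G n q.1 (X j q.2)) := fun n =>
      hv.comp (measurable_fst.prodMk (Measurable.tsum fun j =>
        (hGm n).comp (measurable_fst.prodMk ((hXm j).comp measurable_snd))))
    refine tendsto_lintegral_of_dominated_convergence (fun _ => 1)
      (fun n => (hmeas n).lintegral_prod_right')
      (fun n => ae_of_all _ fun x => ?_) (by simpa using hAfin) (ae_of_all _ fun x => ?_)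
    · exact (lintegral_mono fun ω => hv1 _ _).trans (by simp)
    · refine tendsto_lintegral_of_dominated_convergence (fun _ => 1)
        (fun n => (hmeas n).comp measurable_prodMk_left)
        (fun n => ae_of_all _ fun ω => hv1 _ _) (by simp) (ae_of_all _ fun ω => ?_)
      exact ((hvc _).tendsto _).comp (tendsto_tsum_of_monotone
        (fun j => hGmono _ _) fun j => hGlim _ _)

/-- The Mecke formula for functionals of an additive statistic of the other points. -/
theorem mecke (hX : IsPoissonProcess P X lam) (hlam : 0 < lam)
    {A : Set Plane} (hA : MeasurableSet A) {g : Plane → Plane → ℝ≥0∞}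
    (hg : Measurable (Function.uncurry g)) {v : Plane → ℝ≥0∞ → ℝ≥0∞}
    (hv : Measurable (Function.uncurry v)) (hvc : ∀ x, Continuous (v x)) (hv1 : ∀ x a, v x a ≤ 1) :
    ∫⁻ ω, ∑' i, A.indicator 1 (X i ω) *
        v (X i ω) (∑' j, if j = i then 0 else g (X i ω) (X j ω)) ∂P =
      ENNReal.ofReal lam * ∫⁻ x in A, ∫⁻ ω, v x (∑' j, g x (X j ω)) ∂P := by
  have hXm := hX.measurable
  -- Monotone convergence in the averaging set removes the finiteness of its area; the base stations
  -- need the whole plane.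
  let B : ℕ → Set Plane := fun n => A ∩ exhaustion n
  have hB : ∀ n, MeasurableSet (B n) := fun n => hA.inter (measurableSet_exhaustion n)
  have hkey := fun n => hX.mecke_of_volume_ne_top hlam (hB n)
    (measure_ne_top_of_subset Set.inter_subset_right (volume_exhaustion_ne_top n)) hg hv hvc hv1
  have hmono : ∀ z, Monotone fun n => (B n).indicator (1 : Plane → ℝ≥0∞) z := fun z m n h =>
    Set.indicator_le_indicator_of_subset
      (Set.inter_subset_inter_right _ (monotone_exhaustion h)) (fun _ => bot_le) z
  have hlim : ∀ z, Tendsto (fun n => (B n).indicator (1 : Plane → ℝ≥0∞) z) atTop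
      (𝓝 (A.indicator 1 z)) := fun z => by
    have h := tendsto_indicator_exhaustion (A.indicator 1) z
    simpa [B, Set.indicator_indicator, Set.inter_comm] using h
  have hvm : ∀ i, Measurable fun ω =>
      v (X i ω) (∑' j, if j = i then 0 else g (X i ω) (X j ω)) := fun i => by
    refine hv.comp ((hXm i).prodMk (Measurable.tsum fun j => ?_))
    split_ifs
    · exact measurable_const
    · exact hg.comp ((hXm i).prodMk (hXm j))
  have hfin : ∀ x a, v x a ≠ ∞ := fun x a => ((hv1 x a).trans_lt ENNReal.one_lt_top).ne
  refine tendsto_nhds_unique (f := fun n => ∫⁻ ω, ∑' i, (B n).indicator 1 (X i ω) *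
        v (X i ω) (∑' j, if j = i then 0 else g (X i ω) (X j ω)) ∂P) (l := atTop) ?_ ?_
  · refine lintegral_tendsto_of_tendsto_of_monotone
      (fun n => (Measurable.tsum fun i =>
        ((measurable_one.indicator (hB n)).comp (hXm i)).mul (hvm i)).aemeasurable)
      (ae_of_all _ fun ω m n h => ENNReal.tsum_le_tsum fun i => mul_le_mul_left (hmono _ h) _)
      (ae_of_all _ fun ω => tendsto_tsum_of_monotone
        (fun i m n h => mul_le_mul_left (hmono _ h) _)
        fun i => ENNReal.Tendsto.mul_const (hlim _) (Or.inr (hfin _ _)))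
  · simp only [hkey]
    refine ENNReal.Tendsto.const_mul ?_ (Or.inr (by simp))
    have hmeas : Measurable fun x => ∫⁻ ω, v x (∑' j, g x (X j ω)) ∂P :=
      Measurable.lintegral_prod_right' (f := fun q : Plane × Ω => v q.1 (∑' j, g q.1 (X j q.2)))
        (hv.comp (measurable_fst.prodMk (Measurable.tsum fun j =>
        hg.comp (measurable_fst.prodMk ((hXm j).comp measurable_snd)))))
    have hind : ∀ S : Set Plane, MeasurableSet S →
        ∫⁻ x in S, ∫⁻ ω, v x (∑' j, g x (X j ω)) ∂P =
        ∫⁻ x, S.indicator 1 x * ∫⁻ ω, v x (∑' j, g x (X j ω)) ∂P := fun S hS => by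
      rw [← lintegral_indicator hS]
      refine lintegral_congr fun x => ?_
      by_cases h : x ∈ S <;> simp [h]
    simp only [hind _ (hB _), hind _ hA]
    have hone : ∀ x, ∫⁻ ω, v x (∑' j, g x (X j ω)) ∂P ≠ ∞ := fun x =>
      ((lintegral_mono fun ω => hv1 _ _).trans_lt (by simp)).ne
    exact lintegral_tendsto_of_tendsto_of_monotone
      (fun n => ((measurable_one.indicator (hB n)).mul hmeas).aemeasurable)
      (ae_of_all _ fun x m n h => mul_le_mul_left (hmono _ h) _)
      (ae_of_all _ fun x => ENNReal.Tendsto.mul_const (hlim _) (Or.inr (hone x)))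

end IsPoissonProcess

/-! ### Radial integrals of the interference -/

lemma integral_plane_norm (φ : ℝ → ℝ) :
    ∫ z : Plane, φ ‖z‖ = 2 * Real.pi * ∫ r in Set.Ioi (0 : ℝ), φ r * r := by
  rw [integral_fun_norm_addHaar volume φ, Measure.real, EuclideanSpace.volume_ball_fin_two]
  simp only [finrank_euclideanSpace, Fintype.card_fin, ENNReal.ofReal_one, one_pow, one_mul]
  have : (ENNReal.ofReal Real.pi).toReal = Real.pi := ENNReal.toReal_ofReal Real.pi_pos.le
  simp [mul_comm, Real.pi_pos.le, mul_assoc, mul_left_comm]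

lemma one_sub_inv_pow_nonneg {u : ℝ} (hu : 0 ≤ u) (n : ℕ) : 0 ≤ 1 - ((1 + u) ^ n)⁻¹ := by
  have : ((1 + u) ^ n)⁻¹ ≤ 1 := inv_le_one_of_one_le₀ (one_le_pow₀ (by linarith))
  linarith

lemma one_sub_inv_pow_le_one {u : ℝ} (hu : 0 ≤ u) (n : ℕ) : 1 - ((1 + u) ^ n)⁻¹ ≤ 1 := by
  have : 0 ≤ ((1 + u) ^ n)⁻¹ := by positivity
  linarith

/-- Bernoulli's inequality for `(1 - u / (1 + u)) ^ n`, whose base is `(1 + u)⁻¹`. -/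
lemma one_sub_inv_pow_le_mul {u : ℝ} (hu : 0 ≤ u) (n : ℕ) : 1 - ((1 + u) ^ n)⁻¹ ≤ n * u := by
  have hpos : 0 < 1 + u := by linarith
  have h1 : u / (1 + u) ≤ 1 := (div_le_one hpos).2 (by linarith)
  have h2 : u / (1 + u) ≤ u := div_le_self hu (by linarith)
  have h := one_add_mul_le_pow (a := -(u / (1 + u))) (by linarith) n
  have h3 : 1 + -(u / (1 + u)) = (1 + u)⁻¹ := by field_simp; ring
  rw [h3, inv_pow] at h
  have h4 : (n : ℝ) * (u / (1 + u)) ≤ n * u := by gcongr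
  linarith

namespace Params

variable (c : Params)

lemma α_pos : 0 < c.α := by linarith [c.two_lt_α]

lemma loss_pos {r : ℝ} (hr : 0 < r) : 0 < c.loss r :=
  mul_pos c.A_pos (Real.rpow_pos_of_pos hr _)

lemma loss_zero : c.loss 0 = 0 := by
  rw [loss, Real.zero_rpow c.α_pos.ne', mul_zero]

lemma loss_nonneg {r : ℝ} (hr : 0 ≤ r) : 0 ≤ c.loss r :=
  mul_nonneg c.A_pos.le (Real.rpow_nonneg hr _)

lemma invSNR_nonneg : 0 ≤ c.invSNR := div_nonneg c.noise_nonneg c.Pm_pos.le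

lemma invSNRc_nonneg : 0 ≤ c.invSNRc := div_nonneg c.noise_nonneg c.Pb_pos.le

@[fun_prop] lemma measurable_loss : Measurable c.loss := by
  unfold loss; fun_prop

/-- The mean effect, on the `n`-th power of a success probability, of one interferer at
distance `r`. -/
noncomputable def interference (d : ℝ) (n : ℕ) (r : ℝ) : ℝ := 1 - ((1 + d / c.loss r) ^ n)⁻¹

@[fun_prop] lemma measurable_interference (d : ℝ) (n : ℕ) : Measurable (c.interference d n) := by
  unfold interference; fun_prop

variable {c} in
lemma interference_nonneg {d : ℝ} (hd : 0 ≤ d) (n : ℕ) {r : ℝ} (hr : 0 ≤ r) :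
    0 ≤ c.interference d n r :=
  one_sub_inv_pow_nonneg (div_nonneg hd (c.loss_nonneg hr)) n

/-- The bound by one serves for `r ≤ 1` and the linear bound for `r > 1`; the constant `2 ^ α` comes
from `1 + r ≤ 2` and `1 + r ≤ 2 r` respectively. The decay is integrable on the plane because `α >
2`. -/
lemma interference_le {d : ℝ} (hd : 0 ≤ d) (n : ℕ) {r : ℝ} (hr : 0 ≤ r) :
    c.interference d n r ≤ (2 ^ c.α * (1 + n * d / c.A)) * (1 + r) ^ (-c.α) := by
  have hA := c.A_pos
  have hα := c.α_pos
  have hu : 0 ≤ d / c.loss r := div_nonneg hd (c.loss_nonneg hr)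
  have hr1 : 0 < 1 + r := by linarith
  rw [Real.rpow_neg hr1.le]
  rcases le_or_gt r 1 with h | h
  · refine (one_sub_inv_pow_le_one hu n).trans ?_
    have h1 : (1 + r) ^ c.α ≤ 2 ^ c.α := Real.rpow_le_rpow hr1.le (by linarith) hα.le
    have h2 : 1 ≤ 2 ^ c.α * ((1 + r) ^ c.α)⁻¹ := by
      rw [← div_eq_mul_inv, one_le_div (by positivity)]; exact h1
    have h3 : 0 ≤ n * d / c.A := by positivity
    nlinarith
  · refine (one_sub_inv_pow_le_mul hu n).trans ?_
    have hr0 : 0 < r := by linarith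
    have h1 : (1 + r) ^ c.α ≤ 2 ^ c.α * r ^ c.α := by
      rw [← Real.mul_rpow zero_le_two hr0.le]
      exact Real.rpow_le_rpow hr1.le (by linarith) hα.le
    have h2 : (r ^ c.α)⁻¹ ≤ 2 ^ c.α * ((1 + r) ^ c.α)⁻¹ := by
      rw [← div_eq_mul_inv, inv_le_iff_one_le_mul₀ (by positivity), div_mul_eq_mul_div,
        one_le_div (by positivity)]
      exact h1
    have h3 : 0 ≤ n * d / c.A := by positivity
    calc n * (d / c.loss r) = n * d / c.A * (r ^ c.α)⁻¹ := by
          unfold loss; field_simp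
      _ ≤ n * d / c.A * (2 ^ c.α * ((1 + r) ^ c.α)⁻¹) := by gcongr
      _ ≤ (1 + n * d / c.A) * (2 ^ c.α * ((1 + r) ^ c.α)⁻¹) := by gcongr; linarith
      _ = _ := by ring

lemma integrable_interference {d : ℝ} (hd : 0 ≤ d) (n : ℕ) :
    Integrable fun z : Plane => c.interference d n ‖z‖ := by
  have h : Integrable fun z : Plane => (1 + ‖z‖) ^ (-c.α) :=
    integrable_one_add_norm (by simpa using c.two_lt_α)
  refine (h.const_mul (2 ^ c.α * (1 + n * d / c.A))).mono'
    ((c.measurable_interference d n).comp measurable_norm).aestronglyMeasurable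
    (ae_of_all _ fun z => ?_)
  rw [Real.norm_of_nonneg (interference_nonneg hd n (norm_nonneg _))]
  exact c.interference_le hd n (norm_nonneg _)

/-- The contribution of a point at distance `r` to the exponent of the success probability of a
link whose threshold times path loss is `d`. -/
noncomputable def exponent (d r : ℝ) : ℝ≥0∞ :=
  logOneAdd (ENNReal.ofReal d / ENNReal.ofReal (c.loss r))

@[fun_prop] lemma measurable_exponent : Measurable (Function.uncurry c.exponent) := by
  unfold exponent Function.uncurry; fun_prop

/-- Translation between the extended and the real integrand. At `r = 0` the path loss is zero and
the two conventions for division disagree when `d > 0`, hence `0 < r`; in the integrals this is a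
null set. -/
lemma expNeg_mul_exponent {d : ℝ} (hd : 0 ≤ d) (n : ℕ) {r : ℝ} (hr : 0 < r) :
    1 - expNeg (n * c.exponent d r) = ENNReal.ofReal (c.interference d n r) := by
  have hl := c.loss_pos hr
  have hu : 0 ≤ d / c.loss r := by positivity
  rw [expNeg_natCast_mul, exponent, expNeg_logOneAdd, interference,
    ← ENNReal.ofReal_div_of_pos hl, ← ENNReal.ofReal_one, ← ENNReal.ofReal_add zero_le_one hu,
    ← ENNReal.ofReal_inv_of_pos (by positivity), ← ENNReal.ofReal_pow (by positivity),
    ← ENNReal.ofReal_sub _ (by positivity), inv_pow]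

lemma lintegral_exponent {d : ℝ} (hd : 0 ≤ d) (n : ℕ) (w : Plane) :
    ∫⁻ z, 1 - expNeg (n * c.exponent d (dist w z)) =
      ENNReal.ofReal (2 * Real.pi * ∫ r in Set.Ioi (0 : ℝ), c.interference d n r * r) := by
  calc _ = ∫⁻ z : Plane, 1 - expNeg (n * c.exponent d ‖z - w‖) := by
        simp only [dist_comm w, dist_eq_norm]
    _ = ∫⁻ z : Plane, 1 - expNeg (n * c.exponent d ‖z‖) :=
        lintegral_sub_right_eq_self (fun z : Plane => 1 - expNeg (n * c.exponent d ‖z‖)) w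
    _ = ∫⁻ z : Plane, ENNReal.ofReal (c.interference d n ‖z‖) := by
        refine lintegral_congr_ae ?_
        filter_upwards [compl_mem_ae_iff.2 (measure_singleton (0 : Plane))] with z hz
        exact c.expNeg_mul_exponent hd n (norm_pos_iff.2 hz)
    _ = _ := by
        rw [← ofReal_integral_eq_lintegral_ofReal (c.integrable_interference hd n)
          (ae_of_all _ fun z => interference_nonneg hd n (norm_nonneg _)),
          integral_plane_norm (c.interference d n)]

/-- Power-law path loss is scale invariant: relative to the distance `r` of the serving station the
integrand no longer depends on `r` or `A`. The substitution `s = r x` then produces `r ^ 2 * H`. -/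
lemma interference_T_mul_loss {r x : ℝ} (hr : 0 < r) (hx : 0 < x) :
    c.interference (c.T * c.loss r) 1 (r * x) * x = x / (1 + x ^ c.α / c.T) := by
  have hT := c.T_pos
  have hA := c.A_pos
  have h1 : 0 < r ^ c.α := Real.rpow_pos_of_pos hr _
  have h2 : 0 < x ^ c.α := Real.rpow_pos_of_pos hx _
  unfold interference loss
  rw [Real.mul_rpow hr.le hx.le, pow_one]
  have : c.T * (c.A * r ^ c.α) / (c.A * (r ^ c.α * x ^ c.α)) = c.T / x ^ c.α := by field_simp
  rw [this]
  field_simp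
  ring

lemma integral_Ioi_interference {r : ℝ} (hr : 0 < r) :
    ∫ s in Set.Ioi r, c.interference (c.T * c.loss r) 1 s * s = r ^ 2 * c.H := by
  have h := integral_comp_mul_left_Ioi
    (fun s => c.interference (c.T * c.loss r) 1 s * s) 1 hr
  rw [mul_one] at h
  have h2 : ∫ x in Set.Ioi (1 : ℝ), c.interference (c.T * c.loss r) 1 (r * x) * (r * x) =
      r * c.H := by
    rw [H, ← integral_const_mul]
    refine setIntegral_congr_fun measurableSet_Ioi fun x hx => ?_
    have hx0 : 0 < x := lt_trans one_pos hx
    rw [← c.interference_T_mul_loss hr hx0]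
    ring
  rw [h2, smul_eq_mul] at h
  field_simp at h
  linarith

/-- The contribution of a station at distance `s` to the exponent of the probability that a
station at distance `r` is the nearest one and that its link succeeds. -/
noncomputable def exponentDown (r s : ℝ) : ℝ≥0∞ :=
  if s < r then ∞ else c.exponent (c.T * c.loss r) s

lemma measurable_exponentDown : Measurable (Function.uncurry c.exponentDown) := by
  have hm : Measurable fun q : ℝ × ℝ => (c.T * c.loss q.1, q.2) := by fun_prop
  have h : Measurable fun q : ℝ × ℝ => c.exponent (c.T * c.loss q.1) q.2 :=
    c.measurable_exponent.comp hm
  unfold exponentDown Function.uncurry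
  refine Measurable.ite (measurableSet_lt measurable_snd measurable_fst) measurable_const h

/-- Inside the disc of radius `r` the exponent is infinite and the integrand is one, which
contributes the area `π r²` of the void; outside it the interference contributes `2 π r² H`. -/
lemma lintegral_exponentDown {r : ℝ} (hr : 0 < r) (x : Plane) :
    ∫⁻ z, 1 - expNeg (c.exponentDown r (dist x z)) =
      ENNReal.ofReal (2 * Real.pi * c.H * r ^ 2 + Real.pi * r ^ 2) := by
  have hd : 0 ≤ c.T * c.loss r := mul_nonneg c.T_pos.le (c.loss_nonneg hr.le)
  let ψ : ℝ → ℝ := fun s => if s < r then 1 else c.interference (c.T * c.loss r) 1 s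
  have hψm : Measurable ψ := Measurable.ite measurableSet_Iio measurable_const (by fun_prop)
  have hψ0 : ∀ s, 0 ≤ s → 0 ≤ ψ s := fun s hs => by
    simp only [ψ]; split_ifs
    · exact zero_le_one
    · exact interference_nonneg hd 1 hs
  have hint : Integrable fun z : Plane => ψ ‖z‖ := by
    have h1 : Integrable ((Metric.ball (0 : Plane) r).indicator fun _ => (1 : ℝ)) :=
      (integrable_indicator_iff measurableSet_ball).2
        (integrableOn_const measure_ball_lt_top.ne)
    refine (h1.add (c.integrable_interference hd 1)).mono'
      (hψm.comp measurable_norm).aestronglyMeasurable (ae_of_all _ fun z => ?_)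
    rw [Real.norm_of_nonneg (hψ0 _ (norm_nonneg _))]
    have h0 := interference_nonneg (c := c) hd 1 (norm_nonneg z)
    by_cases h : ‖z‖ < r <;> simp [ψ, h, h0]
  have hval : ∫ s in Set.Ioi (0 : ℝ), ψ s * s = r ^ 2 / 2 + r ^ 2 * c.H := by
    have hintR : IntegrableOn (fun s => ψ s * s) (Set.Ioi 0) := by
      have := (integrable_fun_norm_addHaar (volume : Measure Plane) (f := ψ)).1 hint
      simpa [mul_comm] using this
    rw [← Set.Ioc_union_Ioi_eq_Ioi hr.le, setIntegral_union Set.Ioc_disjoint_Ioi_same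
      measurableSet_Ioi (hintR.mono_set Set.Ioc_subset_Ioi_self)
      (hintR.mono_set (Set.Ioi_subset_Ioi hr.le))]
    congr 1
    · rw [integral_Ioc_eq_integral_Ioo, setIntegral_congr_fun (g := fun s => s) measurableSet_Ioo
        fun s hs => by simp [ψ, hs.2], ← integral_Ioc_eq_integral_Ioo,
        ← intervalIntegral.integral_of_le hr.le, integral_id]
      ring
    · rw [← c.integral_Ioi_interference hr]
      refine setIntegral_congr_fun measurableSet_Ioi fun s hs => ?_
      simp [ψ, not_lt.2 (le_of_lt (Set.mem_Ioi.1 hs))]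
  calc _ = ∫⁻ z : Plane, 1 - expNeg (c.exponentDown r ‖z - x‖) := by
        simp only [dist_comm x, dist_eq_norm]
    _ = ∫⁻ z : Plane, 1 - expNeg (c.exponentDown r ‖z‖) :=
        lintegral_sub_right_eq_self (fun z : Plane => 1 - expNeg (c.exponentDown r ‖z‖)) x
    _ = ∫⁻ z : Plane, ENNReal.ofReal (ψ ‖z‖) := by
        refine lintegral_congr_ae ?_
        filter_upwards [compl_mem_ae_iff.2 (measure_singleton (0 : Plane))] with z hz
        have := c.expNeg_mul_exponent hd 1 (norm_pos_iff.2 hz)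
        by_cases h : ‖z‖ < r
        · simp [exponentDown, ψ, h]
        · simpa [exponentDown, ψ, h] using this
    _ = _ := by
        rw [← ofReal_integral_eq_lintegral_ofReal hint
          (ae_of_all _ fun z => hψ0 _ (norm_nonneg _)), integral_plane_norm ψ, hval]
        congr 1
        ring

end Params

/-! ### Success probabilities of links at fixed positions -/

/-- The SINR of link `i` when the links have path losses `L`, fading `e` and the noise is `σ`. -/
noncomputable def sinrOf (L : ℕ → ℝ≥0∞) (σ : ℝ≥0∞) (e : ℕ → ℝ) (i : ℕ) : ℝ≥0∞ :=
  (ENNReal.ofReal (e i) / L i) / (σ + ∑' j, if j = i then 0 else ENNReal.ofReal (e j) / L j)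

lemma measurable_sinrOf {β : Type*} [MeasurableSpace β] {L : ℕ → β → ℝ≥0∞} {e : ℕ → β → ℝ}
    (hL : ∀ j, Measurable (L j)) (he : ∀ j, Measurable (e j)) (σ : ℝ≥0∞) (i : ℕ) :
    Measurable fun b => sinrOf (fun j => L j b) σ (fun j => e j b) i := by
  have h : ∀ j, Measurable fun b => ENNReal.ofReal (e j b) / L j b := fun j => by
    have := hL j; have := he j; fun_prop
  refine (h i).div (measurable_const.add (Measurable.tsum fun j => ?_))
  split_ifs
  · exact measurable_const
  · exact h j

/-- Integration of a function of two independent random elements. -/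
lemma lintegral_of_indepFun {Ω α β : Type*} [MeasurableSpace Ω] [MeasurableSpace α]
    [MeasurableSpace β] {P : Measure Ω} [IsProbabilityMeasure P] {U : Ω → α} {V : Ω → β}
    (hU : Measurable U) (hV : Measurable V) (hind : IndepFun U V P) {h : α → β → ℝ≥0∞}
    (hh : Measurable (Function.uncurry h)) :
    ∫⁻ ω, h (U ω) (V ω) ∂P = ∫⁻ ω, ∫⁻ ω', h (U ω) (V ω') ∂P ∂P := by
  have e := (indepFun_iff_map_prod_eq_prod_map_map hU.aemeasurable hV.aemeasurable).1 hind
  have := Measure.isProbabilityMeasure_map (μ := P) hV.aemeasurable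
  have hi : Measurable fun a => ∫⁻ b, h a b ∂(P.map V) := hh.lintegral_prod_right'
  calc ∫⁻ ω, h (U ω) (V ω) ∂P = ∫⁻ q, Function.uncurry h q ∂(P.map fun ω => (U ω, V ω)) :=
        (lintegral_map hh (hU.prodMk hV)).symm
    _ = ∫⁻ a, ∫⁻ b, h a b ∂(P.map V) ∂(P.map U) := by
        rw [e, lintegral_prod _ hh.aemeasurable]; rfl
    _ = ∫⁻ ω, ∫⁻ b, h (U ω) b ∂(P.map V) ∂P := lintegral_map hi hU
    _ = _ := lintegral_congr fun ω => lintegral_map (hh.comp measurable_prodMk_left) hV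

section Links

variable {Ω : Type*} [MeasurableSpace Ω] {P : Measure Ω} [IsProbabilityMeasure P]

omit [IsProbabilityMeasure P] in
lemma ae_pos_of_expMeasure {E : Ω → ℝ} (hE : Measurable E) (hlaw : P.map E = expMeasure 1) :
    ∀ᵐ ω ∂P, 0 < E ω := by
  have h := ae_expMeasure_pos
  rw [← hlaw] at h
  exact ae_of_ae_map hE.aemeasurable h

/-- The success probability of a link. -/
lemma measure_le_sinrOf {E : ℕ → Ω → ℝ} (hE : ∀ j, Measurable (E j))
    (hlaw : ∀ j, P.map (E j) = expMeasure 1) (hind : iIndepFun E P) (i : ℕ) {L : ℕ → ℝ≥0∞}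
    (hL0 : L i ≠ 0) (hL : L i ≠ ∞) (σ T : ℝ≥0∞) :
    P {ω | T ≤ sinrOf L σ (fun j => E j ω) i} =
      expNeg (T * L i * σ + ∑' j, if j = i then 0 else logOneAdd (T * L i / L j)) := by
  rw [← measure_interference_le hE hlaw hind i (T * L i * σ) fun j => T * L i / L j]
  refine measure_congr ?_
  filter_upwards [ae_pos_of_expMeasure (hE i) (hlaw i)] with ω hω
  refine propext ?_
  change T ≤ sinrOf L σ (fun j => E j ω) i ↔ _ ≤ _
  -- A numerator that is neither zero nor infinite allows clearing the SINR denominator even when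
  -- noise plus interference is zero or infinite.
  have h0 : ENNReal.ofReal (E i ω) / L i ≠ 0 := by
    simp [ENNReal.div_eq_zero_iff, hω, hL]
  have ht : ENNReal.ofReal (E i ω) / L i ≠ ∞ := by
    simp [ENNReal.div_eq_top, hL0]
  rw [sinrOf, ENNReal.le_div_iff_mul_le (Or.inr h0) (Or.inr ht),
    ENNReal.le_div_iff_mul_le (Or.inl hL0) (Or.inl hL)]
  have : T * (σ + ∑' j, if j = i then 0 else ENNReal.ofReal (E j ω) / L j) * L i =
      T * L i * σ + ∑' j, if j = i then 0 else T * L i / L j * ENNReal.ofReal (E j ω) := by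
    rw [mul_right_comm, mul_add, ← ENNReal.tsum_mul_left]
    congr 2
    ext j
    split_ifs
    · simp
    · simp only [div_eq_mul_inv]; ring
  rw [this]

omit [IsProbabilityMeasure P] in
-- Independence means that the joint law is an infinite product, and a product over pairs is an
-- iterated product. It makes the fading at different times independent as whole sequences.
lemma iIndepFun_curry {E : ℕ → ℕ → Ω → ℝ} (hE : ∀ n j, Measurable (E n j))
    (hind : iIndepFun (fun q : ℕ × ℕ => E q.1 q.2) P) : iIndepFun (fun n ω j => E n j ω) P := by
  have := hind.isProbabilityMeasure
  have : ∀ n j, IsProbabilityMeasure (P.map (E n j)) :=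
    fun n j => Measure.isProbabilityMeasure_map (hE n j).aemeasurable
  have hm : ∀ n, Measurable fun ω j => E n j ω := fun n => measurable_pi_lambda _ (hE n)
  have : ∀ n, IsProbabilityMeasure (P.map fun ω j => E n j ω) :=
    fun n => Measure.isProbabilityMeasure_map (hm n).aemeasurable
  rw [iIndepFun_iff_map_fun_eq_infinitePi_map hm]
  have h := (iIndepFun_iff_map_fun_eq_infinitePi_map fun q : ℕ × ℕ => hE q.1 q.2).1 hind
  have h2 := congrArg (fun ν => ν.map (MeasurableEquiv.curry ℕ ℕ ℝ)) h
  have hmq : Measurable fun ω (q : ℕ × ℕ) => E q.1 q.2 ω :=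
    measurable_pi_lambda _ fun q => hE q.1 q.2
  rw [Measure.map_map (by fun_prop) hmq, Measure.infinitePi_map_curry fun n j => P.map (E n j)] at h2
  refine Eq.trans h2 ?_
  congr 1
  ext1 n
  refine ((iIndepFun_iff_map_fun_eq_infinitePi_map (hE n)).1 ?_).symm
  exact hind.precomp (g := fun j => (n, j)) fun j j' h => (Prod.mk.inj h).2

/-- The probability that one of several independent transmissions succeeds. -/
lemma measure_exists_le_sinrOf {E : ℕ → ℕ → Ω → ℝ} (hE : ∀ n j, Measurable (E n j))
    (hlaw : ∀ n j, P.map (E n j) = expMeasure 1)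
    (hind : iIndepFun (fun q : ℕ × ℕ => E q.1 q.2) P) (i : ℕ) {L : ℕ → ℝ≥0∞}
    (hL0 : L i ≠ 0) (hL : L i ≠ ∞) (σ T : ℝ≥0∞) (s : Finset ℕ) :
    P {ω | ∃ n ∈ s, T ≤ sinrOf L σ (fun j => E n j ω) i} =
      1 - (1 - expNeg (T * L i * σ + ∑' j, if j = i then 0 else logOneAdd (T * L i / L j))) ^
        s.card := by
  have hset : MeasurableSet {e : ℕ → ℝ | T ≤ sinrOf L σ e i} :=
    measurableSet_le measurable_const
      (measurable_sinrOf (fun j => measurable_const) (fun j => measurable_pi_apply j) σ i)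
  have hm : ∀ n, Measurable fun ω j => E n j ω := fun n => measurable_pi_lambda _ (hE n)
  have h := (iIndepFun_curry hE hind).measure_inter_preimage_eq_mul s
    (sets := fun _ => {e : ℕ → ℝ | T ≤ sinrOf L σ e i}ᶜ) fun _ _ => hset.compl
  have hcompl : {ω | ∃ n ∈ s, T ≤ sinrOf L σ (fun j => E n j ω) i}ᶜ =
      ⋂ n ∈ s, (fun ω j => E n j ω) ⁻¹' {e : ℕ → ℝ | T ≤ sinrOf L σ e i}ᶜ := by
    ext ω
    simp
  have hone : ∀ n, P ((fun ω j => E n j ω) ⁻¹' {e : ℕ → ℝ | T ≤ sinrOf L σ e i}ᶜ) =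
      1 - expNeg (T * L i * σ + ∑' j, if j = i then 0 else logOneAdd (T * L i / L j)) := by
    intro n
    rw [Set.preimage_compl, prob_compl_eq_one_sub (hm n hset),
      ← measure_le_sinrOf (hE n) (hlaw n)
        (hind.precomp (g := fun j => (n, j)) fun j j' h => (Prod.mk.inj h).2) i hL0 hL σ T]
    rfl
  have hmeas : MeasurableSet {ω | ∃ n ∈ s, T ≤ sinrOf L σ (fun j => E n j ω) i} := by
    rw [← compl_compl {ω | ∃ n ∈ s, T ≤ sinrOf L σ (fun j => E n j ω) i}, hcompl]
    exact (s.measurableSet_biInter fun n _ => hm n hset.compl).compl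
  rw [← compl_compl {ω | ∃ n ∈ s, T ≤ sinrOf L σ (fun j => E n j ω) i},
    prob_compl_eq_one_sub hmeas.compl, hcompl, h]
  simp only [hone, Finset.prod_const]

/-- A receiver at distance zero is covered as soon as the interference is finite. -/
lemma expNeg_le_measure_le_sinrOf {E : ℕ → Ω → ℝ} (hE : ∀ j, Measurable (E j))
    (hlaw : ∀ j, P.map (E j) = expMeasure 1) (hind : iIndepFun E P) (i : ℕ) {L : ℕ → ℝ≥0∞}
    (hL0 : L i = 0) (σ T : ℝ≥0∞) {s : ℝ≥0∞} (hs : s ≠ 0) :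
    expNeg (s * σ + ∑' j, if j = i then 0 else logOneAdd (s / L j)) ≤
      P {ω | T ≤ sinrOf L σ (fun j => E j ω) i} := by
  rw [← measure_interference_le hE hlaw hind i (s * σ) fun j => s / L j]
  refine measure_mono_ae ?_
  filter_upwards [ae_pos_of_expMeasure (hE i) (hlaw i)] with ω hω h
  change _ ≤ _ at h
  change T ≤ sinrOf L σ (fun j => E j ω) i
  have h1 : s * (σ + ∑' j, if j = i then 0 else ENNReal.ofReal (E j ω) / L j) =
      s * σ + ∑' j, if j = i then 0 else s / L j * ENNReal.ofReal (E j ω) := by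
    rw [mul_add, ← ENNReal.tsum_mul_left]
    congr 2
    ext j
    split_ifs
    · simp
    · simp only [div_eq_mul_inv]; ring
  rw [← h1] at h
  -- The auxiliary event bounds `s` times noise plus interference by a finite number, and `s ≠ 0`.
  -- With zero path loss on the link itself the SINR is then infinite.
  have h2 : σ + ∑' j, (if j = i then 0 else ENNReal.ofReal (E j ω) / L j) ≠ ∞ := by
    intro htop
    rw [htop, ENNReal.mul_top hs] at h
    exact absurd h (by simp)
  have h3 : ENNReal.ofReal (E i ω) / L i = ∞ := by
    rw [hL0]
    exact ENNReal.div_zero (by simpa using hω)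
  rw [sinrOf, h3, ENNReal.top_div_of_ne_top h2]
  exact le_top

end Links

/-- The binomial theorem without its constant term; it reduces coverage in several attempts to the
moments of `q`. -/
lemma one_sub_one_sub_pow (q : ℝ) (m : ℕ) :
    1 - (1 - q) ^ m = ∑ n ∈ Finset.Icc 1 m, (-1 : ℝ) ^ (n + 1) * (m.choose n : ℝ) * q ^ n := by
  have h := add_pow (-q) 1 m
  rw [Finset.sum_range_succ'] at h
  simp only [one_pow, mul_one, pow_zero, Nat.choose_zero_right, Nat.cast_one] at h
  have h2 : ∑ n ∈ Finset.Icc 1 m, (-1 : ℝ) ^ (n + 1) * (m.choose n : ℝ) * q ^ n =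
      ∑ n ∈ Finset.range m, (-1 : ℝ) ^ (n + 1 + 1) * (m.choose (n + 1) : ℝ) * q ^ (n + 1) := by
    rw [← Finset.Ico_succ_right_eq_Icc, Finset.sum_Ico_eq_sum_range]
    refine Finset.sum_congr (by simp) fun n _ => ?_
    rw [add_comm 1 n]
  rw [h2, sub_eq_neg_add 1 q, h]
  rw [sub_add_cancel_right, ← Finset.sum_neg_distrib]
  refine Finset.sum_congr rfl fun n _ => ?_
  rw [neg_pow q, pow_succ (-1 : ℝ) (n + 1)]
  ring

/-! ### Averaging direct coverage over the transmitters -/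

namespace Params

variable (c : Params)

/-- The conditional coverage probability of a receiver displaced by `y` from its transmitter, as a
function of the exponent contributed by the interferers. -/
noncomputable def condCoverage (y : Plane) (s : ℝ≥0∞) : ℝ≥0∞ :=
  1 - (1 - expNeg (ENNReal.ofReal (c.T * c.loss ‖y‖) * ENNReal.ofReal c.invSNR + s)) ^ c.τ

lemma continuous_condCoverage (y : Plane) : Continuous (c.condCoverage y) := by
  have hsub : Continuous fun a : ℝ≥0∞ => 1 - a := ENNReal.continuous_sub_left (by simp)
  exact hsub.comp ((ENNReal.continuous_pow _).comp
    (hsub.comp (continuous_expNeg.comp (continuous_const_add _))))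

lemma measurable_condCoverage {β : Type*} [MeasurableSpace β] {f : β → Plane} {g : β → ℝ≥0∞}
    (hf : Measurable f) (hg : Measurable g) : Measurable fun b => c.condCoverage (f b) (g b) := by
  unfold condCoverage
  fun_prop

lemma condCoverage_le_one (y : Plane) (s : ℝ≥0∞) : c.condCoverage y s ≤ 1 := tsub_le_self

lemma T_mul_loss_nonneg {r : ℝ} (hr : 0 ≤ r) : 0 ≤ c.T * c.loss r :=
  mul_nonneg c.T_pos.le (c.loss_nonneg hr)

end Params

section Poisson

variable {Ω : Type*} [MeasurableSpace Ω] {P : Measure Ω} [IsProbabilityMeasure P] {c : Params}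

lemma lintegral_expNeg_nat_mul_exponent {X : ℕ → Ω → Plane} (hX : IsPoissonProcess P X c.lamM)
    {d : ℝ} (hd : 0 ≤ d) (n : ℕ) (w : Plane) :
    ∫⁻ ω, expNeg (∑' j, n * c.exponent d (dist w (X j ω))) ∂P =
      ENNReal.ofReal (Real.exp (-(2 * Real.pi * c.lamM *
        ∫ r in Set.Ioi (0 : ℝ), c.interference d n r * r))) := by
  have hm : Measurable fun z => (n : ℝ≥0∞) * c.exponent d (dist w z) :=
    (c.measurable_exponent.comp (f := fun z => (d, dist w z)) (by fun_prop)).const_mul _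
  have h0 : 0 ≤ ∫ r in Set.Ioi (0 : ℝ), c.interference d n r * r :=
    setIntegral_nonneg measurableSet_Ioi fun r hr =>
      mul_nonneg (Params.interference_nonneg hd n (le_of_lt hr)) (le_of_lt hr)
  have hpi := Real.pi_pos.le
  have hl := c.lamM_pos.le
  rw [hX.lintegral_expNeg_tsum c.lamM_pos hm, c.lintegral_exponent hd, ← ENNReal.ofReal_mul hl,
    expNeg_ofReal (by positivity)]
  congr 3
  ring

/-- `p y` is the expectation of the random variable `1 - (1 - q) ^ τ` with values in `[0, 1]`; this
gives the bounds on `p`, which its alternating sum does not show. -/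
lemma lintegral_condCoverage {X : ℕ → Ω → Plane} (hX : IsPoissonProcess P X c.lamM)
    (y w : Plane) :
    c.p y ∈ Set.Icc (0 : ℝ) 1 ∧
    ∫⁻ ω, c.condCoverage y (∑' j, c.exponent (c.T * c.loss ‖y‖) (dist w (X j ω))) ∂P =
      ENNReal.ofReal (c.p y) := by
  have hd : 0 ≤ c.T * c.loss ‖y‖ := c.T_mul_loss_nonneg (norm_nonneg y)
  have hσ := c.invSNR_nonneg
  let S : Ω → ℝ≥0∞ := fun ω => ENNReal.ofReal (c.T * c.loss ‖y‖) * ENNReal.ofReal c.invSNR +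
    ∑' j, c.exponent (c.T * c.loss ‖y‖) (dist w (X j ω))
  have hterm : ∀ j, Measurable fun ω => c.exponent (c.T * c.loss ‖y‖) (dist w (X j ω)) := fun j =>
    c.measurable_exponent.comp (f := fun ω => (c.T * c.loss ‖y‖, dist w (X j ω)))
      (measurable_const.prodMk (measurable_const.dist (hX.measurable j)))
  have hSm : Measurable S := measurable_const.add (Measurable.tsum hterm)
  let q : Ω → ℝ := fun ω => (expNeg (S ω)).toReal
  have hqm : Measurable q := (measurable_expNeg.comp hSm).ennreal_toReal
  have hq : ∀ ω, ENNReal.ofReal (q ω) = expNeg (S ω) := fun ω =>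
    ENNReal.ofReal_toReal (expNeg_ne_top _)
  have hq0 : ∀ ω, 0 ≤ q ω := fun ω => ENNReal.toReal_nonneg
  have hq1 : ∀ ω, q ω ≤ 1 := fun ω => by
    have := ENNReal.toReal_mono ENNReal.one_ne_top (expNeg_le_one (S ω))
    simpa using this
  have hqn : ∀ n : ℕ, Integrable (fun ω => q ω ^ n) P := fun n =>
    Integrable.of_bound (hqm.pow_const n).aestronglyMeasurable 1 (ae_of_all _ fun ω => by
      rw [Real.norm_of_nonneg (pow_nonneg (hq0 ω) n)]
      exact pow_le_one₀ (hq0 ω) (hq1 ω))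
  have hmoment : ∀ n : ℕ, ∫ ω, q ω ^ n ∂P =
      Real.exp (-((n : ℝ) * c.loss ‖y‖ * c.T * c.invSNR)) *
      Real.exp (-(2 * Real.pi * c.lamM *
        ∫ r in Set.Ioi (0 : ℝ), (1 - ((1 + c.T * c.loss ‖y‖ / c.loss r) ^ n)⁻¹) * r)) := by
    intro n
    rw [integral_eq_lintegral_of_nonneg_ae (ae_of_all _ fun ω => pow_nonneg (hq0 ω) n)
      (hqm.pow_const n).aestronglyMeasurable]
    -- A power of `q` multiplies its exponent by `n`, so each moment is again a Laplace functional.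
    have h1 : ∀ ω, ENNReal.ofReal (q ω ^ n) =
        expNeg (ENNReal.ofReal (n * (c.T * c.loss ‖y‖ * c.invSNR))) *
        expNeg (∑' j, n * c.exponent (c.T * c.loss ‖y‖) (dist w (X j ω))) := by
      intro ω
      rw [ENNReal.ofReal_pow (hq0 ω), hq, ← expNeg_natCast_mul, mul_add, expNeg_add,
        ← ENNReal.tsum_mul_left, ENNReal.ofReal_mul (Nat.cast_nonneg n), ENNReal.ofReal_mul hd,
        ENNReal.ofReal_natCast]
    simp only [h1]
    rw [lintegral_const_mul' _ _ (expNeg_ne_top _), lintegral_expNeg_nat_mul_exponent hX hd,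
      expNeg_ofReal (by positivity), ENNReal.toReal_mul, ENNReal.toReal_ofReal (Real.exp_pos _).le,
      ENNReal.toReal_ofReal (Real.exp_pos _).le]
    congr 2
    ring
  have hp : c.p y = ∫ ω, (1 - (1 - q ω) ^ c.τ) ∂P := by
    simp only [one_sub_one_sub_pow]
    rw [integral_finsetSum _ fun n _ => (hqn n).const_mul _]
    unfold Params.p
    refine Finset.sum_congr rfl fun n _ => ?_
    rw [integral_const_mul, hmoment]
    ring
  have hb0 : ∀ ω, 0 ≤ 1 - (1 - q ω) ^ c.τ := fun ω => by
    have := pow_le_one₀ (n := c.τ) (sub_nonneg.2 (hq1 ω)) (by linarith [hq0 ω])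
    linarith
  have hb1 : ∀ ω, 1 - (1 - q ω) ^ c.τ ≤ 1 := fun ω => by
    have := pow_nonneg (sub_nonneg.2 (hq1 ω)) c.τ
    linarith
  have hbm : Measurable fun ω => 1 - (1 - q ω) ^ c.τ := by fun_prop
  have hbi : Integrable (fun ω => 1 - (1 - q ω) ^ c.τ) P :=
    Integrable.of_bound hbm.aestronglyMeasurable 1 (ae_of_all _ fun ω => by
      rw [Real.norm_of_nonneg (hb0 ω)]; exact hb1 ω)
  refine ⟨⟨hp ▸ integral_nonneg hb0, ?_⟩, ?_⟩
  · rw [hp]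
    calc _ ≤ ∫ _, (1 : ℝ) ∂P := integral_mono hbi (integrable_const _) hb1
      _ = 1 := by simp
  · rw [hp, ofReal_integral_eq_lintegral_ofReal hbi (ae_of_all _ hb0)]
    refine lintegral_congr fun ω => ?_
    change 1 - (1 - expNeg (S ω)) ^ c.τ = _
    rw [← hq, ← ENNReal.ofReal_one, ← ENNReal.ofReal_sub _ (hq0 ω),
      ← ENNReal.ofReal_pow (sub_nonneg.2 (hq1 ω)),
      ← ENNReal.ofReal_sub _ (pow_nonneg (sub_nonneg.2 (hq1 ω)) _)]

/-! ### Coverage by the nearest base station -/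

/-- Coverage by the base station nearest to `x`, for stations at `z` and fading `e`. -/
def CoveredDown (c : Params) (x : Plane) (z : ℕ → Plane) (e : ℕ → ℝ) : Prop :=
  ∃ s, (∀ j, dist x (z s) ≤ dist x (z j)) ∧
    ENNReal.ofReal c.T ≤ sinrOf (fun j => ENNReal.ofReal (c.loss (dist x (z j))))
      (ENNReal.ofReal c.invSNRc) e s

lemma measurableSet_coveredDown {β : Type*} [MeasurableSpace β] {x : β → Plane}
    {z : ℕ → β → Plane} {e : ℕ → β → ℝ} (hx : Measurable x) (hz : ∀ j, Measurable (z j))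
    (he : ∀ j, Measurable (e j)) :
    MeasurableSet {b | CoveredDown c (x b) (fun j => z j b) fun j => e j b} := by
  have hL : ∀ j, Measurable fun b => ENNReal.ofReal (c.loss (dist (x b) (z j b))) := fun j => by
    have := hz j; fun_prop
  have h : {b | CoveredDown c (x b) (fun j => z j b) fun j => e j b} =
      ⋃ s, ((⋂ j, {b | dist (x b) (z s b) ≤ dist (x b) (z j b)}) ∩
        {b | ENNReal.ofReal c.T ≤ sinrOf (fun j => ENNReal.ofReal (c.loss (dist (x b) (z j b))))
          (ENNReal.ofReal c.invSNRc) (fun j => e j b) s}) := by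
    ext b
    simp [CoveredDown]
  rw [h]
  refine MeasurableSet.iUnion fun s => (MeasurableSet.iInter fun j => ?_).inter ?_
  · exact measurableSet_le (hx.dist (hz s)) (hx.dist (hz j))
  · exact measurableSet_le measurable_const (measurable_sinrOf hL he _ s)

/-- Almost surely, no two points of a Poisson process have the same distance to `x`, and none of
them is equal to `x`. -/
lemma ae_dist_injective {Z : ℕ → Ω → Plane} {lam : ℝ} (hlam : 0 < lam)
    (hZ : IsPoissonProcess P Z lam) (x : Plane) :
    ∀ᵐ ω ∂P, ∀ s, Z s ω ≠ x ∧ ∀ j, j ≠ s → dist x (Z j ω) ≠ dist x (Z s ω) := by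
  have hnull : ∀ r : ℝ, volume {z : Plane | dist x z = r} = 0 := fun r => by
    have : {z : Plane | dist x z = r} = Metric.sphere x r := by
      ext z
      rw [Metric.mem_sphere, dist_comm z x]
      rfl
    rw [this, Measure.addHaar_sphere]
  have h1 : ∀ᵐ ω ∂P, ∀ s, Z s ω ≠ x := by
    have h := hZ.lintegral_tsum_indicator hlam (measurableSet_singleton x) (by simp)
    have hm : ∀ i, Measurable fun ω => ({x} : Set Plane).indicator (1 : Plane → ℝ≥0∞) (Z i ω) :=
      fun i => (measurable_one.indicator (measurableSet_singleton x)).comp (hZ.measurable i)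
    rw [measure_singleton, mul_zero, lintegral_eq_zero_iff (Measurable.tsum hm)] at h
    filter_upwards [h] with ω hω s hs
    have := ENNReal.tsum_eq_zero.1 hω s
    simp [hs] at this
  have h2 : ∀ᵐ ω ∂P, ∀ s j, j ≠ s → dist x (Z j ω) ≠ dist x (Z s ω) := by
    -- With infinite weight on ties, `1 - e^{-∑ g}` is the indicator that another point shares the
    -- distance. Circles are null, so its Mecke average vanishes.
    let g : Plane → Plane → ℝ≥0∞ := fun z w => if dist x w = dist x z then ∞ else 0
    have hg : Measurable (Function.uncurry g) :=
      Measurable.ite (measurableSet_eq_fun (f := fun q : Plane × Plane => dist x q.2)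
        (g := fun q : Plane × Plane => dist x q.1) (by fun_prop) (by fun_prop))
        measurable_const measurable_const
    have hgtop : ∀ z w, dist x w = dist x z → g z w = ∞ := fun z w h => if_pos h
    have hgzero : ∀ z w, dist x w ≠ dist x z → g z w = 0 := fun z w h => if_neg h
    clear_value g
    have hgm : ∀ s j, Measurable fun ω => if j = s then 0 else g (Z s ω) (Z j ω) := by
      intro s j
      split_ifs
      · exact measurable_const
      · exact hg.comp ((hZ.measurable s).prodMk (hZ.measurable j))
    have hv : Measurable (Function.uncurry fun (_ : Plane) (a : ℝ≥0∞) => 1 - expNeg a) := by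
      unfold Function.uncurry; fun_prop
    have hM := hZ.mecke hlam MeasurableSet.univ hg hv
      (fun _ => (ENNReal.continuous_sub_left (by simp)).comp continuous_expNeg)
      fun _ _ => tsub_le_self
    have hz : ∀ z, ∫⁻ ω, 1 - expNeg (∑' j, g z (Z j ω)) ∂P = 0 := by
      intro z
      have hgz : Measurable (g z) := hg.comp measurable_prodMk_left
      have hS : Measurable fun ω => ∑' j, g z (Z j ω) :=
        Measurable.tsum fun j => hgz.comp (hZ.measurable j)
      have hL := hZ.lintegral_expNeg_tsum hlam hgz
      have h0 : ∫⁻ w, 1 - expNeg (g z w) = 0 := by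
        rw [lintegral_eq_zero_iff (by fun_prop)]
        have : ∀ᵐ w : Plane, dist x w ≠ dist x z := by
          rw [ae_iff]; simpa using hnull (dist x z)
        filter_upwards [this] with w hw
        simp [hgzero z w hw]
      rw [h0, mul_zero, expNeg_zero] at hL
      rw [lintegral_sub (by fun_prop) (by rw [hL]; simp) (ae_of_all _ fun ω => expNeg_le_one _), hL]
      simp
    simp only [hz, lintegral_zero, mul_zero, Set.indicator_univ, Pi.one_apply, one_mul] at hM
    rw [lintegral_eq_zero_iff] at hM
    · filter_upwards [hM] with ω hω s j hj heq
      have h := ENNReal.tsum_eq_zero.1 hω s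
      have htop : ∑' j, (if j = s then 0 else g (Z s ω) (Z j ω)) = ∞ :=
        ENNReal.tsum_eq_top_of_eq_top ⟨j, by simp [hj, hgtop _ _ heq]⟩
      rw [htop] at h
      simp at h
    · exact Measurable.tsum fun s =>
        measurable_const.sub (measurable_expNeg.comp (Measurable.tsum (hgm s)))
  filter_upwards [h1, h2] with ω ha hb s
  exact ⟨ha s, hb s⟩

/-- The conditional probability of coverage by the nearest base station. -/
lemma measure_coveredDown {E : ℕ → Ω → ℝ} (hE : ∀ j, Measurable (E j))
    (hlaw : ∀ j, P.map (E j) = expMeasure 1) (hind : iIndepFun E P) {x : Plane} {z : ℕ → Plane}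
    (hz : ∀ s, z s ≠ x ∧ ∀ j, j ≠ s → dist x (z j) ≠ dist x (z s)) :
    P {ω | CoveredDown c x z fun j => E j ω} =
      ∑' s, expNeg (ENNReal.ofReal (c.T * c.loss (dist x (z s))) * ENNReal.ofReal c.invSNRc +
        ∑' j, if j = s then 0 else c.exponentDown (dist x (z s)) (dist x (z j))) := by
  -- A strictly nearer station makes the exponent infinite. Hence only the nearest station
  -- contributes to the sum; if none is nearest, both sides are zero.
  have hzero : ∀ s, (¬ ∀ j, dist x (z s) ≤ dist x (z j)) →
      expNeg (ENNReal.ofReal (c.T * c.loss (dist x (z s))) * ENNReal.ofReal c.invSNRc +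
        ∑' j, if j = s then 0 else c.exponentDown (dist x (z s)) (dist x (z j))) = 0 := by
    intro s hs
    push Not at hs
    obtain ⟨j, hj⟩ := hs
    have hne : j ≠ s := by rintro rfl; exact lt_irrefl _ hj
    have htop : ∑' j, (if j = s then 0 else c.exponentDown (dist x (z s)) (dist x (z j))) = ∞ :=
      ENNReal.tsum_eq_top_of_eq_top ⟨j, by simp [hne, Params.exponentDown, hj]⟩
    rw [htop, add_top, expNeg_top]
  by_cases hex : ∃ s, ∀ j, dist x (z s) ≤ dist x (z j)
  · obtain ⟨s, hs⟩ := hex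
    have huniq : ∀ t, (∀ j, dist x (z t) ≤ dist x (z j)) → t = s := fun t ht => by
      by_contra h
      exact (hz s).2 t h (le_antisymm (ht s) (hs t))
    rw [tsum_eq_single s fun t ht => hzero t fun h => ht (huniq t h)]
    have hset : {ω | CoveredDown c x z fun j => E j ω} =
        {ω | ENNReal.ofReal c.T ≤ sinrOf (fun j => ENNReal.ofReal (c.loss (dist x (z j))))
          (ENNReal.ofReal c.invSNRc) (fun j => E j ω) s} := by
      ext ω
      refine ⟨fun ⟨t, ht, h⟩ => ?_, fun h => ⟨s, hs, h⟩⟩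
      rw [huniq t ht] at h
      exact h
    have hpos : 0 < c.loss (dist x (z s)) := c.loss_pos (dist_pos.2 (hz s).1.symm)
    rw [hset, measure_le_sinrOf hE hlaw hind s (by simpa using hpos) (by simp)]
    rw [← ENNReal.ofReal_mul c.T_pos.le]
    congr 2
    refine tsum_congr fun j => ?_
    split_ifs with h
    · rfl
    · rw [Params.exponentDown, if_neg (not_lt.2 (hs j))]
      rfl
  · rw [ENNReal.tsum_eq_zero.2 fun s => hzero s fun h => hex ⟨s, h⟩]
    have : {ω | CoveredDown c x z fun j => E j ω} = ∅ := by
      ext ω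
      simp only [Set.mem_ofPred_eq, Set.mem_empty_iff_false, iff_false]
      exact fun ⟨s, h, _⟩ => hex ⟨s, h⟩
    rw [this, measure_empty]

/-- The probability of coverage by the base station nearest to `x`. -/
lemma lintegral_measure_coveredDown {Z : ℕ → Ω → Plane} (hZ : IsPoissonProcess P Z c.lamB)
    {E : ℕ → Ω → ℝ} (hE : ∀ j, Measurable (E j))
    (hlaw : ∀ j, P.map (E j) = expMeasure 1) (hind : iIndepFun E P) (x : Plane) :
    c.pc ∈ Set.Icc (0 : ℝ) 1 ∧
    ∫⁻ ω, P {ω' | CoveredDown c x (fun j => Z j ω) fun j => E j ω'} ∂P =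
      ENNReal.ofReal c.pc := by
  have hlam := c.lamB_pos
  have hpi := Real.pi_pos
  have hH : 0 ≤ c.H := setIntegral_nonneg measurableSet_Ioi fun r hr => by
    have h0 : (0 : ℝ) < r := lt_trans one_pos hr
    have := c.T_pos
    have := Real.rpow_pos_of_pos h0 c.α
    positivity
  have hσ := c.invSNRc_nonneg
  let g : Plane → Plane → ℝ≥0∞ := fun z w => c.exponentDown (dist x z) (dist x w)
  have hg : Measurable (Function.uncurry g) :=
    c.measurable_exponentDown.comp (f := fun q : Plane × Plane => (dist x q.1, dist x q.2))
      (by fun_prop)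
  have hgdef : ∀ z w, g z w = c.exponentDown (dist x z) (dist x w) := fun _ _ => rfl
  clear_value g
  let v : Plane → ℝ≥0∞ → ℝ≥0∞ := fun z s =>
    expNeg (ENNReal.ofReal (c.T * c.loss (dist x z)) * ENNReal.ofReal c.invSNRc + s)
  have hv : Measurable (Function.uncurry v) := by
    unfold v Function.uncurry; fun_prop
  have hM := hZ.mecke hlam MeasurableSet.univ hg hv
    (fun z => continuous_expNeg.comp (continuous_const_add _))
    fun z s => expNeg_le_one _
  simp only [Set.indicator_univ, Pi.one_apply, one_mul, Measure.restrict_univ] at hM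
  let Θ : ℝ → ℝ := fun r => Real.exp (-(c.T * c.invSNRc * c.A * r ^ c.α)) *
      Real.exp (-(2 * Real.pi * c.lamB * c.H * r ^ 2)) *
      Real.exp (-(c.lamB * Real.pi * r ^ 2))
  have hΘm : Measurable Θ := by unfold Θ; fun_prop
  have hΘ0 : ∀ r, 0 ≤ Θ r := fun r => by positivity
  have hin : ∀ᵐ z : Plane, ∫⁻ ω, v z (∑' j, g z (Z j ω)) ∂P = ENNReal.ofReal (Θ ‖z - x‖) := by
    filter_upwards [compl_mem_ae_iff.2 (measure_singleton x)] with z hz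
    have hr : 0 < dist x z := dist_pos.2 (Ne.symm hz)
    have hgz : Measurable (g z) := hg.of_uncurry_left
    have hd := c.T_mul_loss_nonneg hr.le
    simp only [v, expNeg_add]
    rw [lintegral_const_mul' _ _ (expNeg_ne_top _), hZ.lintegral_expNeg_tsum hlam hgz]
    simp only [hgdef]
    rw [c.lintegral_exponentDown hr, ← ENNReal.ofReal_mul hd, ← ENNReal.ofReal_mul hlam.le,
      expNeg_ofReal (by positivity), expNeg_ofReal (by positivity),
      ← ENNReal.ofReal_mul (Real.exp_pos _).le, ← dist_eq_norm, dist_comm z x]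
    simp only [Θ, Params.loss, ← Real.exp_add]
    congr 2
    ring
  rw [lintegral_congr_ae hin,
    lintegral_sub_right_eq_self (fun z : Plane => ENNReal.ofReal (Θ ‖z‖)) x] at hM
  have hL : ∫⁻ ω, P {ω' | CoveredDown c x (fun j => Z j ω) fun j => E j ω'} ∂P =
      ENNReal.ofReal c.lamB * ∫⁻ z : Plane, ENNReal.ofReal (Θ ‖z‖) := by
    rw [← hM]
    refine lintegral_congr_ae ?_
    filter_upwards [ae_dist_injective hlam hZ x] with ω hω
    simp only [v, hgdef]
    exact measure_coveredDown hE hlaw hind hω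
  -- The integral is the average of a probability. This bound supplies both the integrability of `Θ`
  -- and `pc ≤ 1`, with no estimate of the integrand.
  have hle : ENNReal.ofReal c.lamB * ∫⁻ z : Plane, ENNReal.ofReal (Θ ‖z‖) ≤ 1 := by
    rw [← hL]
    exact (lintegral_mono fun ω => prob_le_one).trans (by simp)
  have hint : Integrable fun z : Plane => Θ ‖z‖ := by
    refine (lintegral_ofReal_ne_top_iff_integrable
      (hΘm.comp measurable_norm).aestronglyMeasurable (ae_of_all _ fun z => hΘ0 _)).1 fun h => ?_
    change ∫⁻ z : Plane, ENNReal.ofReal (Θ ‖z‖) = ∞ at h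
    rw [h, ENNReal.mul_top (by simpa using hlam)] at hle
    exact absurd hle (by simp)
  have hpc : ENNReal.ofReal c.lamB * ∫⁻ z : Plane, ENNReal.ofReal (Θ ‖z‖) =
      ENNReal.ofReal c.pc := by
    rw [← ofReal_integral_eq_lintegral_ofReal hint (ae_of_all _ fun z => hΘ0 _),
      ← ENNReal.ofReal_mul hlam.le, integral_plane_norm Θ]
    congr 1
    unfold Params.pc
    ring
  rw [hpc] at hL hle
  refine ⟨⟨?_, by simpa using hle⟩, hL⟩
  unfold Params.pc
  have : 0 ≤ ∫ r in Set.Ioi (0 : ℝ), Θ r * r :=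
    setIntegral_nonneg measurableSet_Ioi fun r hr => mul_nonneg (hΘ0 r) (le_of_lt hr)
  positivity

end Poisson

/-! ### Direct coverage given the transmitters -/

/-- Coverage by transmitter `i` of a receiver at `w`, for transmitters at `x` and fading `e`. -/
def CoveredDirect (c : Params) (i : ℕ) (x : ℕ → Plane) (w : Plane) (e : ℕ → ℕ → ℝ) : Prop :=
  ∃ n ∈ Finset.Icc 1 c.τ, ENNReal.ofReal c.T ≤
    sinrOf (fun j => ENNReal.ofReal (c.loss (dist w (x j)))) (ENNReal.ofReal c.invSNR) (e n) i

lemma measurableSet_coveredDirect {c : Params} {β : Type*} [MeasurableSpace β] (i : ℕ)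
    {x : ℕ → β → Plane} {w : β → Plane} {e : ℕ → ℕ → β → ℝ} (hx : ∀ j, Measurable (x j))
    (hw : Measurable w) (he : ∀ n j, Measurable (e n j)) :
    MeasurableSet {b | CoveredDirect c i (fun j => x j b) (w b) fun n j => e n j b} := by
  have hL : ∀ j, Measurable fun b => ENNReal.ofReal (c.loss (dist (w b) (x j b))) := fun j => by
    have := hx j; fun_prop
  have h : {b | CoveredDirect c i (fun j => x j b) (w b) fun n j => e n j b} =
      ⋃ n ∈ Finset.Icc 1 c.τ, {b | ENNReal.ofReal c.T ≤
        sinrOf (fun j => ENNReal.ofReal (c.loss (dist (w b) (x j b)))) (ENNReal.ofReal c.invSNR)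
          (fun j => e n j b) i} := by
    ext b
    simp [CoveredDirect]
  rw [h]
  exact Finset.measurableSet_biUnion _ fun n _ =>
    measurableSet_le measurable_const (measurable_sinrOf hL (he n) _ i)

namespace Params

variable (c : Params)

/-- The exponent contributed by the points `x j`, `j ≠ i`, to the success probability of the link
from `x i` to `w`. -/
noncomputable def exponentSum (i : ℕ) (x : ℕ → Plane) (w : Plane) : ℝ≥0∞ :=
  ∑' j, if j = i then 0 else c.exponent (c.T * c.loss ‖w - x i‖) (dist w (x j))

lemma measurable_exponentSum {β : Type*} [MeasurableSpace β] (i : ℕ) {x : ℕ → β → Plane}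
    {w : β → Plane} (hx : ∀ j, Measurable (x j)) (hw : Measurable w) :
    Measurable fun b => c.exponentSum i (fun j => x j b) (w b) := by
  refine Measurable.tsum fun j => ?_
  split_ifs
  · exact measurable_const
  · have h : Measurable fun b => (c.T * c.loss ‖w b - x i b‖, dist (w b) (x j b)) := by
      have := hx i; have := hx j; fun_prop
    exact c.measurable_exponent.comp h

/-- Dominated convergence, the case `d = 1` being the majorant. It serves a receiver at its
transmitter's own position, where `d → 0` makes the lower bound for the coverage probability tend to
one. -/
lemma tendsto_lintegral_exponent (w : Plane) :
    Tendsto (fun m : ℕ => ∫⁻ z, 1 - expNeg (c.exponent (1 / ((m : ℝ) + 1)) (dist w z))) atTop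
      (𝓝 0) := by
  have hm : ∀ d : ℝ, Measurable fun z => 1 - expNeg (c.exponent d (dist w z)) := fun d =>
    measurable_const.sub (measurable_expNeg.comp
      (c.measurable_exponent.comp (f := fun z => (d, dist w z)) (by fun_prop)))
  have hfin := c.lintegral_exponent zero_le_one 1 w
  simp only [Nat.cast_one, one_mul] at hfin
  have hlim := tendsto_lintegral_of_dominated_convergence (μ := (volume : Measure Plane))
    (F := fun (m : ℕ) z => 1 - expNeg (c.exponent (1 / ((m : ℝ) + 1)) (dist w z)))
    (f := fun _ => 0) (fun z => 1 - expNeg (c.exponent 1 (dist w z))) (fun m => hm _)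
    (fun m => ae_of_all _ fun z => ?_) (by rw [hfin]; simp) ?_
  · simpa using hlim
  · simp only [exponent, expNeg_logOneAdd]
    have : (1 : ℝ) / ((m : ℝ) + 1) ≤ 1 := by
      rw [div_le_one (by positivity)]; linarith [Nat.cast_nonneg (α := ℝ) m]
    gcongr
  · filter_upwards [compl_mem_ae_iff.2 (measure_singleton w)] with z hz
    have hr : 0 < dist w z := dist_pos.2 (Ne.symm hz)
    have h1 : ∀ m : ℕ, 1 - expNeg (c.exponent (1 / ((m : ℝ) + 1)) (dist w z)) ≤
        ENNReal.ofReal (1 / ((m : ℝ) + 1) / c.loss (dist w z)) := fun m => by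
      have h := c.expNeg_mul_exponent (d := 1 / ((m : ℝ) + 1)) (by positivity) 1 hr
      simp only [Nat.cast_one, one_mul] at h
      rw [h]
      have hl := c.loss_pos hr
      refine ENNReal.ofReal_le_ofReal ?_
      have := one_sub_inv_pow_le_mul (u := 1 / ((m : ℝ) + 1) / c.loss (dist w z)) (by positivity) 1
      simpa [interference] using this
    refine tendsto_of_tendsto_of_tendsto_of_le_of_le tendsto_const_nhds ?_
      (fun m => bot_le) h1
    have h2 := (tendsto_one_div_add_atTop_nhds_zero_nat (𝕜 := ℝ)).div_const (c.loss (dist w z))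
    rw [zero_div] at h2
    simpa [Function.comp_def] using (ENNReal.continuous_ofReal.tendsto 0).comp h2

end Params

/-! ### Conditioning and independence in the network -/

namespace Network

variable {Ω : Type*} [MeasurableSpace Ω] {P : Measure Ω} [IsProbabilityMeasure P] {c : Params}
  {N : Network Ω}

/-- The values of the transmitters and their clusters. -/
abbrev ClusterSpace : Type := (ℕ → Plane) × (ℕ → ℕ) × (ℕ → ℕ → Plane)

namespace IsModel

omit [IsProbabilityMeasure P] in
lemma measurable_transmitters (hN : N.IsModel c P) : Measurable N.transmitters :=
  measurable_pi_lambda _ hN.poisson_X.measurable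

omit [IsProbabilityMeasure P] in
lemma measurable_clusters (hN : N.IsModel c P) : Measurable N.clusters :=
  hN.measurable_transmitters.prodMk ((measurable_pi_lambda _ hN.measurable_K).prodMk
    (measurable_pi_lambda _ fun i => measurable_pi_lambda _ fun k => hN.measurable_Y i k))

omit [IsProbabilityMeasure P] in
lemma measurable_stations (hN : N.IsModel c P) : Measurable N.stations :=
  measurable_pi_lambda _ hN.poisson_Z.measurable

omit [IsProbabilityMeasure P] in
lemma measurable_fading (hN : N.IsModel c P) : Measurable N.fading :=
  measurable_pi_lambda _ fun i => measurable_pi_lambda _ fun k => measurable_pi_lambda _ fun j =>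
    measurable_pi_lambda _ fun n => hN.measurable_F i k j n

omit [IsProbabilityMeasure P] in
lemma measurable_fadingDown (hN : N.IsModel c P) : Measurable N.fadingDown :=
  measurable_pi_lambda _ fun i => measurable_pi_lambda _ fun k => measurable_pi_lambda _ fun j =>
    hN.measurable_G i k j

omit [IsProbabilityMeasure P] in
lemma iIndepFun_F (hN : N.IsModel c P) (i k : ℕ) :
    iIndepFun (fun q : ℕ × ℕ => N.F i k q.2 q.1) P :=
  hN.indep_F.precomp (g := fun q : ℕ × ℕ => (i, k, q.2, q.1)) fun q q' h => by
    simp only [Prod.mk.injEq] at h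
    exact Prod.ext h.2.2.2 h.2.2.1

omit [IsProbabilityMeasure P] in
lemma iIndepFun_G (hN : N.IsModel c P) (i k : ℕ) : iIndepFun (fun j => N.G i k j) P :=
  hN.indep_G.precomp (g := fun j => (i, k, j)) fun j j' h => by
    simp only [Prod.mk.injEq] at h
    exact h.2.2

/-- Coverage by the transmitter, given the positions of the transmitters. -/
lemma measure_coveredDirect (hN : N.IsModel c P) (i k : ℕ) {x : ℕ → Plane} {w : Plane}
    (hw : w ≠ x i) :
    P {ω | CoveredDirect c i x w fun n j => N.F i k j n ω} =
      c.condCoverage (w - x i) (c.exponentSum i x w) := by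
  have hpos : 0 < c.loss (dist w (x i)) := c.loss_pos (dist_pos.2 hw)
  have h := measure_exists_le_sinrOf (E := fun n j => N.F i k j n)
    (fun n j => hN.measurable_F i k j n) (fun n j => hN.law_F i k j n) (hN.iIndepFun_F i k) i
    (L := fun j => ENNReal.ofReal (c.loss (dist w (x j)))) (by simpa using hpos) (by simp)
    (ENNReal.ofReal c.invSNR) (ENNReal.ofReal c.T) (Finset.Icc 1 c.τ)
  refine Eq.trans h ?_
  rw [← ENNReal.ofReal_mul c.T_pos.le, Nat.card_Icc, Nat.add_sub_cancel]
  simp only [Params.condCoverage, Params.exponentSum, Params.exponent, dist_eq_norm]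

/-- Coverage by the transmitter of a receiver at the same position. -/
lemma expNeg_le_measure_coveredDirect (hN : N.IsModel c P) (hτ : c.τ ≠ 0) (i k : ℕ)
    (x : ℕ → Plane) {d : ℝ} (hd : 0 < d) :
    expNeg (ENNReal.ofReal d * ENNReal.ofReal c.invSNR +
        ∑' j, if j = i then 0 else c.exponent d (dist (x i) (x j))) ≤
      P {ω | CoveredDirect c i x (x i) fun n j => N.F i k j n ω} := by
  have h := expNeg_le_measure_le_sinrOf (E := fun j => N.F i k j 1)
    (fun j => hN.measurable_F i k j 1) (fun j => hN.law_F i k j 1)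
    ((hN.iIndepFun_F i k).precomp (g := fun j => (1, j)) fun j j' h => (Prod.mk.inj h).2) i
    (L := fun j => ENNReal.ofReal (c.loss (dist (x i) (x j)))) (by simp [c.loss_zero])
    (ENNReal.ofReal c.invSNR) (ENNReal.ofReal c.T) (s := ENNReal.ofReal d) (by simpa using hd)
  refine h.trans (measure_mono fun ω hω => ?_)
  exact ⟨1, by simp; omega, hω⟩

/-- The fading is independent of the clusters, so it can be integrated out with the clusters frozen,
even when the receiver position `w` depends on them. -/
lemma lintegral_mul_coveredD2D (hN : N.IsModel c P) (i k : ℕ) {a : ClusterSpace → ℝ≥0∞}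
    {w : ClusterSpace → Plane} (ha : Measurable a) (hw : Measurable w) :
    ∫⁻ ω, a (N.clusters ω) *
        {ω' | N.CoveredD2D c i k (w (N.clusters ω')) ω'}.indicator 1 ω ∂P =
      ∫⁻ ω, a (N.clusters ω) * P {ω' | CoveredDirect c i (N.transmitters ω) (w (N.clusters ω))
        fun n j => N.F i k j n ω'} ∂P := by
  have hind : IndepFun N.clusters N.fading P :=
    hN.indep_clusters.comp measurable_id (measurable_fst.comp measurable_snd)
  let S : Set (ClusterSpace × (ℕ → ℕ → ℕ → ℕ → ℝ)) :=
    {q | CoveredDirect c i (fun j => q.1.1 j) (w q.1) fun n j => q.2 i k j n}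
  have hS : MeasurableSet S := measurableSet_coveredDirect i
    (fun j => by fun_prop) (hw.comp measurable_fst) (fun n j => by fun_prop)
  have h := lintegral_of_indepFun hN.measurable_clusters hN.measurable_fading hind
    (h := fun q f => a q * S.indicator 1 (q, f))
    ((ha.comp measurable_fst).mul (measurable_one.indicator hS))
  refine Eq.trans h (lintegral_congr fun ω => ?_)
  have hSω : MeasurableSet {ω' | (N.clusters ω, N.fading ω') ∈ S} :=
    (measurable_const.prodMk hN.measurable_fading) hS
  have hm : Measurable fun ω' => {ω' | (N.clusters ω, N.fading ω') ∈ S}.indicator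
      (1 : Ω → ℝ≥0∞) ω' := measurable_one.indicator hSω
  refine (lintegral_const_mul _ hm).trans ?_
  rw [lintegral_indicator_one hSω]
  rfl

omit [IsProbabilityMeasure P] in
lemma measurableSet_coveredD2D (hN : N.IsModel c P) (i k : ℕ) {w : Ω → Plane}
    (hw : Measurable w) : MeasurableSet {ω | N.CoveredD2D c i k (w ω) ω} :=
  measurableSet_coveredDirect i hN.poisson_X.measurable hw fun n j => hN.measurable_F i k j n

omit [IsProbabilityMeasure P] in
lemma measurableSet_coveredBS (hN : N.IsModel c P) (i k : ℕ) :
    MeasurableSet {ω | N.CoveredBS c i k ω} :=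
  measurableSet_coveredDown (hN.poisson_X.measurable i) hN.poisson_Z.measurable
    fun j => hN.measurable_G i k j

omit [IsProbabilityMeasure P] in
lemma measurableSet_coveredAssisted (hN : N.IsModel c P) (i k : ℕ) {w : Ω → Plane}
    (hw : Measurable w) : MeasurableSet {ω | N.CoveredAssisted c i k (w ω) ω} :=
  (hN.measurableSet_coveredD2D i k hw).union (hN.measurableSet_coveredBS i k)

/-- Coverage by the base station is independent of everything that determines coverage by the
transmitter. -/
lemma lintegral_mul_coveredBS (hN : N.IsModel c P) (i k : ℕ)
    {g : ClusterSpace → (ℕ → ℕ → ℕ → ℕ → ℝ) → ℝ≥0∞} (hg : Measurable (Function.uncurry g)) :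
    ∫⁻ ω, g (N.clusters ω) (N.fading ω) * {ω' | N.CoveredBS c i k ω'}.indicator 1 ω ∂P =
      ENNReal.ofReal c.pc * ∫⁻ ω, g (N.clusters ω) (N.fading ω) ∂P := by
  have hpc := fun x => lintegral_measure_coveredDown hN.poisson_Z (fun j => hN.measurable_G i k j)
    (fun j => hN.law_G i k j) (hN.iIndepFun_G i k) x
  let D : Set (Plane × (ℕ → Plane) × (ℕ → ℕ → ℕ → ℝ)) :=
    {q | CoveredDown c q.1 (fun j => q.2.1 j) fun j => q.2.2 i k j}
  have hD : MeasurableSet D := measurableSet_coveredDown measurable_fst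
    (fun j => by fun_prop) (fun j => by fun_prop)
  have hd : Measurable (D.indicator (1 : Plane × (ℕ → Plane) × (ℕ → ℕ → ℕ → ℝ) → ℝ≥0∞)) :=
    measurable_one.indicator hD
  have hDP : ∀ x z, ∫⁻ ω, D.indicator 1 (x, z, N.fadingDown ω) ∂P =
      P {ω' | CoveredDown c x z fun j => N.G i k j ω'} := fun x z =>
    lintegral_indicator_one (measurable_const.prodMk
      (measurable_const.prodMk hN.measurable_fadingDown) hD)
  have hL : ∫⁻ ω, g (N.clusters ω) (N.fading ω) * {ω' | N.CoveredBS c i k ω'}.indicator 1 ω ∂P =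
      ∫⁻ ω, g (N.clusters ω) (N.fading ω) *
        D.indicator 1 ((N.clusters ω).1 i, N.stations ω, N.fadingDown ω) ∂P := rfl
  rw [hL]
  generalize D.indicator (1 : Plane × (ℕ → Plane) × (ℕ → ℕ → ℕ → ℝ) → ℝ≥0∞) = d at hd hDP ⊢
  have hfd : Measurable fun ω => (N.fading ω, N.fadingDown ω) :=
    hN.measurable_fading.prodMk hN.measurable_fadingDown
  have hind : IndepFun N.clusters N.fading P :=
    hN.indep_clusters.comp measurable_id (measurable_fst.comp measurable_snd)
  have hA := lintegral_of_indepFun hN.measurable_clusters (hN.measurable_stations.prodMk hfd)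
    hN.indep_clusters (h := fun q r => g q r.2.1 * d (q.1 i, r.1, r.2.2))
    ((hg.comp (f := fun s : ClusterSpace × (ℕ → Plane) × (ℕ → ℕ → ℕ → ℕ → ℝ) ×
      (ℕ → ℕ → ℕ → ℝ) => (s.1, s.2.2.1)) (by fun_prop)).mul (hd.comp
      (f := fun s : ClusterSpace × (ℕ → Plane) × (ℕ → ℕ → ℕ → ℕ → ℝ) ×
      (ℕ → ℕ → ℕ → ℝ) => (s.1.1 i, s.2.1, s.2.2.2)) (by fun_prop)))
  have hB := lintegral_of_indepFun hN.measurable_clusters hN.measurable_fading hind hg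
  have hgq : ∀ q, Measurable (g q) := fun q => hg.comp measurable_prodMk_left
  have hgf : ∀ q, Measurable fun ω => g q (N.fading ω) := fun q =>
    (hgq q).comp hN.measurable_fading
  have hdz : ∀ x z, Measurable fun ω => d (x, z, N.fadingDown ω) := fun x z =>
    hd.comp (measurable_const.prodMk (measurable_const.prodMk hN.measurable_fadingDown))
  have hcond : ∀ q z, ∫⁻ ω, g q (N.fading ω) * d (q.1 i, z, N.fadingDown ω) ∂P =
      (∫⁻ ω, g q (N.fading ω) ∂P) *
        P {ω' | CoveredDown c (q.1 i) z fun j => N.G i k j ω'} := by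
    intro q z
    have hE := lintegral_of_indepFun hN.measurable_fading hN.measurable_fadingDown
      hN.indep_fading (h := fun f r => g q f * d (q.1 i, z, r))
      (((hgq q).comp measurable_fst).mul (hd.comp
        (f := fun s : (ℕ → ℕ → ℕ → ℕ → ℝ) × (ℕ → ℕ → ℕ → ℝ) => (q.1 i, z, s.2)) (by fun_prop)))
    rw [hE, lintegral_congr fun ω => lintegral_const_mul (g q (N.fading ω)) (hdz (q.1 i) z),
      hDP, lintegral_mul_const _ (hgf q)]
  -- With the clusters frozen at `q`, the stations are separated from all fading and then the two
  -- kinds of fading from each other. The remaining probability is `pc` for every position `q.1 i`,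
  -- which is why the common dependence on the transmitter leaves no correlation.
  have hinner : ∀ q, ∫⁻ ω, g q (N.fading ω) * d (q.1 i, N.stations ω, N.fadingDown ω) ∂P =
      ENNReal.ofReal c.pc * ∫⁻ ω, g q (N.fading ω) ∂P := by
    intro q
    have hC := lintegral_of_indepFun hN.measurable_stations hfd hN.indep_stations
      (h := fun z r => g q r.1 * d (q.1 i, z, r.2))
      (((hgq q).comp (f := fun s : (ℕ → Plane) × (ℕ → ℕ → ℕ → ℕ → ℝ) × (ℕ → ℕ → ℕ → ℝ) => s.2.1)
        (by fun_prop)).mul (hd.comp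
        (f := fun s : (ℕ → Plane) × (ℕ → ℕ → ℕ → ℕ → ℝ) × (ℕ → ℕ → ℕ → ℝ) =>
          (q.1 i, s.1, s.2.2)) (by fun_prop)))
    have hmeas : Measurable fun ω => P {ω' | CoveredDown c (q.1 i) (N.stations ω)
        fun j => N.G i k j ω'} := by
      simp only [← hDP]
      exact (hd.comp (f := fun s : Ω × Ω => (q.1 i, N.stations s.1, N.fadingDown s.2))
        (measurable_const.prodMk ((hN.measurable_stations.comp measurable_fst).prodMk
          (hN.measurable_fadingDown.comp measurable_snd)))).lintegral_prod_right'
    rw [hC, lintegral_congr fun ω => hcond q (N.stations ω), lintegral_const_mul _ hmeas, mul_comm]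
    congr 1
    exact (hpc (q.1 i)).2
  rw [hA, hB, lintegral_congr fun ω => hinner (N.clusters ω)]
  exact lintegral_const_mul' _ _ ENNReal.ofReal_ne_top

/-- Assisted coverage is direct coverage, or else coverage by the station without direct coverage;
the latter has weight `pc` times that of no direct coverage. The form `pc + (1 - pc) * _` involves
no difference of possibly infinite integrals. -/
lemma lintegral_mul_coveredAssisted (hN : N.IsModel c P) (i k : ℕ) {a : ClusterSpace → ℝ≥0∞}
    {w : ClusterSpace → Plane} (ha : Measurable a) (hw : Measurable w) :
    ∫⁻ ω, a (N.clusters ω) *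
        {ω' | N.CoveredAssisted c i k (w (N.clusters ω')) ω'}.indicator 1 ω ∂P =
      ENNReal.ofReal c.pc * ∫⁻ ω, a (N.clusters ω) ∂P + (1 - ENNReal.ofReal c.pc) *
        ∫⁻ ω, a (N.clusters ω) *
          {ω' | N.CoveredD2D c i k (w (N.clusters ω')) ω'}.indicator 1 ω ∂P := by
  have hpc1 : ENNReal.ofReal c.pc ≤ 1 := by
    simpa using (lintegral_measure_coveredDown hN.poisson_Z (fun j => hN.measurable_G i k j)
      (fun j => hN.law_G i k j) (hN.iIndepFun_G i k) 0).1.2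
  let S : Set (ClusterSpace × (ℕ → ℕ → ℕ → ℕ → ℝ)) :=
    {q | CoveredDirect c i (fun j => q.1.1 j) (w q.1) fun n j => q.2 i k j n}
  have hS : MeasurableSet S := measurableSet_coveredDirect i
    (fun j => by fun_prop) (hw.comp measurable_fst) (fun n j => by fun_prop)
  have hsplit := hN.lintegral_mul_coveredBS i k (g := fun q f => a q * Sᶜ.indicator 1 (q, f))
    ((ha.comp measurable_fst).mul (measurable_one.indicator hS.compl))
  have hm1 : Measurable fun ω => a (N.clusters ω) * S.indicator 1 (N.clusters ω, N.fading ω) :=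
    ((ha.comp measurable_fst).mul (measurable_one.indicator hS)).comp
      (hN.measurable_clusters.prodMk hN.measurable_fading)
  have hD2D : ∫⁻ ω, a (N.clusters ω) *
        {ω' | N.CoveredD2D c i k (w (N.clusters ω')) ω'}.indicator 1 ω ∂P =
      ∫⁻ ω, a (N.clusters ω) * S.indicator 1 (N.clusters ω, N.fading ω) ∂P := rfl
  have hdec : ∀ ω, a (N.clusters ω) *
        {ω' | N.CoveredAssisted c i k (w (N.clusters ω')) ω'}.indicator 1 ω =
      a (N.clusters ω) * S.indicator 1 (N.clusters ω, N.fading ω) +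
        a (N.clusters ω) * Sᶜ.indicator 1 (N.clusters ω, N.fading ω) *
          {ω' | N.CoveredBS c i k ω'}.indicator 1 ω := by
    intro ω
    have hiff : ω ∈ {ω' | N.CoveredAssisted c i k (w (N.clusters ω')) ω'} ↔
        (N.clusters ω, N.fading ω) ∈ S ∨ ω ∈ {ω' | N.CoveredBS c i k ω'} := Iff.rfl
    by_cases h1 : (N.clusters ω, N.fading ω) ∈ S
    · rw [Set.indicator_of_mem (hiff.2 (Or.inl h1)), Set.indicator_of_mem h1,
        Set.indicator_of_notMem (Set.notMem_compl_iff.2 h1)]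
      simp
    · rw [Set.indicator_of_notMem h1, Set.indicator_of_mem (s := Sᶜ) h1]
      by_cases h2 : ω ∈ {ω' | N.CoveredBS c i k ω'}
      · rw [Set.indicator_of_mem (hiff.2 (Or.inr h2)), Set.indicator_of_mem h2]
        simp
      · rw [Set.indicator_of_notMem fun h => (hiff.1 h).elim h1 h2, Set.indicator_of_notMem h2]
        simp
  have hsum : ∫⁻ ω, a (N.clusters ω) ∂P =
      (∫⁻ ω, a (N.clusters ω) * S.indicator 1 (N.clusters ω, N.fading ω) ∂P) +
        ∫⁻ ω, a (N.clusters ω) * Sᶜ.indicator 1 (N.clusters ω, N.fading ω) ∂P := by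
    rw [← lintegral_add_left hm1]
    refine lintegral_congr fun ω => ?_
    by_cases h1 : (N.clusters ω, N.fading ω) ∈ S
    · rw [Set.indicator_of_mem h1, Set.indicator_of_notMem (Set.notMem_compl_iff.2 h1)]
      simp
    · rw [Set.indicator_of_notMem h1, Set.indicator_of_mem (s := Sᶜ) h1]
      simp
  rw [hD2D, lintegral_congr hdec, lintegral_add_left hm1, hsplit, hsum, mul_add, add_right_comm,
    ← add_mul, add_tsub_cancel_of_le hpc1, one_mul]

end IsModel

end Network

/-! ### Palm averages of direct coverage at a fixed displacement -/

namespace Network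

variable {Ω : Type*} [MeasurableSpace Ω] {P : Measure Ω} [IsProbabilityMeasure P] {c : Params}
  {N : Network Ω}

lemma sum_range_eq_tsum_ite (n : ℕ) (f : ℕ → ℝ≥0∞) :
    ∑ k ∈ Finset.range n, f k = ∑' k, if k < n then f k else 0 := by
  rw [tsum_eq_sum (s := Finset.range n) fun k hk => if_neg (by simpa using hk)]
  exact Finset.sum_congr rfl fun k hk => (if_pos (by simpa using hk)).symm

namespace IsModel

lemma lintegral_tsum_condCoverage (hN : N.IsModel c P) {B : Set Plane} (hB : MeasurableSet B)
    (y : Plane) :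
    ∫⁻ ω, ∑' i, B.indicator 1 (N.X i ω) *
        c.condCoverage y (c.exponentSum i (N.transmitters ω) (N.X i ω + y)) ∂P =
      ENNReal.ofReal c.lamM * volume B * ENNReal.ofReal (c.p y) := by
  have hg : Measurable (Function.uncurry fun x z : Plane =>
      c.exponent (c.T * c.loss ‖y‖) (dist (x + y) z)) :=
    c.measurable_exponent.comp
      (f := fun q : Plane × Plane => (c.T * c.loss ‖y‖, dist (q.1 + y) q.2)) (by fun_prop)
  have h := hN.poisson_X.mecke c.lamM_pos hB hg (v := fun _ => c.condCoverage y)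
    ((c.continuous_condCoverage y).measurable.comp measurable_snd)
    (fun _ => c.continuous_condCoverage y) (fun _ => c.condCoverage_le_one y)
  have h2 := fun x => (lintegral_condCoverage hN.poisson_X y (x + y)).2
  simp only [h2, lintegral_const, Measure.restrict_apply MeasurableSet.univ, Set.univ_inter] at h
  rw [mul_assoc, mul_comm (volume B), ← h]
  simp only [Params.exponentSum, transmitters, add_sub_cancel_left]

/-- A lower bound for the number of transmitters covering their own position. -/
lemma expNeg_le_lintegral_tsum_measure_coveredDirect (hN : N.IsModel c P) {B : Set Plane}
    (hB : MeasurableSet B) (hτ : c.τ ≠ 0) (k : ℕ) {d : ℝ} (hd : 0 < d) :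
    ENNReal.ofReal c.lamM * (expNeg (ENNReal.ofReal d * ENNReal.ofReal c.invSNR +
        ENNReal.ofReal c.lamM * ∫⁻ z, 1 - expNeg (c.exponent d (dist (0 : Plane) z))) *
          volume B) ≤
      ∫⁻ ω, ∑' i, B.indicator 1 (N.X i ω) *
        P {ω' | CoveredDirect c i (N.transmitters ω) (N.X i ω) fun n j => N.F i k j n ω'} ∂P := by
  have hg : Measurable (Function.uncurry fun x z : Plane => c.exponent d (dist x z)) :=
    c.measurable_exponent.comp (f := fun q : Plane × Plane => (d, dist q.1 q.2)) (by fun_prop)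
  have hgx : ∀ x : Plane, Measurable fun z => c.exponent d (dist x z) := fun x =>
    c.measurable_exponent.comp (f := fun z : Plane => (d, dist x z)) (by fun_prop)
  have hv : Continuous fun s : ℝ≥0∞ =>
      expNeg (ENNReal.ofReal d * ENNReal.ofReal c.invSNR + s) :=
    continuous_expNeg.comp (continuous_const_add _)
  have h := hN.poisson_X.mecke c.lamM_pos hB hg
    (v := fun _ s => expNeg (ENNReal.ofReal d * ENNReal.ofReal c.invSNR + s))
    (hv.measurable.comp measurable_snd) (fun _ => hv) (fun _ _ => expNeg_le_one _)
  have h2 : ∀ x : Plane, ∫⁻ ω, expNeg (ENNReal.ofReal d * ENNReal.ofReal c.invSNR +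
      ∑' j, c.exponent d (dist x (N.X j ω))) ∂P =
      expNeg (ENNReal.ofReal d * ENNReal.ofReal c.invSNR + ENNReal.ofReal c.lamM *
        ∫⁻ z, 1 - expNeg (c.exponent d (dist (0 : Plane) z))) := by
    intro x
    have h3 : ∀ w : Plane, _ := fun w => c.lintegral_exponent hd.le 1 w
    simp only [Nat.cast_one, one_mul] at h3
    have h4 := hN.poisson_X.lintegral_expNeg_tsum c.lamM_pos (hgx x)
    simp only [expNeg_add]
    rw [lintegral_const_mul' _ _ (expNeg_ne_top _), h4, h3, h3]
  simp only [h2, lintegral_const, Measure.restrict_apply MeasurableSet.univ, Set.univ_inter] at h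
  rw [← h]
  refine lintegral_mono fun ω => ENNReal.tsum_le_tsum fun i => mul_le_mul_right ?_ _
  exact hN.expNeg_le_measure_coveredDirect hτ i k (N.transmitters ω) hd

/-- At displacement zero coverage is certain: the upper bound is trivial, and the lower bound with
parameter `d` tends to it as `d → 0`. -/
lemma lintegral_tsum_measure_coveredDirect (hN : N.IsModel c P) {B : Set Plane}
    (hB : MeasurableSet B) (hB1 : volume B ≠ ∞) (hτ : c.τ ≠ 0) (k : ℕ) :
    ∫⁻ ω, ∑' i, B.indicator 1 (N.X i ω) *
        P {ω' | CoveredDirect c i (N.transmitters ω) (N.X i ω) fun n j => N.F i k j n ω'} ∂P =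
      ENNReal.ofReal c.lamM * volume B := by
  refine le_antisymm ?_ ?_
  · rw [← hN.poisson_X.lintegral_tsum_indicator c.lamM_pos hB hB1]
    exact lintegral_mono fun ω => ENNReal.tsum_le_tsum fun i => mul_le_of_le_one_right' prob_le_one
  · have hδ : ∀ m : ℕ, 0 < 1 / ((m : ℝ) + 1) := fun m => by positivity
    have ha : Tendsto (fun m : ℕ => ENNReal.ofReal (1 / ((m : ℝ) + 1)) * ENNReal.ofReal c.invSNR)
        atTop (𝓝 0) := by
      have h := ENNReal.Tendsto.mul_const (b := ENNReal.ofReal c.invSNR)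
        ((ENNReal.continuous_ofReal.tendsto 0).comp
          (tendsto_one_div_add_atTop_nhds_zero_nat (𝕜 := ℝ))) (Or.inr ENNReal.ofReal_ne_top)
      rw [ENNReal.ofReal_zero, zero_mul] at h
      exact h
    have hb := ENNReal.Tendsto.const_mul (a := ENNReal.ofReal c.lamM)
      (c.tendsto_lintegral_exponent 0) (Or.inr ENNReal.ofReal_ne_top)
    have hab := ha.add hb
    rw [mul_zero, add_zero] at hab
    have hlim := ENNReal.Tendsto.const_mul (a := ENNReal.ofReal c.lamM)
      (ENNReal.Tendsto.mul_const (b := volume B) ((continuous_expNeg.tendsto 0).comp hab)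
        (Or.inr hB1)) (Or.inr ENNReal.ofReal_ne_top)
    rw [expNeg_zero, one_mul] at hlim
    exact le_of_tendsto' hlim fun m =>
      hN.expNeg_le_lintegral_tsum_measure_coveredDirect hB hτ k (hδ m)

lemma lintegral_tsum_coveredD2D (hN : N.IsModel c P) {B : Set Plane} (hB : MeasurableSet B)
    (hB1 : volume B ≠ ∞) (k : ℕ) (y : Plane) :
    ∫⁻ ω, ∑' i, B.indicator 1 (N.X i ω) *
        {ω' | N.CoveredD2D c i k (N.X i ω' + y) ω'}.indicator 1 ω ∂P =
      ENNReal.ofReal c.lamM * volume B * ENNReal.ofReal (c.p y) := by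
  have hX := hN.poisson_X.measurable
  have hBm : Measurable (B.indicator (1 : Plane → ℝ≥0∞)) := measurable_one.indicator hB
  have hm : ∀ i, Measurable fun ω => B.indicator 1 (N.X i ω) *
      {ω' | N.CoveredD2D c i k (N.X i ω' + y) ω'}.indicator (1 : Ω → ℝ≥0∞) ω := fun i =>
    (hBm.comp (hX i)).mul (measurable_one.indicator
      (hN.measurableSet_coveredD2D i k ((hX i).add_const y)))
  have hQm : ∀ i, Measurable fun ω => B.indicator (1 : Plane → ℝ≥0∞) (N.X i ω) *
      P {ω' | CoveredDirect c i (N.transmitters ω) (N.X i ω + y) fun n j => N.F i k j n ω'} := by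
    intro i
    refine (hBm.comp (hX i)).mul (measurable_measure_prodMk_left (ν := P) (s := {r : Ω × Ω |
      CoveredDirect c i (fun j => N.X j r.1) (N.X i r.1 + y) fun n j => N.F i k j n r.2})
      (measurableSet_coveredDirect i (fun j => (hX j).comp measurable_fst)
        (((hX i).comp measurable_fst).add_const y)
        fun n j => (hN.measurable_F i k j n).comp measurable_snd))
  have h1 : ∀ i, ∫⁻ ω, B.indicator 1 (N.X i ω) *
        {ω' | N.CoveredD2D c i k (N.X i ω' + y) ω'}.indicator 1 ω ∂P =
      ∫⁻ ω, B.indicator 1 (N.X i ω) * P {ω' | CoveredDirect c i (N.transmitters ω) (N.X i ω + y)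
        fun n j => N.F i k j n ω'} ∂P := fun i =>
    hN.lintegral_mul_coveredD2D i k (a := fun q => B.indicator 1 (q.1 i))
      (w := fun q => q.1 i + y) (hBm.comp (f := fun q : ClusterSpace => q.1 i) (by fun_prop))
      (by fun_prop)
  rw [lintegral_tsum fun i => (hm i).aemeasurable, tsum_congr h1,
    ← lintegral_tsum fun i => (hQm i).aemeasurable]
  -- At `y = 0` the formula for a positive path loss is not available. For `τ = 0` nothing is
  -- covered and `p 0 = 0`; otherwise both sides correspond to coverage with probability one.
  by_cases hy : y = 0
  · subst hy
    simp only [add_zero]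
    have hp := (lintegral_condCoverage hN.poisson_X (0 : Plane) 0).2
    by_cases hτ : c.τ = 0
    · have h0 : ∀ i x w e, ¬ CoveredDirect c i x w e := by
        rintro i x w e ⟨n, hn, -⟩
        simp [hτ] at hn
      simp only [h0, Set.ofPred_false, measure_empty, mul_zero, tsum_zero, lintegral_zero]
      simp only [Params.condCoverage, hτ, pow_zero, tsub_self, lintegral_zero] at hp
      rw [← hp, mul_zero]
    · rw [hN.lintegral_tsum_measure_coveredDirect hB hB1 hτ k, ← hp]
      have h0 : ∀ r, c.exponent 0 r = 0 := by
        intro r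
        simp [Params.exponent, logOneAdd]
      simp [Params.condCoverage, c.loss_zero, h0, hτ, expNeg_zero]
  · rw [← hN.lintegral_tsum_condCoverage hB y]
    refine lintegral_congr fun ω => tsum_congr fun i => ?_
    rw [hN.measure_coveredDirect i k (x := N.transmitters ω) (w := N.X i ω + y)
      (by simpa [transmitters] using hy)]
    simp [transmitters]

end IsModel

end Network

/-! ### Summation over the receivers of a cluster -/

namespace Network

variable {Ω : Type*} [MeasurableSpace Ω] {P : Measure Ω} [IsProbabilityMeasure P] {c : Params}
  {N : Network Ω}

namespace IsModel

/-- Summing a function of the transmitters and of the receiver position over the receivers of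
transmitter `i`. -/
lemma lintegral_tsum_receivers (hN : N.IsModel c P) (i : ℕ) {h : (ℕ → Plane) × Plane → ℝ≥0∞}
    (hh : Measurable h) :
    ∫⁻ ω, ∑' k, (if k < N.K i ω then h (N.transmitters ω, N.Y i k ω) else 0) ∂P =
      ∫⁻ ω, ENNReal.ofReal c.lamR *
        (∫⁻ w in Metric.closedBall (N.X i ω) c.R, h (N.transmitters ω, w)) ∂P := by
  have hT := hN.measurable_transmitters
  have hTY : ∀ k, Measurable fun ω => (N.transmitters ω, N.Y i k ω) := fun k =>
    hT.prodMk (hN.measurable_Y i k)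
  have hA : ∀ k, MeasurableSet {ω | k < N.K i ω} := fun k =>
    measurableSet_lt measurable_const (hN.measurable_K i)
  have hD : MeasurableSet {q : (ℕ → Plane) × Plane | dist q.2 (q.1 i) ≤ c.R} :=
    measurableSet_le (by fun_prop) measurable_const
  -- Both sides are integrals of `h` against measures on pairs of a transmitter configuration and a
  -- receiver position. The intensity assumption says that these agree on rectangles, and `ν₂`, of
  -- mass `lamR * π * R ^ 2`, is finite.
  let ν₁ : Measure ((ℕ → Plane) × Plane) := Measure.sum fun k =>
    (P.restrict {ω | k < N.K i ω}).map fun ω => (N.transmitters ω, N.Y i k ω)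
  let ν₂ : Measure ((ℕ → Plane) × Plane) := ENNReal.ofReal c.lamR •
    ((P.map N.transmitters).prod volume).restrict {q | dist q.2 (q.1 i) ≤ c.R}
  have hite : ∀ (f : (ℕ → Plane) × Plane → ℝ≥0∞) (k : ℕ) (ω : Ω),
      (if k < N.K i ω then f (N.transmitters ω, N.Y i k ω) else 0) =
        {ω | k < N.K i ω}.indicator (fun ω => f (N.transmitters ω, N.Y i k ω)) ω :=
    fun f k ω => by simp [Set.indicator]
  have h₁ : ∀ f : (ℕ → Plane) × Plane → ℝ≥0∞, Measurable f → ∫⁻ q, f q ∂ν₁ =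
      ∫⁻ ω, ∑' k, (if k < N.K i ω then f (N.transmitters ω, N.Y i k ω) else 0) ∂P := by
    intro f hf
    rw [lintegral_sum_measure, lintegral_tsum fun k => ?_]
    · refine tsum_congr fun k => ?_
      rw [lintegral_map hf (hTY k), ← lintegral_indicator (hA k)]
      exact lintegral_congr fun ω => (hite f k ω).symm
    · simp only [hite f k]
      exact ((hf.comp (hTY k)).indicator (hA k)).aemeasurable
  have h₂ : ∀ f : (ℕ → Plane) × Plane → ℝ≥0∞, Measurable f → ∫⁻ q, f q ∂ν₂ =
      ∫⁻ ω, ENNReal.ofReal c.lamR *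
        (∫⁻ w in Metric.closedBall (N.X i ω) c.R, f (N.transmitters ω, w)) ∂P := by
    intro f hf
    have hfD := hf.indicator hD
    rw [lintegral_smul_measure, ← lintegral_indicator hD, lintegral_prod _ hfD.aemeasurable,
      lintegral_map hfD.lintegral_prod_right' hT, smul_eq_mul,
      lintegral_const_mul' _ _ ENNReal.ofReal_ne_top]
    congr 1
    refine lintegral_congr fun ω => ?_
    rw [← lintegral_indicator Metric.isClosed_closedBall.measurableSet]
    rfl
  have hrect : ∀ (C : Set (ℕ → Plane)) (S : Set Plane) (ω : Ω) (w : Plane),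
      (C ×ˢ S).indicator (1 : (ℕ → Plane) × Plane → ℝ≥0∞) (N.transmitters ω, w) =
        (N.transmitters ⁻¹' C).indicator (fun _ => S.indicator 1 w) ω := by
    intro C S ω w
    by_cases h1 : N.transmitters ω ∈ C <;> by_cases h2 : w ∈ S <;>
      simp [Set.indicator, h1, h2]
  have hν : ∀ {C : Set (ℕ → Plane)} {S : Set Plane}, MeasurableSet C → MeasurableSet S →
      ν₂ (C ×ˢ S) = ν₁ (C ×ˢ S) := by
    intro C S hC hS
    have hCS : Measurable ((C ×ˢ S).indicator (1 : (ℕ → Plane) × Plane → ℝ≥0∞)) :=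
      measurable_one.indicator (hC.prod hS)
    rw [← lintegral_indicator_one (hC.prod hS), ← lintegral_indicator_one (hC.prod hS), h₁ _ hCS,
      h₂ _ hCS]
    have hint := hN.intensity i S C hS hC
    rw [← lintegral_indicator (hT hC), ← lintegral_indicator (hT hC)] at hint
    refine Eq.trans (lintegral_congr fun ω => ?_) (hint.symm.trans (lintegral_congr fun ω => ?_))
    · by_cases hω : ω ∈ N.transmitters ⁻¹' C
      · simp only [hrect, Set.indicator_of_mem hω]
        rw [lintegral_indicator_one hS, Measure.restrict_apply hS]
      · simp only [hrect, Set.indicator_of_notMem hω]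
        simp
    · by_cases hω : ω ∈ N.transmitters ⁻¹' C
      · simp only [hrect, Set.indicator_of_mem hω, receiverCount, sum_range_eq_tsum_ite]
      · simp only [hrect, Set.indicator_of_notMem hω]
        simp
  have hfin : IsFiniteMeasure ν₂ := by
    refine ⟨?_⟩
    have := h₂ (fun _ => 1) measurable_const
    simp only [lintegral_const, one_mul, Measure.restrict_apply MeasurableSet.univ, Set.univ_inter,
      EuclideanSpace.volume_closedBall_fin_two, measure_univ, mul_one] at this
    rw [this]
    exact ENNReal.mul_lt_top (by simp) (ENNReal.mul_lt_top (by simp) (by simp))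
  rw [← h₁ h hh, ← h₂ h hh, Measure.ext_prod hν]

end IsModel

end Network

namespace Network

variable {Ω : Type*} [MeasurableSpace Ω] {P : Measure Ω} [IsProbabilityMeasure P] {c : Params}
  {N : Network Ω}

/-- The weight of receiver `k` of transmitter `i`: one if the transmitter lies in `B` and the
receiver exists, zero otherwise. -/
noncomputable def weight (B : Set Plane) (i k : ℕ) (q : ClusterSpace) : ℝ≥0∞ :=
  if k < q.2.1 i then B.indicator 1 (q.1 i) else 0

lemma measurable_weight {B : Set Plane} (hB : MeasurableSet B) (i k : ℕ) :
    Measurable (weight B i k) :=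
  Measurable.ite (measurableSet_lt measurable_const (by fun_prop))
    ((measurable_one.indicator hB).comp (f := fun q : ClusterSpace => q.1 i) (by fun_prop))
    measurable_const

omit [MeasurableSpace Ω] in
lemma weight_clusters (B : Set Plane) (i k : ℕ) (ω : Ω) :
    weight B i k (N.clusters ω) = if k < N.K i ω then B.indicator 1 (N.X i ω) else 0 := rfl

/-- The conditional coverage probability of a receiver at `q.2` of transmitter `i`, for
transmitters at `q.1`, counted if the transmitter lies in `B`. -/
noncomputable def windowCoverage (c : Params) (B : Set Plane) (i : ℕ)
    (q : (ℕ → Plane) × Plane) : ℝ≥0∞ :=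
  B.indicator 1 (q.1 i) * c.condCoverage (q.2 - q.1 i) (c.exponentSum i q.1 q.2)

lemma measurable_windowCoverage (c : Params) {B : Set Plane} (hB : MeasurableSet B) (i : ℕ) :
    Measurable (windowCoverage c B i) := by
  have h1 := c.measurable_exponentSum i (x := fun j (q : (ℕ → Plane) × Plane) => q.1 j)
    (w := fun q => q.2) (fun j => by fun_prop) measurable_snd
  have h2 : Measurable fun q : (ℕ → Plane) × Plane => q.2 - q.1 i := by fun_prop
  have h3 : Measurable fun q : (ℕ → Plane) × Plane => B.indicator (1 : Plane → ℝ≥0∞) (q.1 i) :=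
    (measurable_one.indicator hB).comp (f := fun q : (ℕ → Plane) × Plane => q.1 i) (by fun_prop)
  have h4 := c.measurable_condCoverage h2 h1
  exact Measurable.mul h3 h4

namespace IsModel

omit [IsProbabilityMeasure P] in
lemma lintegral_tsum_sum_range (hN : N.IsModel c P) {B : Set Plane} (hB : MeasurableSet B)
    {S : ℕ → ℕ → Set Ω} (hS : ∀ i k, MeasurableSet (S i k)) :
    ∫⁻ ω, ∑' i, B.indicator 1 (N.X i ω) *
        ∑ k ∈ Finset.range (N.K i ω), (S i k).indicator 1 ω ∂P =
      ∑' i, ∑' k, ∫⁻ ω, weight B i k (N.clusters ω) * (S i k).indicator 1 ω ∂P := by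
  have hm : ∀ i k, Measurable fun ω => weight B i k (N.clusters ω) *
      (S i k).indicator (1 : Ω → ℝ≥0∞) ω := fun i k =>
    ((measurable_weight hB i k).comp hN.measurable_clusters).mul (measurable_one.indicator (hS i k))
  have h : ∀ i, ∑' k, ∫⁻ ω, weight B i k (N.clusters ω) * (S i k).indicator 1 ω ∂P =
      ∫⁻ ω, ∑' k, weight B i k (N.clusters ω) * (S i k).indicator 1 ω ∂P := fun i =>
    (lintegral_tsum fun k => (hm i k).aemeasurable).symm
  rw [tsum_congr h, ← lintegral_tsum fun i => (Measurable.tsum (hm i)).aemeasurable]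
  refine lintegral_congr fun ω => tsum_congr fun i => ?_
  rw [sum_range_eq_tsum_ite, ← ENNReal.tsum_mul_left]
  refine tsum_congr fun k => ?_
  rw [weight_clusters]
  split_ifs <;> simp

/-- The conditional intensity has no atoms, so the mean number of receivers at the transmitter's
position is zero. This allows the coverage formula for positive distance at the random receivers. -/
lemma ae_receiver_ne (hN : N.IsModel c P) (i k : ℕ) :
    ∀ᵐ ω ∂P, k < N.K i ω → N.Y i k ω ≠ N.X i ω := by
  have hE : MeasurableSet {q : (ℕ → Plane) × Plane | q.2 = q.1 i} :=
    measurableSet_eq_fun (by fun_prop) (by fun_prop)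
  have hEm : Measurable ({q : (ℕ → Plane) × Plane | q.2 = q.1 i}.indicator
    (1 : (ℕ → Plane) × Plane → ℝ≥0∞)) := measurable_one.indicator hE
  have h := hN.lintegral_tsum_receivers i hEm
  have h0 : ∀ ω, ∫⁻ w in Metric.closedBall (N.X i ω) c.R,
      {q : (ℕ → Plane) × Plane | q.2 = q.1 i}.indicator 1 (N.transmitters ω, w) = 0 := by
    intro ω
    refine le_antisymm ((setLIntegral_le_lintegral _ _).trans ?_) bot_le
    have : ∀ w : Plane, {q : (ℕ → Plane) × Plane | q.2 = q.1 i}.indicator 1 (N.transmitters ω, w) =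
        ({N.X i ω} : Set Plane).indicator (1 : Plane → ℝ≥0∞) w := fun w => by
      by_cases hw : w = N.X i ω
      · rw [Set.indicator_of_mem (by exact hw), Set.indicator_of_mem (by exact hw)]
        rfl
      · rw [Set.indicator_of_notMem (by exact hw), Set.indicator_of_notMem (by exact hw)]
    simp only [this]
    rw [lintegral_indicator_one (measurableSet_singleton _), measure_singleton]
  simp only [h0, mul_zero, lintegral_zero] at h
  have hterm : ∀ k', Measurable fun ω => if k' < N.K i ω then
      {q : (ℕ → Plane) × Plane | q.2 = q.1 i}.indicator (1 : (ℕ → Plane) × Plane → ℝ≥0∞)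
        (N.transmitters ω, N.Y i k' ω) else 0 := fun k' =>
    Measurable.ite (measurableSet_lt measurable_const (hN.measurable_K i))
      (hEm.comp (hN.measurable_transmitters.prodMk (hN.measurable_Y i k'))) measurable_const
  rw [lintegral_eq_zero_iff (Measurable.tsum hterm)] at h
  filter_upwards [h] with ω hω hk heq
  have := ENNReal.tsum_eq_zero.1 hω k
  rw [if_pos hk, Set.indicator_of_mem (by exact heq)] at this
  exact one_ne_zero this

lemma tsum_tsum_lintegral_weight (hN : N.IsModel c P) {B : Set Plane} (hB : MeasurableSet B)
    (hB1 : volume B ≠ ∞) :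
    ∑' i, ∑' k, ∫⁻ ω, weight B i k (N.clusters ω) ∂P =
      ENNReal.ofReal (c.lamR * Real.pi * c.R ^ 2) * (ENNReal.ofReal c.lamM * volume B) := by
  have hBm : Measurable (B.indicator (1 : Plane → ℝ≥0∞)) := measurable_one.indicator hB
  have hi : ∀ i, ∑' k, ∫⁻ ω, weight B i k (N.clusters ω) ∂P =
      ENNReal.ofReal (c.lamR * Real.pi * c.R ^ 2) * ∫⁻ ω, B.indicator 1 (N.X i ω) ∂P := by
    intro i
    have hwm : ∀ k, Measurable fun ω => weight B i k (N.clusters ω) := fun k =>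
      (measurable_weight hB i k).comp hN.measurable_clusters
    rw [← lintegral_tsum fun k => (hwm k).aemeasurable]
    have h := hN.lintegral_tsum_receivers i (h := fun q => B.indicator 1 (q.1 i))
      (hBm.comp (f := fun q : (ℕ → Plane) × Plane => q.1 i) (by fun_prop))
    refine Eq.trans h ?_
    rw [← lintegral_const_mul' _ _ ENNReal.ofReal_ne_top]
    refine lintegral_congr fun ω => ?_
    change _ * ∫⁻ _ in Metric.closedBall (N.X i ω) c.R, B.indicator 1 (N.X i ω) = _
    have hR := c.R_pos.le
    have hl := c.lamR_pos.le
    rw [lintegral_const, Measure.restrict_apply MeasurableSet.univ, Set.univ_inter,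
      EuclideanSpace.volume_closedBall_fin_two, mul_assoc c.lamR, ENNReal.ofReal_mul hl,
      mul_comm Real.pi, ENNReal.ofReal_mul (by positivity), ENNReal.ofReal_pow hR, mul_assoc,
      mul_comm (B.indicator _ _)]
  have hBX : ∀ i, Measurable fun ω => B.indicator (1 : Plane → ℝ≥0∞) (N.X i ω) := fun i =>
    hBm.comp (hN.poisson_X.measurable i)
  rw [tsum_congr hi, ENNReal.tsum_mul_left, ← lintegral_tsum fun i => (hBX i).aemeasurable,
    hN.poisson_X.lintegral_tsum_indicator c.lamM_pos hB hB1]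

/-- After the fading is integrated out, the cluster enters only through the existence and position
of receiver `k`; summed over `k`, this is what the intensity determines. -/
lemma lintegral_weight_mul_coveredD2D (hN : N.IsModel c P) {B : Set Plane}
    (hB : MeasurableSet B) (i k : ℕ) :
    ∫⁻ ω, weight B i k (N.clusters ω) *
        {ω' | N.CoveredD2D c i k (N.Y i k ω') ω'}.indicator 1 ω ∂P =
      ∫⁻ ω, (if k < N.K i ω then windowCoverage c B i (N.transmitters ω, N.Y i k ω) else 0) ∂P := by
  have hw : Measurable fun q : ClusterSpace => q.2.2 i k := by fun_prop
  refine (hN.lintegral_mul_coveredD2D i k (measurable_weight hB i k) hw).trans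
    (lintegral_congr_ae ?_)
  filter_upwards [hN.ae_receiver_ne i k] with ω hω
  rw [weight_clusters]
  split_ifs with hk
  · exact congrArg _ (hN.measure_coveredDirect i k (x := N.transmitters ω) (hω hk))
  · rw [zero_mul]

omit [MeasurableSpace Ω] in
lemma setLIntegral_windowCoverage (i : ℕ) (B : Set Plane) (ω : Ω) :
    ∫⁻ w in Metric.closedBall (N.X i ω) c.R, windowCoverage c B i (N.transmitters ω, w) =
      ∫⁻ y in Metric.closedBall (0 : Plane) c.R,
        windowCoverage c B i (N.transmitters ω, N.X i ω + y) := by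
  rw [← lintegral_indicator Metric.isClosed_closedBall.measurableSet,
    ← lintegral_indicator Metric.isClosed_closedBall.measurableSet,
    ← lintegral_add_left_eq_self _ (N.X i ω)]
  refine lintegral_congr fun y => ?_
  simp [Set.indicator, dist_eq_norm]

lemma tsum_lintegral_weight_mul_coveredD2D (hN : N.IsModel c P) {B : Set Plane}
    (hB : MeasurableSet B) (i : ℕ) :
    ∑' k, ∫⁻ ω, weight B i k (N.clusters ω) *
        {ω' | N.CoveredD2D c i k (N.Y i k ω') ω'}.indicator 1 ω ∂P =
      ENNReal.ofReal c.lamR * ∫⁻ y in Metric.closedBall (0 : Plane) c.R,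
        (∫⁻ ω, windowCoverage c B i (N.transmitters ω, N.X i ω + y) ∂P) := by
  have hm := measurable_windowCoverage c hB i
  have hitem : ∀ k, Measurable fun ω =>
      if k < N.K i ω then windowCoverage c B i (N.transmitters ω, N.Y i k ω) else 0 := fun k =>
    Measurable.ite (measurableSet_lt measurable_const (hN.measurable_K i))
      (hm.comp (hN.measurable_transmitters.prodMk (hN.measurable_Y i k))) measurable_const
  have hpair : Measurable fun r : Ω × Plane =>
      windowCoverage c B i (N.transmitters r.1, N.X i r.1 + r.2) :=
    hm.comp ((hN.measurable_transmitters.comp measurable_fst).prodMk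
      (((hN.poisson_X.measurable i).comp measurable_fst).add measurable_snd))
  rw [tsum_congr (hN.lintegral_weight_mul_coveredD2D hB i),
    ← lintegral_tsum fun k => (hitem k).aemeasurable,
    hN.lintegral_tsum_receivers i hm, lintegral_const_mul' _ _ ENNReal.ofReal_ne_top]
  simp only [setLIntegral_windowCoverage]
  rw [lintegral_lintegral_swap hpair.aemeasurable]

/-- In coordinates relative to the transmitter the ball is fixed, so by Tonelli the sum over
transmitters moves inside the integral over the displacement `y`, where the Mecke formula gives `p
y`. -/
lemma tsum_tsum_lintegral_weight_mul_coveredD2D (hN : N.IsModel c P) {B : Set Plane}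
    (hB : MeasurableSet B) :
    ∑' i, ∑' k, ∫⁻ ω, weight B i k (N.clusters ω) *
        {ω' | N.CoveredD2D c i k (N.Y i k ω') ω'}.indicator 1 ω ∂P =
      ENNReal.ofReal c.lamR * ∫⁻ y in Metric.closedBall (0 : Plane) c.R,
        ENNReal.ofReal c.lamM * volume B * ENNReal.ofReal (c.p y) := by
  have hX := hN.poisson_X.measurable
  have hpair : ∀ i, Measurable fun r : Plane × Ω =>
      windowCoverage c B i (N.transmitters r.2, N.X i r.2 + r.1) := fun i =>
    (measurable_windowCoverage c hB i).comp
      ((hN.measurable_transmitters.comp measurable_snd).prodMk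
        (((hX i).comp measurable_snd).add measurable_fst))
  have hiy : ∀ y i, Measurable fun ω =>
      windowCoverage c B i (N.transmitters ω, N.X i ω + y) := fun y i =>
    (measurable_windowCoverage c hB i).comp
      (hN.measurable_transmitters.prodMk ((hX i).add_const y))
  have hint : ∀ i, Measurable fun y : Plane =>
      ∫⁻ ω, windowCoverage c B i (N.transmitters ω, N.X i ω + y) ∂P := fun i =>
    (hpair i).lintegral_prod_right'
  rw [tsum_congr (hN.tsum_lintegral_weight_mul_coveredD2D hB), ENNReal.tsum_mul_left,
    ← lintegral_tsum fun i => (hint i).aemeasurable]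
  congr 1
  refine lintegral_congr fun y => ?_
  rw [← hN.lintegral_tsum_condCoverage hB y, ← lintegral_tsum fun i => (hiy y i).aemeasurable]
  simp only [windowCoverage, transmitters, add_sub_cancel_left]

/-- Measurability is read off from the representation of `p` as an expectation depending measurably
on `y`, rather than from the closed form. -/
lemma measurable_p (hN : N.IsModel c P) : Measurable c.p := by
  have hp := fun y => lintegral_condCoverage hN.poisson_X y (0 : Plane)
  have hterm : ∀ j, Measurable fun r : Plane × Ω =>
      c.exponent (c.T * c.loss ‖r.1‖) (dist (0 : Plane) (N.X j r.2)) := by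
    intro j
    have hj := hN.poisson_X.measurable j
    have h : Measurable fun r : Plane × Ω =>
        (c.T * c.loss ‖r.1‖, dist (0 : Plane) (N.X j r.2)) := by fun_prop
    exact c.measurable_exponent.comp h
  have hm : Measurable fun r : Plane × Ω => c.condCoverage r.1
      (∑' j, c.exponent (c.T * c.loss ‖r.1‖) (dist (0 : Plane) (N.X j r.2))) :=
    c.measurable_condCoverage measurable_fst (Measurable.tsum hterm)
  have h := hm.lintegral_prod_right' (ν := P)
  simp only [(hp _).2] at h
  have h' := h.ennreal_toReal
  simp only [ENNReal.toReal_ofReal (hp _).1.1] at h'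
  exact h'

lemma ofReal_integral_p (hN : N.IsModel c P) {s : Set Plane} (hs : volume s ≠ ∞) :
    ENNReal.ofReal (∫ y in s, c.p y) = ∫⁻ y in s, ENNReal.ofReal (c.p y) := by
  have hp := fun y => (lintegral_condCoverage hN.poisson_X y (0 : Plane)).1
  have : IsFiniteMeasure (volume.restrict s) := ⟨by simpa using hs.lt_top⟩
  refine ofReal_integral_eq_lintegral_ofReal ?_ (ae_of_all _ fun y => (hp y).1)
  exact Integrable.of_bound hN.measurable_p.aestronglyMeasurable 1 (ae_of_all _ fun y => by
    rw [Real.norm_of_nonneg (hp y).1]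
    exact (hp y).2)

end IsModel

end Network

/-! ### Palm probabilities and mean numbers of covered receivers -/

lemma Params.mul_div_window (c : Params) {B : Set Plane} (hB0 : volume B ≠ 0)
    (hB1 : volume B ≠ ∞) (a : ℝ≥0∞) :
    a * (ENNReal.ofReal c.lamM * volume B) / (ENNReal.ofReal c.lamM * volume B) = a :=
  ENNReal.mul_div_cancel_right (mul_ne_zero (by simpa using c.lamM_pos) hB0)
    (ENNReal.mul_ne_top ENNReal.ofReal_ne_top hB1)

namespace Network

variable {Ω : Type*} [MeasurableSpace Ω] {P : Measure Ω} [IsProbabilityMeasure P] {c : Params}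
  {N : Network Ω} {B : Set Plane}

namespace IsModel

lemma pc_mem_Icc (hN : N.IsModel c P) : c.pc ∈ Set.Icc (0 : ℝ) 1 :=
  (lintegral_measure_coveredDown hN.poisson_Z (fun j => hN.measurable_G 0 0 j)
    (fun j => hN.law_G 0 0 j) (hN.iIndepFun_G 0 0) 0).1

lemma lintegral_tsum_coveredAssisted (hN : N.IsModel c P) (hB : MeasurableSet B)
    (hB1 : volume B ≠ ∞) (k : ℕ) (y : Plane) :
    ∫⁻ ω, ∑' i, B.indicator 1 (N.X i ω) *
        {ω' | N.CoveredAssisted c i k (N.X i ω' + y) ω'}.indicator 1 ω ∂P =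
      ENNReal.ofReal c.pc * (ENNReal.ofReal c.lamM * volume B) +
        (1 - ENNReal.ofReal c.pc) *
          (ENNReal.ofReal c.lamM * volume B * ENNReal.ofReal (c.p y)) := by
  have hX := hN.poisson_X.measurable
  have hBX : ∀ i, Measurable fun ω => B.indicator (1 : Plane → ℝ≥0∞) (N.X i ω) := fun i =>
    (measurable_one.indicator hB).comp (hX i)
  have hBq : ∀ i, Measurable fun q : ClusterSpace => B.indicator (1 : Plane → ℝ≥0∞) (q.1 i) :=
    fun i => (measurable_one.indicator hB).comp (f := fun q : ClusterSpace => q.1 i) (by fun_prop)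
  have hA : ∀ i, Measurable fun ω => B.indicator 1 (N.X i ω) *
      {ω' | N.CoveredAssisted c i k (N.X i ω' + y) ω'}.indicator (1 : Ω → ℝ≥0∞) ω := fun i =>
    (hBX i).mul (measurable_one.indicator
      (hN.measurableSet_coveredAssisted i k ((hX i).add_const y)))
  have hD : ∀ i, Measurable fun ω => B.indicator 1 (N.X i ω) *
      {ω' | N.CoveredD2D c i k (N.X i ω' + y) ω'}.indicator (1 : Ω → ℝ≥0∞) ω := fun i =>
    (hBX i).mul (measurable_one.indicator
      (hN.measurableSet_coveredD2D i k ((hX i).add_const y)))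
  have h := fun i => hN.lintegral_mul_coveredAssisted i k (w := fun q => q.1 i + y) (hBq i)
    (by fun_prop)
  rw [lintegral_tsum fun i => (hA i).aemeasurable, ← hN.lintegral_tsum_coveredD2D hB hB1 k y,
    lintegral_tsum fun i => (hD i).aemeasurable,
    ← hN.poisson_X.lintegral_tsum_indicator c.lamM_pos hB hB1,
    lintegral_tsum fun i => (hBX i).aemeasurable, ← ENNReal.tsum_mul_left, ← ENNReal.tsum_mul_left,
    ← ENNReal.tsum_add]
  exact tsum_congr h

lemma lintegral_tsum_coveredBS (hN : N.IsModel c P) (hB : MeasurableSet B)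
    (hB1 : volume B ≠ ∞) (k : ℕ) :
    ∫⁻ ω, ∑' i, B.indicator 1 (N.X i ω) * {ω' | N.CoveredBS c i k ω'}.indicator 1 ω ∂P =
      ENNReal.ofReal c.pc * (ENNReal.ofReal c.lamM * volume B) := by
  have hBX : ∀ i, Measurable fun ω => B.indicator (1 : Plane → ℝ≥0∞) (N.X i ω) := fun i =>
    (measurable_one.indicator hB).comp (hN.poisson_X.measurable i)
  have hBq : ∀ i, Measurable fun q : ClusterSpace × (ℕ → ℕ → ℕ → ℕ → ℝ) =>
      B.indicator (1 : Plane → ℝ≥0∞) (q.1.1 i) := fun i =>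
    (measurable_one.indicator hB).comp
      (f := fun q : ClusterSpace × (ℕ → ℕ → ℕ → ℕ → ℝ) => q.1.1 i) (by fun_prop)
  have hA : ∀ i, Measurable fun ω => B.indicator 1 (N.X i ω) *
      {ω' | N.CoveredBS c i k ω'}.indicator (1 : Ω → ℝ≥0∞) ω := fun i =>
    (hBX i).mul (measurable_one.indicator (hN.measurableSet_coveredBS i k))
  have h := fun i => hN.lintegral_mul_coveredBS i k (g := fun q _ => B.indicator 1 (q.1 i)) (hBq i)
  rw [lintegral_tsum fun i => (hA i).aemeasurable,
    ← hN.poisson_X.lintegral_tsum_indicator c.lamM_pos hB hB1,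
    lintegral_tsum fun i => (hBX i).aemeasurable, ← ENNReal.tsum_mul_left]
  exact tsum_congr h

section Palm

variable (hN : N.IsModel c P) (hB : MeasurableSet B) (hB0 : volume B ≠ 0) (hB1 : volume B ≠ ∞)

include hN hB hB0 hB1

lemma coverageProb_eq (k : ℕ) (y : Plane) :
    N.coverageProb c P B k y = ENNReal.ofReal (c.p y) := by
  rw [coverageProb, palmProb, palm, hN.lintegral_tsum_coveredD2D hB hB1, mul_comm,
    c.mul_div_window hB0 hB1]

lemma coverageProbBS_eq (k : ℕ) : N.coverageProbBS c P B k = ENNReal.ofReal c.pc := by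
  rw [coverageProbBS, palmProb, palm, hN.lintegral_tsum_coveredBS hB hB1,
    c.mul_div_window hB0 hB1]

lemma coverageProbAssisted_eq (k : ℕ) (y : Plane) :
    N.coverageProbAssisted c P B k y = ENNReal.ofReal (c.p y + c.pc * (1 - c.p y)) := by
  have hp := (lintegral_condCoverage hN.poisson_X y 0).1
  have hpc := hN.pc_mem_Icc
  rw [coverageProbAssisted, palmProb, palm, hN.lintegral_tsum_coveredAssisted hB hB1,
    mul_comm _ (ENNReal.ofReal (c.p y)), ← mul_assoc (1 - _), ← add_mul, c.mul_div_window hB0 hB1,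
    ← ENNReal.ofReal_one, ← ENNReal.ofReal_sub _ hpc.1,
    ← ENNReal.ofReal_mul (sub_nonneg.2 hpc.2), ← ENNReal.ofReal_add hpc.1
      (mul_nonneg (sub_nonneg.2 hpc.2) hp.1)]
  congr 1
  ring

lemma meanCovered_eq : N.meanCovered c P B =
    ENNReal.ofReal (c.lamR * ∫ y in Metric.closedBall (0 : Plane) c.R, c.p y) := by
  have hvol : volume (Metric.closedBall (0 : Plane) c.R) ≠ ∞ := measure_closedBall_lt_top.ne
  have hw : ENNReal.ofReal c.lamM * volume B ≠ ∞ := ENNReal.mul_ne_top ENNReal.ofReal_ne_top hB1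
  rw [meanCovered, palm, hN.lintegral_tsum_sum_range hB
      fun i k => hN.measurableSet_coveredD2D i k (hN.measurable_Y i k),
    hN.tsum_tsum_lintegral_weight_mul_coveredD2D hB, lintegral_const_mul' _ _ hw,
    ← hN.ofReal_integral_p hvol, mul_left_comm, mul_comm (ENNReal.ofReal c.lamM * volume B),
    c.mul_div_window hB0 hB1, ENNReal.ofReal_mul c.lamR_pos.le]

/-- The decomposition is applied to each potential receiver with its existence as weight, then
summed; the total weight gives the mean cluster size `lamR * π * R ^ 2`. -/
lemma meanCoveredAssisted_eq : N.meanCoveredAssisted c P B =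
    ENNReal.ofReal c.pc * ENNReal.ofReal (c.lamR * Real.pi * c.R ^ 2) +
      (1 - ENNReal.ofReal c.pc) * N.meanCovered c P B := by
  have h := fun i k => hN.lintegral_mul_coveredAssisted i k (w := fun q => q.2.2 i k)
    (measurable_weight hB i k) (by fun_prop)
  have h' : ∑' i, ∑' k, ∫⁻ ω, weight B i k (N.clusters ω) *
        {ω' | N.CoveredAssisted c i k (N.Y i k ω') ω'}.indicator 1 ω ∂P =
      ENNReal.ofReal c.pc * (∑' i, ∑' k, ∫⁻ ω, weight B i k (N.clusters ω) ∂P) +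
        (1 - ENNReal.ofReal c.pc) * ∑' i, ∑' k, ∫⁻ ω, weight B i k (N.clusters ω) *
          {ω' | N.CoveredD2D c i k (N.Y i k ω') ω'}.indicator 1 ω ∂P := by
    simp only [← ENNReal.tsum_mul_left, ← ENNReal.tsum_add]
    exact tsum_congr fun i => tsum_congr fun k => h i k
  rw [meanCoveredAssisted, meanCovered, palm, palm, hN.lintegral_tsum_sum_range hB
      fun i k => hN.measurableSet_coveredAssisted i k (hN.measurable_Y i k),
    hN.lintegral_tsum_sum_range hB
      fun i k => hN.measurableSet_coveredD2D i k (hN.measurable_Y i k),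
    h', ENNReal.add_div, mul_div_assoc (1 - _), hN.tsum_tsum_lintegral_weight hB hB1, ← mul_assoc,
    c.mul_div_window hB0 hB1]

end Palm

end IsModel

end Network

end MulticastD2D

theorem proposition5 {Ω : Type*} [MeasurableSpace Ω] (P : Measure Ω) [IsProbabilityMeasure P]
    (c : MulticastD2D.Params) (N : MulticastD2D.Network Ω) (hN : N.IsModel c P)
    (B : Set MulticastD2D.Plane) (hB : MeasurableSet B) (hB0 : volume B ≠ 0)
    (hB1 : volume B ≠ ∞) :
    c.pc ∈ Set.Icc (0 : ℝ) 1 ∧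
    (∀ k : ℕ, N.coverageProbBS c P B k = ENNReal.ofReal c.pc) ∧
    (∀ (k : ℕ) (y : MulticastD2D.Plane),
      c.p y ∈ Set.Icc (0 : ℝ) 1 ∧
      N.coverageProb c P B k y = ENNReal.ofReal (c.p y) ∧
      N.coverageProbAssisted c P B k y = ENNReal.ofReal (c.p y + c.pc * (1 - c.p y))) ∧
    N.meanCovered c P B =
      ENNReal.ofReal (c.lamR * ∫ y in Metric.closedBall (0 : MulticastD2D.Plane) c.R, c.p y) ∧
    N.meanCovered c P B ≠ ∞ ∧
    N.meanCoveredAssisted c P B ≠ ∞ ∧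
    (N.meanCoveredAssisted c P B).toReal =
      (N.meanCovered c P B).toReal +
        c.pc * (c.lamR * Real.pi * c.R ^ 2 - (N.meanCovered c P B).toReal) := by
  have hpc := hN.pc_mem_Icc
  have hmean := hN.meanCovered_eq hB hB0 hB1
  have hfin : N.meanCovered c P B ≠ ∞ := hmean ▸ ENNReal.ofReal_ne_top
  have hassisted := hN.meanCoveredAssisted_eq hB hB0 hB1
  have h1 : ENNReal.ofReal c.pc * ENNReal.ofReal (c.lamR * Real.pi * c.R ^ 2) ≠ ∞ :=
    ENNReal.mul_ne_top ENNReal.ofReal_ne_top ENNReal.ofReal_ne_top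
  have h2 : (1 - ENNReal.ofReal c.pc) * N.meanCovered c P B ≠ ∞ :=
    ENNReal.mul_ne_top (ENNReal.sub_ne_top ENNReal.one_ne_top) hfin
  have hM : 0 ≤ c.lamR * Real.pi * c.R ^ 2 :=
    mul_nonneg (mul_nonneg c.lamR_pos.le Real.pi_pos.le) (sq_nonneg _)
  refine ⟨hpc, hN.coverageProbBS_eq hB hB0 hB1, fun k y =>
    ⟨(MulticastD2D.lintegral_condCoverage hN.poisson_X y 0).1, hN.coverageProb_eq hB hB0 hB1 k y,
      hN.coverageProbAssisted_eq hB hB0 hB1 k y⟩, hmean, hfin, ?_, ?_⟩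
  · rw [hassisted]
    exact ENNReal.add_ne_top.2 ⟨h1, h2⟩
  -- `pc ≤ 1` turns the truncated difference `1 - pc` into a real one; the rest is rearrangement.
  · rw [hassisted, ENNReal.toReal_add h1 h2, ENNReal.toReal_mul, ENNReal.toReal_mul,
      ENNReal.toReal_sub_of_le (by simpa using hpc.2) ENNReal.one_ne_top,
      ENNReal.toReal_ofReal hpc.1, ENNReal.toReal_ofReal hM, ENNReal.toReal_one]
    ring
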